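/- Let $M\subset\mathbb{C}^n$ be a compact smooth CR-submanifold of hypersurface type of CR-dimension $m-1$; that is, $M$ is a smooth embedded submanifold of real dimension $2m-1$ and, for every $z\in M$, the complex tangent space $T^{\mathbb C}_z(M)=T_z(M)\cap J\,T_z(M)$ ($J$ = multiplication by $i$) has complex dimension $m-1$. It is identified with $T^{1,0}_z(M)$ via $(a_1,\dots,a_n)\leftrightarrow\sum_j a_j\,\partial/\partial z_j$, and orthonormality in $T^{1,0}_z(M)$ refers to the Hermitian inner product of $\mathbb{C}^n$. For a (local) smooth real vector field $T$ on $M$ transversal to $T^{\mathbb C}(M)$, the Levi form is defined by $\frac1{2i}[X,\overline Y]\equiv L_z(X,\overline Y)\,T$ modulo $T^{1,0}_z(M)\oplus T^{0,1}_z(M)$, for sections $X,Y$ of $T^{1,0}(M)$; its nullspace is $\mathcal N_z=\{a\in T^{1,0}_z(M): L_z(a,\overline b)=0 \text{ for all } b\in T^{1,0}_z(M)\}$. Assume that $M$ is pseudoconvex: every point of $M$ has a neighborhood on which the Levi form is (positive or negative) semidefinite. Let $1\le q\le m-1$. Then the following two conditions are equivalent. (i) ($M$ satisfies property $(P_q)$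 on the nullspace of the Levi form.) For every $A>0$ there is a smooth function $\lambda$ on a neighborhood of $M$ with $0\le\lambda\le1$ and $$\sum_{s=1}^q\sum_{j,k=1}^n\frac{\partial^2\lambda(z)}{\partial z_j\partial\overline{z_k}}(L_s)_j\overline{(L_s)_k}\ \ge\ A$$ whenever $z\in M$ and $L_1,\dots,L_q\in\mathcal N_z$ are orthonormal. (ii) ($M$ satisfies property $(P_q)$.) For every $A>0$ there is a $C^2$ function $\lambda$ on a neighborhood $U$ of $M$ with $0\le\lambda\le1$ and $$\sum_{|K|=q-1}^{\prime}\ \sum_{j,k=1}^n\frac{\partial^2\lambda(z)}{\partial z_j\partial\overline{z_k}}\,w_{jK}\overline{w_{kK}}\ \ge\ A\sum_{|I|=q}^{\prime}|w_I|^2$$ for all $z\in U$ and all $(0,q)$-forms $w=\sum_{|I|=q}^{\prime}w_I\,d\overline z^I$, where primes denote summation over strictly increasing multi-indices and $w_I$ is defined for all $I$ by skew symmetry. If in addition $M$ is orientable, then (i) and (ii) are also equivalent to (iii) ($M$ satisfies property (CR-$P_q$).) There is a smooth real vector field $T$ defined on all of $M$, transversal to $T^{\mathbb C}(M)$, whose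 Levi form is positive semidefinite, such that, with $\eta$ the real $1$-form on $M$ that annihilates $T^{1,0}(M)\oplus T^{0,1}(M)$ and satisfies $\eta(T)=1$, and with $\gamma=\frac i2\eta$: for every $A>0$ there are a smooth function $\lambda$ on a neighborhood of $M$ with $0\le\lambda\le1$ and a real constant $A_0$ such that $$\sum_{j=1}^q\Big\langle \tfrac12\big(\partial_b\overline\partial_b\lambda-\overline\partial_b\partial_b\lambda\big)+A_0\,d\gamma,\ L_j\wedge\overline{L_j}\Big\rangle\ \ge\ A$$ for all $z\in M$ and all orthonormal $L_1,\dots,L_q\in T^{1,0}_z(M)$. Here $\partial_b$ and $\overline\partial_b$ are the tangential Cauchy–Riemann operators of $M$, forms on $M$ being taken to vanish on the orthogonal complement of $T^{1,0}(M)\oplus T^{0,1}(M)$, and $\langle\omega,L\wedge\overline L\rangle=\omega(L,\overline L)$ with $d\eta(X,Y)=X\eta(Y)-Y\eta(X)-\eta([X,Y])$. -/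

import Mathlib

open scoped ContDiff

noncomputable section

namespace CRSub

/-- Complex Euclidean space `ℂⁿ` with its Hermitian inner product. -/
abbrev Cn (n : ℕ) := EuclideanSpace ℂ (Fin n)

/-- The complex structure `J` of `ℂⁿ` (multiplication by `i`). -/
def J (n : ℕ) : Cn n →L[ℝ] Cn n := Complex.I • ContinuousLinearMap.id ℝ (Cn n)

/-! ### Submanifolds of `ℂⁿ` and their tangent spaces -/

/-- `M ⊆ ℂⁿ` is a smooth (embedded) submanifold of real dimension `k`: near each of its points it is
the zero set of `2n - k` smooth real functions with linearly independent differentials. -/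
def IsSmoothSubmanifold {n : ℕ} (k : ℕ) (M : Set (Cn n)) : Prop :=
  ∃ d : ℕ, d + k = 2 * n ∧ ∀ p ∈ M, ∃ (U : Set (Cn n)) (ρ : Cn n → EuclideanSpace ℝ (Fin d)),
    IsOpen U ∧ p ∈ U ∧ ContDiffOn ℝ ∞ ρ U ∧
      (∀ x ∈ U, Function.Surjective (fderiv ℝ ρ x)) ∧ M ∩ U = {x ∈ U | ρ x = 0}

/-- The real tangent space `T_z(M)`. For a submanifold the tangent cone is already the tangent
space; the span makes it a subspace by construction. -/
def tangentSpace {n : ℕ} (M : Set (Cn n)) (z : Cn n) : Submodule ℝ (Cn n) :=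
  Submodule.span ℝ (tangentConeAt ℝ M z)

/-- The complex tangent space `T_z(M) ∩ J T_z(M)`. A vector `a` of it also stands for the
vector `∑ a_j ∂/∂z_j` of `T^{1,0}_z(M)`. -/
def complexTangent {n : ℕ} (M : Set (Cn n)) (z : Cn n) : Submodule ℂ (Cn n) where
  carrier := {v | v ∈ tangentSpace M z ∧ Complex.I • v ∈ tangentSpace M z}
  add_mem' := by
    rintro a b ⟨ha, ha'⟩ ⟨hb, hb'⟩
    refine ⟨add_mem ha hb, ?_⟩
    rw [smul_add]
    exact add_mem ha' hb'
  zero_mem' := by simp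
  smul_mem' := by
    rintro c x ⟨hx, hx'⟩
    have h1 : c • x = c.re • x + c.im • (Complex.I • x) := by
      conv_lhs => rw [← Complex.re_add_im c]
      rw [add_smul, mul_smul, Complex.coe_smul, Complex.coe_smul]
    have h2 : Complex.I • (c • x) = c.re • (Complex.I • x) - c.im • x := by
      rw [h1, smul_add, smul_comm Complex.I c.re x, smul_comm Complex.I c.im, smul_smul,
        Complex.I_mul_I, neg_one_smul, smul_neg, sub_eq_add_neg]
    constructor
    · rw [h1]
      exact add_mem (Submodule.smul_mem _ _ hx) (Submodule.smul_mem _ _ hx')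
    · rw [h2]
      exact sub_mem (Submodule.smul_mem _ _ hx') (Submodule.smul_mem _ _ hx)

/-- `M` is a smooth CR-submanifold of hypersurface type and of CR-dimension `m - 1`: its real
dimension is `2m - 1` and all its complex tangent spaces have complex dimension `m - 1`. -/
def IsCRHypersurfaceType {n : ℕ} (m : ℕ) (M : Set (Cn n)) : Prop :=
  IsSmoothSubmanifold (2 * m - 1) M ∧
    ∀ z ∈ M, Module.finrank ℂ (complexTangent M z) + 1 = m

/-- `M`, of real dimension `k`, is orientable: it carries a nowhere vanishing smooth
differential form of top degree. (`ContDiffOn ℝ ∞ θ M` is smoothness along `M`.) -/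
def IsOrientable {n : ℕ} (k : ℕ) (M : Set (Cn n)) : Prop :=
  ∃ θ : Cn n → (Cn n) [⋀^Fin k]→L[ℝ] ℝ, ContDiffOn ℝ ∞ θ M ∧
    ∀ x ∈ M, ∃ v : Fin k → Cn n, (∀ i, v i ∈ tangentSpace M x) ∧ θ x v ≠ 0

/-! ### Complexified vectors, and the Levi form -/

/-- A smooth section of the complex tangent bundle; it also stands for the section
`∑ X_j ∂/∂z_j` of `T^{1,0}(M)`. -/
def IsSection {n : ℕ} (M : Set (Cn n)) (X : Cn n → Cn n) : Prop :=
  ContDiffOn ℝ ∞ X M ∧ ∀ x ∈ M, X x ∈ complexTangent M x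

/-- A smooth real vector field `T`, tangential to `M` and transversal to the complex tangent
bundle, defined on the relatively open subset `M ∩ V` of `M`. -/
def IsTransversal {n : ℕ} (M V : Set (Cn n)) (T : Cn n → Cn n) : Prop :=
  ContDiffOn ℝ ∞ T (M ∩ V) ∧
    ∀ x ∈ M ∩ V, T x ∈ tangentSpace M x ∧ T x ∉ complexTangent M x

/-- A complexified vector `u + √-1 v` of `ℂⁿ = ℝ²ⁿ` is the pair `(u, v)`. The vector
`∑ a_j ∂/∂z_j` is `(a - √-1 J a) / 2`. -/
def vec10 {n : ℕ} (a : Cn n) : Cn n × Cn n := ((1 / 2 : ℝ) • a, -((1 / 2 : ℝ) • J n a))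

/-- The conjugate `(a + √-1 J a) / 2` of `∑ a_j ∂/∂z_j`. -/
def vec01 {n : ℕ} (a : Cn n) : Cn n × Cn n := ((1 / 2 : ℝ) • a, (1 / 2 : ℝ) • J n a)

/-- The Lie bracket on `M`, at `z`, of complexified vector fields tangential to `M`: the complex
bilinear extension of the bracket of real vector fields. -/
def cBracket {n : ℕ} (M : Set (Cn n)) (Z W : Cn n → Cn n × Cn n) (z : Cn n) : Cn n × Cn n :=
  (VectorField.lieBracketWithin ℝ (fun x => (Z x).1) (fun x => (W x).1) M z
      - VectorField.lieBracketWithin ℝ (fun x => (Z x).2) (fun x => (W x).2) M z,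
    VectorField.lieBracketWithin ℝ (fun x => (Z x).1) (fun x => (W x).2) M z
      + VectorField.lieBracketWithin ℝ (fun x => (Z x).2) (fun x => (W x).1) M z)

/-- Orthogonal projection of `ℂⁿ` onto the complex tangent space at `x`. -/
def proj {n : ℕ} (M : Set (Cn n)) (x : Cn n) : Cn n →L[ℂ] Cn n :=
  (complexTangent M x).starProjection

/-- The component of `T` that is orthogonal to the complex tangent space. -/
def normalPart {n : ℕ} (M : Set (Cn n)) (T : Cn n → Cn n) (x : Cn n) : Cn n :=
  T x - proj M x (T x)

/-- The real `1`-form `η` on `M` that annihilates `T^{1,0}(M) ⊕ T^{0,1}(M)` and is one on `T`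
(extended by zero to the orthogonal complement of `T_x(M)`). On vectors of `T_x(M)`, it is the
coefficient of `T` modulo the complex tangent space. -/
def eta {n : ℕ} (M : Set (Cn n)) (T : Cn n → Cn n) (x : Cn n) : Cn n →L[ℝ] ℝ :=
  (‖normalPart M T x‖ ^ 2)⁻¹ •
    (Complex.reCLM.comp ((innerSL ℂ (normalPart M T x)).restrictScalars ℝ))

/-- The Levi form `L_z(X, Ȳ)` relative to `T`: the coefficient of `T` in `(1/2i) [X, Ȳ]`, modulo
`T^{1,0}_z(M) ⊕ T^{0,1}_z(M)`, for sections `X`, `Y` of `T^{1,0}(M)`. -/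
def leviForm {n : ℕ} (M : Set (Cn n)) (T X Y : Cn n → Cn n) (z : Cn n) : ℂ :=
  (1 / (2 * Complex.I)) *
    ((eta M T z (cBracket M (fun x => vec10 (X x)) (fun x => vec01 (Y x)) z).1 : ℂ)
      + Complex.I * (eta M T z (cBracket M (fun x => vec10 (X x)) (fun x => vec01 (Y x)) z).2 : ℂ))

/-- The Levi form relative to `T` is positive semidefinite on `M ∩ V`. -/
def LeviNonneg {n : ℕ} (M V : Set (Cn n)) (T : Cn n → Cn n) : Prop :=
  ∀ z ∈ M ∩ V, ∀ X, IsSection M X → 0 ≤ (leviForm M T X X z).re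

/-- The Levi form relative to `T` is negative semidefinite on `M ∩ V`. -/
def LeviNonpos {n : ℕ} (M V : Set (Cn n)) (T : Cn n → Cn n) : Prop :=
  ∀ z ∈ M ∩ V, ∀ X, IsSection M X → (leviForm M T X X z).re ≤ 0

/-- `M` is pseudoconvex: every point has a neighborhood where the Levi form is (positive or
negative) semidefinite. -/
def IsPseudoconvex {n : ℕ} (M : Set (Cn n)) : Prop :=
  ∀ p ∈ M, ∃ (V : Set (Cn n)) (T : Cn n → Cn n), IsOpen V ∧ p ∈ V ∧ IsTransversal M V T ∧
    (LeviNonneg M V T ∨ LeviNonpos M V T)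

/-- The nullspace `𝒩_z` of the Levi form at `z` (the Levi forms relative to two choices of `T` are
nonzero multiples of each other). -/
def leviNull {n : ℕ} (M : Set (Cn n)) (z : Cn n) : Set (Cn n) :=
  {a | a ∈ complexTangent M z ∧
    ∀ (V : Set (Cn n)) (T : Cn n → Cn n), IsOpen V → z ∈ V → IsTransversal M V T →
      ∀ X Y, IsSection M X → IsSection M Y → X z = a → leviForm M T X Y z = 0}

/-! ### Complex Hessians and the first two conditions -/

/-- `∂f` at `x`, as a complex valued real linear form: `∑ ∂f/∂z_j dz_j`. -/
def del {n : ℕ} (f : Cn n → ℂ) (x : Cn n) : Cn n →L[ℝ] ℂ :=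
  (1 / 2 : ℂ) • (fderiv ℝ f x - Complex.I • (fderiv ℝ f x).comp (J n))

/-- `∂̄f` at `x`, as a complex valued real linear form: `∑ ∂f/∂z̄_j dz̄_j`. -/
def delbar {n : ℕ} (f : Cn n → ℂ) (x : Cn n) : Cn n →L[ℝ] ℂ :=
  (1 / 2 : ℂ) • (fderiv ℝ f x + Complex.I • (fderiv ℝ f x).comp (J n))

/-- The entry `∂²f/∂z_j∂z̄_k` of the complex Hessian; on the coordinate vectors `e_j`, the forms
`∂g` and `∂̄g` take the values `∂g/∂z_j` and `∂g/∂z̄_j`. -/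
def complexHess {n : ℕ} (f : Cn n → ℝ) (z : Cn n) (j k : Fin n) : ℂ :=
  del (fun x => delbar (fun y => (f y : ℂ)) x (EuclideanSpace.single k 1)) z
    (EuclideanSpace.single j 1)

/-- The multi-index `jK = (j, k_1, …, k_{q-1})`. -/
def prepend {n q : ℕ} (j : Fin n) (K : Fin (q - 1) → Fin n) : Fin q → Fin n :=
  fun i => if h : (i : ℕ) = 0 then j else K ⟨(i : ℕ) - 1, by omega⟩

/-- Coefficients `w_J`, `|J| = q`, of a `(0,q)`-form, defined for all multi-indices `J` by skew
symmetry. -/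
def IsSkew {n q : ℕ} (w : (Fin q → Fin n) → ℂ) : Prop :=
  ∀ (σ : Equiv.Perm (Fin q)) (I : Fin q → Fin n),
    w (I ∘ σ) = ((Equiv.Perm.sign σ : ℤ) : ℂ) * w I

open Classical in
/-- Summation over the strictly increasing multi-indices of length `p` only. -/
def sumIncr {n p : ℕ} {R : Type} [AddCommMonoid R] (F : (Fin p → Fin n) → R) : R :=
  ∑ K ∈ Finset.univ.filter (fun K : Fin p → Fin n => StrictMono K), F K

/-- Property `(P_q)` of a set in `ℂⁿ`, for `q ≥ 1`. -/
def PropertyP {n : ℕ} (q : ℕ) (M : Set (Cn n)) : Prop :=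
  ∀ A : ℝ, 0 < A → ∃ (U : Set (Cn n)) (lam : Cn n → ℝ), IsOpen U ∧ M ⊆ U ∧
    ContDiffOn ℝ 2 lam U ∧ (∀ z ∈ U, 0 ≤ lam z ∧ lam z ≤ 1) ∧
    ∀ z ∈ U, ∀ w : (Fin q → Fin n) → ℂ, IsSkew w →
      A * sumIncr (fun I => ‖w I‖ ^ 2) ≤
        (sumIncr (fun K : Fin (q - 1) → Fin n => ∑ j, ∑ k,
          complexHess lam z j k * w (prepend j K) * star (w (prepend k K)))).re

/-- Property `(P_q)` on the nullspace of the Levi form. -/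
def PropertyPNull {n : ℕ} (q : ℕ) (M : Set (Cn n)) : Prop :=
  ∀ A : ℝ, 0 < A → ∃ (U : Set (Cn n)) (lam : Cn n → ℝ), IsOpen U ∧ M ⊆ U ∧
    ContDiffOn ℝ ∞ lam U ∧ (∀ z ∈ U, 0 ≤ lam z ∧ lam z ≤ 1) ∧
    ∀ z ∈ M, ∀ L : Fin q → Cn n, Orthonormal ℂ L → (∀ s, L s ∈ leviNull M z) →
      A ≤ (∑ s, ∑ j, ∑ k, complexHess lam z j k * L s j * star (L s k)).re

/-! ### The tangential Cauchy-Riemann operators and the third condition -/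

/-- A linear form as an alternating `1`-form. -/
def oneForm {n : ℕ} (f : Cn n →L[ℝ] ℂ) : (Cn n) [⋀^Fin 1]→L[ℝ] ℂ :=
  ContinuousAlternatingMap.ofSubsingleton ℝ (Cn n) ℂ (0 : Fin 1) f

/-- The tangential part `∂_b f` of `∂f`, that is `∑ L_j(f) ω_j` for an orthonormal basis
`L_1, …, L_{m-1}` of `T^{1,0}(M)` with dual basis `ω_j`, as a `1`-form on `M`. Forms on `M` vanish
on the orthogonal complement of the complex tangent space. -/
def delb {n : ℕ} (M : Set (Cn n)) (f : Cn n → ℂ) (x : Cn n) : (Cn n) [⋀^Fin 1]→L[ℝ] ℂ :=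
  oneForm ((del f x).comp ((proj M x).restrictScalars ℝ))

/-- The tangential part `∂̄_b f = ∑ L̄_j(f) ω̄_j` of `∂̄f`, as a `1`-form on `M`. -/
def delbarb {n : ℕ} (M : Set (Cn n)) (f : Cn n → ℂ) (x : Cn n) : (Cn n) [⋀^Fin 1]→L[ℝ] ℂ :=
  oneForm ((delbar f x).comp ((proj M x).restrictScalars ℝ))

/-- The `(1,1)`-part `(θ(u,v) + θ(Ju,Jv)) / 2` of a `2`-form. -/
def part11 {n : ℕ} (θ : (Cn n) [⋀^Fin 2]→L[ℝ] ℂ) : (Cn n) [⋀^Fin 2]→L[ℝ] ℂ :=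
  (1 / 2 : ℝ) • (θ + θ.compContinuousLinearMap (J n))

/-- The tangential `(1,1)`-part of the exterior derivative on `M` of a `1`-form `α` on `M`. This is
`∂_b α` if `α` is a `(0,1)`-form, and `∂̄_b α` if `α` is a `(1,0)`-form. -/
def dTan11 {n : ℕ} (M : Set (Cn n)) (α : Cn n → (Cn n) [⋀^Fin 1]→L[ℝ] ℂ) (z : Cn n) :
    (Cn n) [⋀^Fin 2]→L[ℝ] ℂ :=
  part11 ((extDerivWithin α M z).compContinuousLinearMap ((proj M z).restrictScalars ℝ))

/-- The form `γ = (i/2) η` on `M`. -/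
def gammaForm {n : ℕ} (M : Set (Cn n)) (T : Cn n → Cn n) (x : Cn n) :
    (Cn n) [⋀^Fin 1]→L[ℝ] ℂ :=
  oneForm ((Complex.I / 2) • Complex.ofRealCLM.comp (eta M T x))

/-- The value of (the complex bilinear extension of) a `2`-form on complexified vectors. -/
def pairing {n : ℕ} (θ : (Cn n) [⋀^Fin 2]→L[ℝ] ℂ) (Z W : Cn n × Cn n) : ℂ :=
  (θ ![Z.1, W.1] - θ ![Z.2, W.2]) + Complex.I * (θ ![Z.1, W.2] + θ ![Z.2, W.1])

/-- The form `(1/2)(∂_b ∂̄_b λ - ∂̄_b ∂_b λ) + A₀ dγ` at `z`. -/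
def crForm {n : ℕ} (M : Set (Cn n)) (T : Cn n → Cn n) (lam : Cn n → ℝ) (A₀ : ℝ) (z : Cn n) :
    (Cn n) [⋀^Fin 2]→L[ℝ] ℂ :=
  (1 / 2 : ℝ) • (dTan11 M (delbarb M (fun y => (lam y : ℂ))) z
      - dTan11 M (delb M (fun y => (lam y : ℂ))) z)
    + A₀ • extDerivWithin (gammaForm M T) M z

/-- Property `(CR-P_q)`, with `T` a global transversal field for which the Levi form is positive
semidefinite (the condition does not depend on this choice of `T`). -/
def PropertyCRP {n : ℕ} (q : ℕ) (M : Set (Cn n)) : Prop :=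
  ∃ T : Cn n → Cn n, IsTransversal M Set.univ T ∧ LeviNonneg M Set.univ T ∧
    ∀ A : ℝ, 0 < A → ∃ (U : Set (Cn n)) (lam : Cn n → ℝ) (A₀ : ℝ), IsOpen U ∧ M ⊆ U ∧
      ContDiffOn ℝ ∞ lam U ∧ (∀ z ∈ U, 0 ≤ lam z ∧ lam z ≤ 1) ∧
      ∀ z ∈ M, ∀ L : Fin q → Cn n, Orthonormal ℂ L → (∀ j, L j ∈ complexTangent M z) →
        A ≤ (∑ j, pairing (crForm M T lam A₀ z) (vec10 (L j)) (vec01 (L j))).re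

end CRSub

end

/-!
All conditions are compared with a single one, `SmoothPropertyP`: for every `A` there is a smooth
function with values in `[0, 1]` near `M` whose complex Hessian, summed over *any* orthonormal
`q`-tuple of vectors of `ℂⁿ` at a point of `M`, exceeds `A`. By `form_ineq_iff` this is the
inequality on `(0,q)`-forms of property `(P_q)`: in a unitary basis that diagonalizes the Hessian,
both sides are weighted sums over increasing multi-indices. It persists near `M` by compactness, and
mollification (`exists_smooth_jHess_near`) replaces `C²` functions by smooth ones.

The link between the Levi form and Hessians is `IsCRHypersurfaceType.jHess_eq_leviForm`: if `f`
vanishes on `M`, its complex Hessian on complex tangent vectors is, up to a positive constant, the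
Levi form times the derivative of `f` along `JT`. To see it, differentiate the identities `X f = 0`
and `(JX) f = 0`, valid on `M` for sections `X` of the complex tangent bundle. On a pseudoconvex `M`
one can choose, with local retractions onto `M` and cutoff functions, smooth functions `h` and `r`
that vanish on `M` (`exists_controlPair`), such that the Hessian of `r` is nonnegative with kernel
the complex tangent space and the Hessian of `h` is nonnegative on that space with kernel the
nullspace of the Levi form. If `λ` has a large Hessian on the nullspace, then by compactness `λ + C₁
h + C₂ r` has a large Hessian in all directions once `C₁` and then `C₂` are large, and its values on
`M` are those of `λ` (`PropertyPNull.smoothPropertyP`).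

For the condition on the tangential Cauchy-Riemann operators, a computation with `[X, JX]`
(`IsCRHypersurfaceType.pairing_crForm`) shows that its form is, on complex tangent vectors, the
complex Hessian of `λ` plus a multiple `A₀ - dλ(JN)` of the Levi form, where `N` is the part of `T`
orthogonal to the complex tangent space. The multiple disappears on the nullspace, and is
nonnegative on the compact `M` for large `A₀`. It remains to produce the global field `T`. Two local
fields with nonnegative Levi form point to the same side of the complex tangent bundle unless the
Levi form vanishes on an open piece of `M`; the maximum principle on such a Levi flat piece
contradicts the existence of bounded functions with large Hessian (`exists_leviForm_ne_zero`). The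
local fields can therefore be glued by cutoff functions.
-/

namespace CRSub

/-! ### Hermitian forms on `(0,q)`-forms and on orthonormal `q`-tuples -/

/-- The sesquilinear form with matrix `H`, linear in the first argument. -/
noncomputable def sesq {n : ℕ} (H : Fin n → Fin n → ℂ) (a b : Cn n) : ℂ :=
  ∑ j, ∑ k, H j k * a j * star (b k)

theorem sesq_sum_smul {n : ℕ} {ι : Type*} [Fintype ι] (H : Fin n → Fin n → ℂ) (c d : ι → ℂ)
    (a b : ι → Cn n) : sesq H (∑ i, c i • a i) (∑ l, d l • b l) =
      ∑ i, ∑ l, c i * star (d l) * sesq H (a i) (b l) := by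
  have h1 : ∀ b' : Cn n, sesq H (∑ i, c i • a i) b' = ∑ i, c i * sesq H (a i) b' := by
    intro b'
    simp only [sesq, WithLp.ofLp_sum, Finset.sum_apply, PiLp.smul_apply, smul_eq_mul,
      Finset.mul_sum, Finset.sum_mul]
    conv_rhs =>
      rw [Finset.sum_comm]
      enter [2, j]
      rw [Finset.sum_comm]
    exact Finset.sum_congr rfl fun j _ => Finset.sum_congr rfl fun k _ =>
      Finset.sum_congr rfl fun i _ => by ring
  have h2 : ∀ a' : Cn n, sesq H a' (∑ l, d l • b l) = ∑ l, star (d l) * sesq H a' (b l) := by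
    intro a'
    simp only [sesq, WithLp.ofLp_sum, Finset.sum_apply, PiLp.smul_apply, smul_eq_mul,
      Finset.mul_sum, star_sum, star_mul']
    conv_rhs =>
      rw [Finset.sum_comm]
      enter [2, j]
      rw [Finset.sum_comm]
    exact Finset.sum_congr rfl fun j _ => Finset.sum_congr rfl fun k _ =>
      Finset.sum_congr rfl fun i _ => by ring
  rw [h1]
  refine Finset.sum_congr rfl fun i _ => ?_
  rw [h2, Finset.mul_sum]
  exact Finset.sum_congr rfl fun l _ => by ring

theorem sum_eq_factorial_smul_sumIncr {n p : ℕ} {R : Type} [AddCommMonoid R]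
    (F : (Fin p → Fin n) → R) (hF : ∀ I (σ : Equiv.Perm (Fin p)), F (I ∘ σ) = F I)
    (h0 : ∀ I, ¬ Function.Injective I → F I = 0) :
    ∑ I, F I = p.factorial • sumIncr F := by
  classical
  have h1 : ∑ I, F I = ∑ I ∈ Finset.univ.filter (fun I : Fin p → Fin n => Function.Injective I),
      F I := by
    rw [Finset.sum_filter]
    refine Finset.sum_congr rfl fun I _ => ?_
    split_ifs with h
    · rfl
    · exact h0 I h
  have h2 : ∑ x ∈ (Finset.univ.filter (fun K : Fin p → Fin n => StrictMono K)) ×ˢ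
      (Finset.univ : Finset (Equiv.Perm (Fin p))), F (x.1 ∘ x.2) =
      ∑ I ∈ Finset.univ.filter (fun I : Fin p → Fin n => Function.Injective I), F I := by
    refine Finset.sum_nbij' (fun x => x.1 ∘ x.2) (fun I => (I ∘ Tuple.sort I, (Tuple.sort I)⁻¹))
      ?_ ?_ ?_ ?_ ?_
    · rintro ⟨K, σ⟩ h
      simp only [Finset.mem_product, Finset.mem_filter, Finset.mem_univ, true_and, and_true] at h ⊢
      exact h.injective.comp σ.injective
    · intro I h
      simp only [Finset.mem_product, Finset.mem_filter, Finset.mem_univ, true_and, and_true] at h ⊢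
      exact (Tuple.monotone_sort I).strictMono_of_injective (h.comp (Tuple.sort I).injective)
    · rintro ⟨K, σ⟩ h
      simp only [Finset.mem_product, Finset.mem_filter, Finset.mem_univ, true_and, and_true] at h
      have h3 : (K ∘ σ) ∘ Tuple.sort (K ∘ σ) = K := by
        rw [Tuple.comp_perm_comp_sort_eq_comp_sort, Tuple.sort_eq_refl_iff_monotone.2 h.monotone]
        rfl
      have h4 : σ * Tuple.sort (K ∘ σ) = 1 := by
        ext i
        have := congrFun h3 i
        simpa using congrArg Fin.val (h.injective this)
      refine Prod.ext h3 ?_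
      exact (eq_inv_of_mul_eq_one_left h4).symm
    · intro I _
      ext i
      simp
    · intro x _
      rfl
  rw [h1, ← h2, Finset.sum_product]
  simp only [hF, Finset.sum_const, Finset.card_univ, Fintype.card_perm, Fintype.card_fin]
  rw [Finset.sum_nsmul]
  rfl

theorem sum_cons {n p : ℕ} {R : Type} [AddCommMonoid R] (F : (Fin (p + 1) → Fin n) → R) :
    ∑ I, F I = ∑ a, ∑ K, F (Fin.cons a K) := by
  rw [← (Fin.consEquiv (fun _ : Fin (p + 1) => Fin n)).sum_comp F, Fintype.sum_prod_type]
  rfl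

theorem IsSkew.eq_zero {n p : ℕ} {w : (Fin p → Fin n) → ℂ} (hw : IsSkew w) {I : Fin p → Fin n}
    (hI : ¬ Function.Injective I) : w I = 0 := by
  simp only [Function.Injective, not_forall] at hI
  obtain ⟨a, b, hab, hne⟩ := hI
  have h1 := hw (Equiv.swap a b) I
  have h2 : I ∘ Equiv.swap a b = I := by
    ext i
    simp only [Function.comp_apply]
    by_cases hia : i = a
    · subst hia; rw [Equiv.swap_apply_left, hab]
    · by_cases hib : i = b
      · subst hib; rw [Equiv.swap_apply_right, hab]
      · rw [Equiv.swap_apply_of_ne_of_ne hia hib]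
  rw [h2, Equiv.Perm.sign_swap hne] at h1
  simp at h1
  exact self_eq_neg.mp h1

theorem IsSkew.norm_comp {n p : ℕ} {w : (Fin p → Fin n) → ℂ} (hw : IsSkew w)
    (I : Fin p → Fin n) (σ : Equiv.Perm (Fin p)) : ‖w (I ∘ σ)‖ = ‖w I‖ := by
  rw [hw]
  rcases Int.units_eq_one_or (Equiv.Perm.sign σ) with h | h <;> simp [h]

theorem IsSkew.sum_sq {n p : ℕ} {w : (Fin p → Fin n) → ℂ} (hw : IsSkew w) :
    ∑ I, ‖w I‖ ^ 2 = p.factorial * sumIncr (fun I => ‖w I‖ ^ 2) := by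
  rw [sum_eq_factorial_smul_sumIncr _ (fun I σ => by rw [hw.norm_comp])
    (fun I hI => by simp [hw.eq_zero hI]), nsmul_eq_mul]

/-- The vector `(w_{jK})_j` of coefficients of a form with the last indices fixed. -/
noncomputable def slice {n p : ℕ} (w : (Fin (p + 1) → Fin n) → ℂ) (K : Fin p → Fin n) : Cn n :=
  WithLp.toLp 2 (fun j => w (Fin.cons j K))

theorem prepend_eq_cons {n p : ℕ} (j : Fin n) (K : Fin p → Fin n) :
    (prepend (q := p + 1) j K : Fin (p + 1) → Fin n) = Fin.cons j K := by
  ext i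
  refine Fin.cases ?_ (fun i => ?_) i <;> simp [prepend]

theorem cons_comp_decompose {n p : ℕ} (j : Fin n) (K : Fin p → Fin n)
    (σ : Equiv.Perm (Fin p)) : (Fin.cons j (K ∘ σ) : Fin (p + 1) → Fin n) =
      (Fin.cons j K : Fin (p + 1) → Fin n) ∘ Equiv.Perm.decomposeFin.symm (0, σ) := by
  ext i
  refine Fin.cases ?_ (fun i => ?_) i <;> simp

theorem IsSkew.sesq_slice {n p : ℕ} {w : (Fin (p + 1) → Fin n) → ℂ} (hw : IsSkew w)
    (H : Fin n → Fin n → ℂ) :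
    ∑ K, sesq H (slice w K) (slice w K) =
      p.factorial * sumIncr (fun K => sesq H (slice w K) (slice w K)) := by
  rw [sum_eq_factorial_smul_sumIncr, nsmul_eq_mul]
  · intro K σ
    simp only [sesq, slice, cons_comp_decompose, hw _ (Fin.cons _ _ : Fin (p + 1) → Fin n)]
    refine Finset.sum_congr rfl fun j _ => Finset.sum_congr rfl fun k _ => ?_
    rcases Int.units_eq_one_or (Equiv.Perm.sign (Equiv.Perm.decomposeFin.symm (0, σ))) with h | h <;>
      simp [h]
  · intro K hK
    have : ∀ j, w (Fin.cons j K) = 0 := fun j => hw.eq_zero fun hinj => hK fun a b hab => by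
      have := @hinj a.succ b.succ (by simpa using hab)
      simpa using this
    simp [sesq, slice, this]

/-- The real part of a sesquilinear form is diagonal in a suitable orthonormal basis, that of the
eigenvectors of its Hermitian part. -/
theorem exists_diagonalization {n : ℕ} (H : Fin n → Fin n → ℂ) :
    ∃ (u : OrthonormalBasis (Fin n) ℂ (Cn n)) (μ : Fin n → ℝ),
      ∀ v, (sesq H v v).re = ∑ a, μ a * ‖inner ℂ (u a) v‖ ^ 2 := by
  let G : Matrix (Fin n) (Fin n) ℂ := fun k j => (1 / 2 : ℂ) * (H j k + star (H k j))
  have hG : G.IsHermitian := by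
    ext j k
    change star ((1 / 2 : ℂ) * (H j k + star (H k j))) = (1 / 2 : ℂ) * (H k j + star (H j k))
    simp only [star_mul', star_add, star_star]
    rw [add_comm (star (H j k))]
    simp
  have hT : (Matrix.toEuclideanLin G).IsSymmetric := Matrix.isSymmetric_toEuclideanLin_iff.2 hG
  have hn : Module.finrank ℂ (Cn n) = n := by simp
  refine ⟨hT.eigenvectorBasis hn, hT.eigenvalues hn, fun v => ?_⟩
  set u := hT.eigenvectorBasis hn
  have h1 : inner ℂ v (Matrix.toEuclideanLin G v) =
      ∑ a, ((hT.eigenvalues hn a * ‖inner ℂ (u a) v‖ ^ 2 : ℝ) : ℂ) := by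
    rw [← u.sum_inner_mul_inner]
    refine Finset.sum_congr rfl fun a _ => ?_
    rw [← hT, hT.apply_eigenvectorBasis, inner_smul_left]
    rw [← inner_conj_symm v (u a)]
    simp only [RCLike.ofReal_alg, Complex.ofReal_mul, Complex.ofReal_pow]
    have h3 := Complex.conj_mul' (inner ℂ (u a) v)
    rw [← h3]
    simp
    ring
  have h2 : (sesq H v v).re = (inner ℂ v (Matrix.toEuclideanLin G v)).re := by
    have h3 : inner ℂ v (Matrix.toEuclideanLin G v) =
        (1 / 2 : ℂ) * (sesq H v v + star (sesq H v v)) := by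
      have key : ∀ j, Matrix.toEuclideanLin G v j = ∑ k, G j k * v k := fun j => rfl
      simp only [sesq, PiLp.inner_apply, key, G, star_sum, star_mul', star_star]
      have h5 : ∑ j, ∑ k, H j k * v j * star (v k) =
          ∑ k, ∑ j, H j k * v j * star (v k) := Finset.sum_comm
      rw [h5, ← Finset.sum_add_distrib, Finset.mul_sum]
      refine Finset.sum_congr rfl fun j _ => ?_
      rw [← Finset.sum_add_distrib, Finset.mul_sum]
      simp only [RCLike.inner_apply, Finset.sum_mul]
      refine Finset.sum_congr rfl fun k _ => ?_
      simp
      ring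
    rw [h3]
    simp
    ring
  rw [h2, h1, ← Complex.ofReal_sum, Complex.ofReal_re]

/-- The coefficients of a tensor `w` of degree `p` in the orthonormal basis `u`. -/
noncomputable def coeff {n p : ℕ} (u : OrthonormalBasis (Fin n) ℂ (Cn n))
    (w : (Fin p → Fin n) → ℂ) (I : Fin p → Fin n) : ℂ :=
  ∑ J, (∏ t, star (u (I t) (J t))) * w J

theorem coeff_cons {n p : ℕ} (u : OrthonormalBasis (Fin n) ℂ (Cn n))
    (w : (Fin (p + 1) → Fin n) → ℂ) (a : Fin n) (K : Fin p → Fin n) :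
    coeff u w (Fin.cons a K) = coeff u (fun J => inner ℂ (u a) (slice w J)) K := by
  unfold coeff
  rw [sum_cons, Finset.sum_comm]
  refine Finset.sum_congr rfl fun J _ => ?_
  simp only [PiLp.inner_apply, Finset.mul_sum]
  refine Finset.sum_congr rfl fun j _ => ?_
  simp [Fin.prod_univ_succ, slice]
  ring

theorem sum_sq_slice {n p : ℕ} (w : (Fin (p + 1) → Fin n) → ℂ) :
    ∑ K, ‖slice w K‖ ^ 2 = ∑ J, ‖w J‖ ^ 2 := by
  rw [sum_cons, Finset.sum_comm]
  refine Finset.sum_congr rfl fun K _ => ?_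
  rw [EuclideanSpace.norm_sq_eq]
  rfl

/-- Parseval's identity for tensors. -/
theorem sum_sq_coeff {n p : ℕ} (u : OrthonormalBasis (Fin n) ℂ (Cn n))
    (w : (Fin p → Fin n) → ℂ) : ∑ I, ‖coeff u w I‖ ^ 2 = ∑ J, ‖w J‖ ^ 2 := by
  induction p with
  | zero => simp [coeff]
  | succ p ih =>
    rw [sum_cons]
    simp only [coeff_cons, ih]
    rw [Finset.sum_comm, ← sum_sq_slice]
    exact Finset.sum_congr rfl fun K _ => u.sum_sq_norm_inner_right _

theorem IsSkew.coeff {n p : ℕ} {w : (Fin p → Fin n) → ℂ} (hw : IsSkew w)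
    (u : OrthonormalBasis (Fin n) ℂ (Cn n)) : IsSkew (coeff u w) := by
  intro σ I
  unfold CRSub.coeff
  rw [← (Equiv.arrowCongr σ (Equiv.refl (Fin n))).symm.sum_comp, Finset.mul_sum]
  refine Finset.sum_congr rfl fun J _ => ?_
  have h1 : (Equiv.arrowCongr σ (Equiv.refl (Fin n))).symm J = J ∘ σ := by
    ext i; simp [Equiv.arrowCongr]
  rw [h1, hw σ J]
  simp only [Function.comp_apply]
  rw [Equiv.prod_comp σ (fun t => star (u (I t) (J t)))]
  ring

theorem sesq_basis {n : ℕ} {H : Fin n → Fin n → ℂ} {u : OrthonormalBasis (Fin n) ℂ (Cn n)}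
    {μ : Fin n → ℝ} (h : ∀ v, (sesq H v v).re = ∑ a, μ a * ‖inner ℂ (u a) v‖ ^ 2) (b : Fin n) :
    (sesq H (u b) (u b)).re = μ b := by
  rw [h, Finset.sum_eq_single b]
  · simp
  · intro a _ hab
    simp [u.inner_eq_zero hab]
  · simp

/-- If the sum of the values of `H` over every orthonormal `q`-tuple is at least `A`, then so is
the form that `H` induces on skew tensors of degree `q = p + 1`. -/
theorem le_sum_sesq_slice {n p : ℕ} (H : Fin n → Fin n → ℂ) (A : ℝ)
    (hH : ∀ L : Fin (p + 1) → Cn n, Orthonormal ℂ L → A ≤ (∑ s, sesq H (L s) (L s)).re)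
    {w : (Fin (p + 1) → Fin n) → ℂ} (hw : IsSkew w) :
    A * ∑ I, ‖w I‖ ^ 2 ≤ (p + 1) * (∑ K, sesq H (slice w K) (slice w K)).re := by
  obtain ⟨u, μ, hu⟩ := exists_diagonalization H
  have h1 : (∑ K, sesq H (slice w K) (slice w K)).re = ∑ I, μ (I 0) * ‖coeff u w I‖ ^ 2 := by
    rw [Complex.re_sum, sum_cons]
    simp only [hu, coeff_cons, Fin.cons_zero]
    rw [Finset.sum_comm]
    refine Finset.sum_congr rfl fun a _ => ?_
    rw [← Finset.mul_sum, ← Finset.mul_sum, sum_sq_coeff]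
  have h2 : ∀ t : Fin (p + 1), ∑ I, μ (I 0) * ‖coeff u w I‖ ^ 2 =
      ∑ I, μ (I t) * ‖coeff u w I‖ ^ 2 := by
    intro t
    rw [← (Equiv.arrowCongr (Equiv.swap 0 t) (Equiv.refl (Fin n))).symm.sum_comp]
    refine Finset.sum_congr rfl fun I _ => ?_
    have h3 : (Equiv.arrowCongr (Equiv.swap 0 t) (Equiv.refl (Fin n))).symm I =
        I ∘ Equiv.swap 0 t := by
      ext i; simp [Equiv.arrowCongr]
    rw [h3, (hw.coeff u).norm_comp]
    simp
  have h3 : ((p : ℝ) + 1) * ∑ I, μ (I 0) * ‖coeff u w I‖ ^ 2 =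
      ∑ I, (∑ t, μ (I t)) * ‖coeff u w I‖ ^ 2 := by
    simp only [Finset.sum_mul]
    rw [Finset.sum_comm, Finset.sum_congr rfl (fun t _ => (h2 t).symm)]
    simp
  rw [h1, h3, ← sum_sq_coeff u, Finset.mul_sum]
  refine Finset.sum_le_sum fun I _ => ?_
  by_cases hI : Function.Injective I
  · refine mul_le_mul_of_nonneg_right ?_ (by positivity)
    have := hH (fun t => u (I t)) (u.orthonormal.comp I hI)
    simpa [Complex.re_sum, sesq_basis hu] using this
  · simp [(hw.coeff u).eq_zero hI]

/-- The skew tensor `L_1 ∧ ⋯ ∧ L_p`. -/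
noncomputable def wedge {n p : ℕ} (L : Fin p → Cn n) (I : Fin p → Fin n) : ℂ :=
  ∑ σ : Equiv.Perm (Fin p), ((Equiv.Perm.sign σ : ℤ) : ℂ) * ∏ t, L (σ t) (I t)

theorem isSkew_wedge {n p : ℕ} (L : Fin p → Cn n) : IsSkew (wedge L) := by
  intro τ I
  unfold wedge
  rw [← Equiv.sum_comp (Equiv.mulRight τ), Finset.mul_sum]
  refine Finset.sum_congr rfl fun σ _ => ?_
  simp only [Equiv.coe_mulRight, Equiv.Perm.sign_mul, Function.comp_apply, Equiv.Perm.coe_mul]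
  rw [Equiv.prod_comp τ (fun t => L (σ t) (I t))]
  push_cast
  ring

theorem sum_prod_mul_star {n p : ℕ} (a b : Fin p → Cn n) :
    ∑ K : Fin p → Fin n, (∏ t, a t (K t)) * star (∏ t, b t (K t)) =
      ∏ t, inner ℂ (b t) (a t) := by
  simp only [star_prod, ← Finset.prod_mul_distrib]
  rw [← Fintype.prod_sum (fun t j => a t j * star (b t j))]
  refine Finset.prod_congr rfl fun t _ => ?_
  rw [PiLp.inner_apply]
  rfl

theorem Orthonormal.prod_inner {n p : ℕ} {L : Fin p → Cn n} (hL : Orthonormal ℂ L)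
    {r : ℕ} (f g : Fin r → Fin p) :
    ∏ t, inner ℂ (L (f t)) (L (g t)) = if f = g then (1 : ℂ) else 0 := by
  split_ifs with h
  · subst h
    refine Finset.prod_eq_one fun t _ => ?_
    rw [inner_self_eq_norm_sq_to_K, hL.1]
    simp
  · obtain ⟨t, ht⟩ := Function.ne_iff.1 h
    exact Finset.prod_eq_zero (Finset.mem_univ t) (hL.2 ht)

theorem sum_sq_wedge {n p : ℕ} {L : Fin p → Cn n} (hL : Orthonormal ℂ L) :
    ∑ I, ‖wedge L I‖ ^ 2 = p.factorial := by
  have h1 : (((∑ I, ‖wedge L I‖ ^ 2 : ℝ)) : ℂ) = p.factorial := by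
    have h2 : ∀ I, ((‖wedge L I‖ ^ 2 : ℝ) : ℂ) = ∑ σ : Equiv.Perm (Fin p),
        ∑ τ : Equiv.Perm (Fin p), ((Equiv.Perm.sign σ : ℤ) : ℂ) * ((Equiv.Perm.sign τ : ℤ) : ℂ) *
          ((∏ t, L (σ t) (I t)) * star (∏ t, L (τ t) (I t))) := by
      intro I
      push_cast
      rw [← Complex.mul_conj' (wedge L I)]
      unfold wedge
      rw [map_sum, Finset.sum_mul_sum]
      refine Finset.sum_congr rfl fun σ _ => Finset.sum_congr rfl fun τ _ => ?_
      simp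
      ring
    rw [Complex.ofReal_sum]
    simp only [h2]
    have h3 : ∀ σ : Equiv.Perm (Fin p), ∑ I : Fin p → Fin n, ∑ τ : Equiv.Perm (Fin p),
        ((Equiv.Perm.sign σ : ℤ) : ℂ) * ((Equiv.Perm.sign τ : ℤ) : ℂ) *
          ((∏ t, L (σ t) (I t)) * star (∏ t, L (τ t) (I t))) = 1 := by
      intro σ
      rw [Finset.sum_comm, Finset.sum_eq_single σ]
      · rw [← Finset.mul_sum, sum_prod_mul_star, Orthonormal.prod_inner hL]
        rcases Int.units_eq_one_or (Equiv.Perm.sign σ) with h | h <;> simp [h]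
      · intro τ _ hτ
        rw [← Finset.mul_sum, sum_prod_mul_star, Orthonormal.prod_inner hL, if_neg, mul_zero]
        exact fun h => hτ (Equiv.coe_fn_injective h)
      · simp
    rw [Finset.sum_comm, Finset.sum_congr rfl fun σ _ => h3 σ]
    simp [Fintype.card_perm]
  exact_mod_cast h1

theorem perm_eq_of_eq_succ {p : ℕ} {σ τ : Equiv.Perm (Fin (p + 1))}
    (h : (fun t : Fin p => σ t.succ) = fun t => τ t.succ) : σ = τ := by
  have h1 : ∀ t : Fin p, σ t.succ = τ t.succ := fun t => congrFun h t
  have h0 : σ 0 = τ 0 := by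
    obtain ⟨s, hs⟩ := σ.surjective (τ 0)
    rcases Fin.eq_zero_or_eq_succ s with rfl | ⟨t, rfl⟩
    · exact hs
    · rw [h1] at hs
      exact absurd (τ.injective hs) (Fin.succ_ne_zero t)
  ext i
  refine Fin.cases (by rw [h0]) (fun t => by rw [h1]) i

theorem sum_sesq_wedge {n p : ℕ} (H : Fin n → Fin n → ℂ) {L : Fin (p + 1) → Cn n}
    (hL : Orthonormal ℂ L) :
    ∑ K, sesq H (slice (wedge L) K) (slice (wedge L) K) =
      p.factorial * ∑ s, sesq H (L s) (L s) := by
  have h2 : ∀ K, sesq H (slice (wedge L) K) (slice (wedge L) K) =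
      ∑ σ : Equiv.Perm (Fin (p + 1)), ∑ τ : Equiv.Perm (Fin (p + 1)),
        ((Equiv.Perm.sign σ : ℤ) : ℂ) * ((Equiv.Perm.sign τ : ℤ) : ℂ) * sesq H (L (σ 0)) (L (τ 0)) *
          ((∏ t : Fin p, L (σ t.succ) (K t)) * star (∏ t : Fin p, L (τ t.succ) (K t))) := by
    intro K
    have h4 : slice (wedge L) K = ∑ σ : Equiv.Perm (Fin (p + 1)),
        (((Equiv.Perm.sign σ : ℤ) : ℂ) * ∏ t : Fin p, L (σ t.succ) (K t)) • L (σ 0) := by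
      ext j
      simp only [slice, wedge, Fin.prod_univ_succ, Fin.cons_zero, Fin.cons_succ, WithLp.ofLp_sum,
        Finset.sum_apply, PiLp.smul_apply, smul_eq_mul]
      exact Finset.sum_congr rfl fun σ _ => by ring
    rw [h4, sesq_sum_smul]
    refine Finset.sum_congr rfl fun σ _ => Finset.sum_congr rfl fun τ _ => ?_
    simp
    ring
  simp only [h2]
  rw [Finset.sum_comm]
  have h3 : ∀ σ : Equiv.Perm (Fin (p + 1)), ∑ K : Fin p → Fin n,
      ∑ τ : Equiv.Perm (Fin (p + 1)),
        ((Equiv.Perm.sign σ : ℤ) : ℂ) * ((Equiv.Perm.sign τ : ℤ) : ℂ) * sesq H (L (σ 0)) (L (τ 0)) *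
          ((∏ t : Fin p, L (σ t.succ) (K t)) * star (∏ t : Fin p, L (τ t.succ) (K t))) =
      sesq H (L (σ 0)) (L (σ 0)) := by
    intro σ
    rw [Finset.sum_comm, Finset.sum_eq_single σ]
    · rw [← Finset.mul_sum, sum_prod_mul_star (fun t => L (σ t.succ)) (fun t => L (σ t.succ)),
        Orthonormal.prod_inner hL (fun t => σ t.succ) (fun t => σ t.succ)]
      rcases Int.units_eq_one_or (Equiv.Perm.sign σ) with h | h <;> simp [h]
    · intro τ _ hτ
      rw [← Finset.mul_sum, sum_prod_mul_star (fun t => L (σ t.succ)) (fun t => L (τ t.succ)),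
        Orthonormal.prod_inner hL (fun t => τ t.succ) (fun t => σ t.succ), if_neg, mul_zero]
      exact fun h => hτ (perm_eq_of_eq_succ h)
    · simp
  simp only [h3]
  rw [← Equiv.sum_comp (Equiv.Perm.decomposeFin (n := p)).symm, Fintype.sum_prod_type]
  simp [Fintype.card_perm, Finset.mul_sum]

/-- A lower bound for the form induced on skew tensors is the same as a lower bound for the sums
over orthonormal tuples. -/
theorem form_ineq_iff {n q : ℕ} (hq : 1 ≤ q) (H : Fin n → Fin n → ℂ) (A : ℝ) :
    (∀ w : (Fin q → Fin n) → ℂ, IsSkew w → A * sumIncr (fun I => ‖w I‖ ^ 2) ≤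
        (sumIncr (fun K : Fin (q - 1) → Fin n => ∑ j, ∑ k,
          H j k * w (prepend j K) * star (w (prepend k K)))).re) ↔
      ∀ L : Fin q → Cn n, Orthonormal ℂ L → A ≤ (∑ s, sesq H (L s) (L s)).re := by
  obtain ⟨p, rfl⟩ : ∃ p, q = p + 1 := ⟨q - 1, by omega⟩
  have hS : ∀ w : (Fin (p + 1) → Fin n) → ℂ, IsSkew w →
      (p.factorial : ℝ) * (sumIncr (fun K : Fin (p + 1 - 1) → Fin n => ∑ j, ∑ k,
          H j k * w (prepend j K) * star (w (prepend k K)))).re =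
        (∑ K, sesq H (slice w K) (slice w K)).re := by
    intro w hw
    rw [hw.sesq_slice H, ← Complex.ofReal_natCast, Complex.re_ofReal_mul]
    simp only [prepend_eq_cons]
    rfl
  have hp : (0 : ℝ) < p.factorial := by exact_mod_cast p.factorial_pos
  have hp1 : ((p + 1).factorial : ℝ) = (p + 1) * p.factorial := by
    rw [Nat.factorial_succ]; push_cast; ring
  constructor
  · intro h L hL
    have h1 := h (wedge L) (isSkew_wedge L)
    have h2 := hS _ (isSkew_wedge L)
    rw [sum_sesq_wedge H hL, ← Complex.ofReal_natCast, Complex.re_ofReal_mul] at h2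
    have h3 := (isSkew_wedge L).sum_sq
    rw [sum_sq_wedge hL] at h3
    have h4 : sumIncr (fun I => ‖wedge L I‖ ^ 2) = 1 := by
      have h5 : (0 : ℝ) < (p + 1).factorial := by exact_mod_cast (p + 1).factorial_pos
      field_simp at h3
      exact h3.symm
    rw [h4, mul_one] at h1
    rwa [mul_left_cancel₀ hp.ne' h2] at h1
  · intro h w hw
    have h1 := le_sum_sesq_slice H A h hw
    rw [hw.sum_sq, ← hS w hw, hp1] at h1
    have h2 : (0 : ℝ) < ((p : ℝ) + 1) * p.factorial := by positivity
    refine le_of_mul_le_mul_left ?_ h2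
    linarith

/-! ### Second derivatives and complex Hessians -/

section SecondDerivative

variable {E F G H : Type*} [NormedAddCommGroup E] [NormedSpace ℝ E] [NormedAddCommGroup F]
  [NormedSpace ℝ F] [NormedAddCommGroup G] [NormedSpace ℝ G] [NormedAddCommGroup H]
  [NormedSpace ℝ H]

theorem ContDiffAt.eventually_differentiableAt {f : E → F} {z : E} (hf : ContDiffAt ℝ 2 f z) :
    ∀ᶠ x in nhds z, DifferentiableAt ℝ f x :=
  (hf.eventually (by simp)).mono fun _ hx => hx.differentiableAt (by simp)

theorem ContDiffAt.differentiableAt_fderiv {f : E → F} {z : E} (hf : ContDiffAt ℝ 2 f z) :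
    DifferentiableAt ℝ (fderiv ℝ f) z :=
  (hf.fderiv_right (m := 1) (by norm_num)).differentiableAt (by simp)

theorem ContDiffAt.fderiv_fderiv_comm {f : E → F} {z : E} (hf : ContDiffAt ℝ 2 f z) (u v : E) :
    fderiv ℝ (fderiv ℝ f) z u v = fderiv ℝ (fderiv ℝ f) z v u :=
  (hf.isSymmSndFDerivAt (by simp)) u v

/-- The product rule for the second derivative of a bilinear expression. -/
theorem fderiv_fderiv_of_bilinear (B : F →L[ℝ] G →L[ℝ] H) {f : E → F} {g : E → G} {z : E}
    (hf : ContDiffAt ℝ 2 f z) (hg : ContDiffAt ℝ 2 g z) (u v : E) :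
    fderiv ℝ (fderiv ℝ (fun x => B (f x) (g x))) z u v =
      B (fderiv ℝ (fderiv ℝ f) z u v) (g z) + B (fderiv ℝ f z v) (fderiv ℝ g z u) +
        (B (fderiv ℝ f z u) (fderiv ℝ g z v) + B (f z) (fderiv ℝ (fderiv ℝ g) z u v)) := by
  have h1 : fderiv ℝ (fun x => B (f x) (g x)) =ᶠ[nhds z] fun x =>
      B.precompR E (f x) (fderiv ℝ g x) + B.precompL E (fderiv ℝ f x) (g x) := by
    filter_upwards [ContDiffAt.eventually_differentiableAt hf,
      ContDiffAt.eventually_differentiableAt hg] with x hx hx'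
    exact B.fderiv_of_bilinear hx hx'
  have hf1 := ContDiffAt.differentiableAt_fderiv hf
  have hg1 := ContDiffAt.differentiableAt_fderiv hg
  have hf0 : DifferentiableAt ℝ f z := hf.differentiableAt (by simp)
  have hg0 : DifferentiableAt ℝ g z := hg.differentiableAt (by simp)
  have h2 := ((B.precompR E).hasFDerivAt_of_bilinear hf0.hasFDerivAt hg1.hasFDerivAt).add
    ((B.precompL E).hasFDerivAt_of_bilinear hf1.hasFDerivAt hg0.hasFDerivAt)
  have h3 := h2.fderiv
  rw [h1.fderiv_eq]
  erw [h3]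
  change (B (f z) (fderiv ℝ (fderiv ℝ g) z u v) + B (fderiv ℝ f z u) (fderiv ℝ g z v)) +
    (B (fderiv ℝ f z v) (fderiv ℝ g z u) + B (fderiv ℝ (fderiv ℝ f) z u v) (g z)) = _
  abel

theorem fderiv_fderiv_clm_comp (B : F →L[ℝ] G) {f : E → F} {z : E}
    (hf : ContDiffAt ℝ 2 f z) (u v : E) :
    fderiv ℝ (fderiv ℝ (fun x => B (f x))) z u v = B (fderiv ℝ (fderiv ℝ f) z u v) := by
  have h1 : fderiv ℝ (fun x => B (f x)) =ᶠ[nhds z] fun x => B.comp (fderiv ℝ f x) := by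
    filter_upwards [ContDiffAt.eventually_differentiableAt hf] with x hx
    exact (B.hasFDerivAt.comp x hx.hasFDerivAt).fderiv
  have h2 := ((ContinuousLinearMap.compL ℝ E F G B).hasFDerivAt.comp z
    (ContDiffAt.differentiableAt_fderiv hf).hasFDerivAt).fderiv
  rw [h1.fderiv_eq]
  change fderiv ℝ ((ContinuousLinearMap.compL ℝ E F G B) ∘ fderiv ℝ f) z u v = _
  rw [h2]
  simp

theorem fderiv_fderiv_add {f g : E → F} {z : E} (hf : ContDiffAt ℝ 2 f z)
    (hg : ContDiffAt ℝ 2 g z) (u v : E) :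
    fderiv ℝ (fderiv ℝ (fun x => f x + g x)) z u v =
      fderiv ℝ (fderiv ℝ f) z u v + fderiv ℝ (fderiv ℝ g) z u v := by
  have h1 : fderiv ℝ (fun x => f x + g x) =ᶠ[nhds z] fun x => fderiv ℝ f x + fderiv ℝ g x := by
    filter_upwards [ContDiffAt.eventually_differentiableAt hf,
      ContDiffAt.eventually_differentiableAt hg] with x hx hx'
    exact fderiv_fun_add hx hx'
  rw [h1.fderiv_eq, fderiv_fun_add (ContDiffAt.differentiableAt_fderiv hf)
    (ContDiffAt.differentiableAt_fderiv hg)]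
  simp

/-- The necessary second order condition at a local maximum. -/
theorem fderiv_fderiv_nonpos_of_isLocalMax {w : E → ℝ} {z : E} (hw : ContDiffAt ℝ 2 w z)
    (hmax : IsLocalMax w z) (v : E) : fderiv ℝ (fderiv ℝ w) z v v ≤ 0 := by
  by_contra! hpos
  let ℓ : ℝ → E := fun t => z + t • v
  have hℓ : ∀ t, HasDerivAt ℓ v t := fun t => by
    simpa [ℓ] using ((hasDerivAt_id t).smul_const v).const_add z
  have hℓ0 : ℓ 0 = z := by simp [ℓ]
  have hℓt : Filter.Tendsto ℓ (nhds 0) (nhds z) := by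
    have := (hℓ 0).continuousAt.tendsto
    rwa [hℓ0] at this
  have h1 : deriv (w ∘ ℓ) =ᶠ[nhds 0] fun t => fderiv ℝ w (ℓ t) v := by
    filter_upwards [hℓt.eventually (ContDiffAt.eventually_differentiableAt hw)] with t ht
    exact (ht.hasFDerivAt.comp_hasDerivAt t (hℓ t)).deriv
  have h2 : deriv (deriv (w ∘ ℓ)) 0 = fderiv ℝ (fderiv ℝ w) z v v := by
    rw [h1.deriv_eq]
    have h3 : HasFDerivAt (fun x => fderiv ℝ w x v)
        ((ContinuousLinearMap.apply ℝ ℝ v).comp (fderiv ℝ (fderiv ℝ w) z)) (ℓ 0) := by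
      rw [hℓ0]
      exact (ContinuousLinearMap.apply ℝ ℝ v).hasFDerivAt.comp z
        (ContDiffAt.differentiableAt_fderiv hw).hasFDerivAt
    exact (h3.comp_hasDerivAt 0 (hℓ 0)).deriv
  have hmax' : IsLocalMax (w ∘ ℓ) 0 := by
    have : ∀ᶠ t in nhds (0 : ℝ), w (ℓ t) ≤ w z := hℓt.eventually hmax
    filter_upwards [this] with t ht
    simpa [hℓ0] using ht
  have hmin : IsLocalMin (w ∘ ℓ) 0 := by
    refine isLocalMin_of_deriv_deriv_pos (by rw [h2]; exact hpos) hmax'.deriv_eq_zero ?_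
    have : ContinuousAt w (ℓ 0) := by rw [hℓ0]; exact hw.continuousAt
    exact this.comp (hℓ 0).continuousAt
  have hconst : (w ∘ ℓ) =ᶠ[nhds 0] fun _ => (w ∘ ℓ) 0 := by
    filter_upwards [hmax', hmin] with t h h'
    exact le_antisymm h h'
  have h4 : deriv (deriv (w ∘ ℓ)) 0 = 0 := by
    rw [hconst.deriv.deriv_eq]
    simp
  rw [h2] at h4
  exact hpos.ne' h4

end SecondDerivative

theorem J_apply {n : ℕ} (a : Cn n) : J n a = Complex.I • a := rfl

theorem J_J {n : ℕ} (a : Cn n) : J n (J n a) = -a := by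
  simp [J_apply, smul_smul]

theorem smul_eq_add_J {n : ℕ} (c : ℂ) (a : Cn n) : c • a = c.re • a + c.im • J n a := by
  conv_lhs => rw [← Complex.re_add_im c]
  rw [add_smul, mul_smul, Complex.coe_smul, Complex.coe_smul, J_apply]

theorem norm_J {n : ℕ} (a : Cn n) : ‖J n a‖ = ‖a‖ := by
  simp [J_apply, norm_smul]

/-- The form `D²f(a, b) + D²f(Ja, Jb)`, twice the `J`-invariant part of the real Hessian, that is,
four times the real part of the complex Hessian for real-valued `f`. -/
noncomputable def jHess {n : ℕ} {F : Type*} [NormedAddCommGroup F] [NormedSpace ℝ F]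
    (f : Cn n → F) (z a b : Cn n) : F :=
  fderiv ℝ (fderiv ℝ f) z a b + fderiv ℝ (fderiv ℝ f) z (J n a) (J n b)

/-- The sesquilinear extension of a real bilinear form. -/
noncomputable def sesqExt {n : ℕ} (B : Cn n →L[ℝ] Cn n →L[ℝ] ℝ) :
    Cn n →ₗ[ℂ] Cn n →ₛₗ[starRingEnd ℂ] ℂ :=
  LinearMap.mk₂'ₛₗ (RingHom.id ℂ) (starRingEnd ℂ)
    (fun a b => (1 / 4 : ℂ) * (((B a b + B (J n a) (J n b) : ℝ) : ℂ) +
      Complex.I * ((B a (J n b) - B (J n a) b : ℝ) : ℂ)))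
    (fun a a' b => by simp; ring)
    (fun c a b => by
      simp only [smul_eq_add_J c, map_add, map_smul, J_J]
      apply Complex.ext <;> simp <;> ring)
    (fun a b b' => by simp; ring)
    (fun c a b => by
      simp only [smul_eq_add_J c, map_add, map_smul, J_J]
      apply Complex.ext <;> simp <;> ring)

theorem sesqExt_apply_self_re {n : ℕ} (B : Cn n →L[ℝ] Cn n →L[ℝ] ℝ) (a : Cn n) :
    (sesqExt B a a).re = (1 / 4) * (B a a + B (J n a) (J n a)) := by
  simp [sesqExt]

theorem complexHess_eq {n : ℕ} {f : Cn n → ℝ} {z : Cn n} (hf : ContDiffAt ℝ 2 f z)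
    (j k : Fin n) : complexHess f z j k =
      sesqExt (fderiv ℝ (fderiv ℝ f) z) (EuclideanSpace.single j 1)
        (EuclideanSpace.single k 1) := by
  set ej : Cn n := EuclideanSpace.single j 1
  set ek : Cn n := EuclideanSpace.single k 1
  let Λ : (Cn n →L[ℝ] ℝ) →L[ℝ] ℂ := (1 / 2 : ℂ) •
    (Complex.ofRealCLM.comp (ContinuousLinearMap.apply ℝ ℝ ek) +
      Complex.I • Complex.ofRealCLM.comp (ContinuousLinearMap.apply ℝ ℝ (J n ek)))
  have h1 : (fun x => delbar (fun y => (f y : ℂ)) x ek) =ᶠ[nhds z] fun x => Λ (fderiv ℝ f x) := by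
    filter_upwards [ContDiffAt.eventually_differentiableAt hf] with x hx
    have h2 : fderiv ℝ (fun y => (f y : ℂ)) x = Complex.ofRealCLM.comp (fderiv ℝ f x) :=
      (Complex.ofRealCLM.hasFDerivAt.comp x hx.hasFDerivAt).fderiv
    simp [delbar, h2, Λ]
  have h3 : fderiv ℝ (fun x => delbar (fun y => (f y : ℂ)) x ek) z =
      Λ.comp (fderiv ℝ (fderiv ℝ f) z) := by
    rw [h1.fderiv_eq]
    exact (Λ.hasFDerivAt.comp z (ContDiffAt.differentiableAt_fderiv hf).hasFDerivAt).fderiv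
  unfold complexHess del
  rw [h3]
  apply Complex.ext <;> simp [Λ, sesqExt] <;> ring

theorem sesq_complexHess {n : ℕ} {f : Cn n → ℝ} {z : Cn n} (hf : ContDiffAt ℝ 2 f z)
    (a : Cn n) : (sesq (complexHess f z) a a).re = (1 / 4) * jHess f z a a := by
  have h1 : sesq (complexHess f z) a a = sesqExt (fderiv ℝ (fderiv ℝ f) z) a a := by
    have ha : a = ∑ j, a j • (EuclideanSpace.single j 1 : Cn n) := by
      ext i
      simp [Finset.sum_apply, Pi.single_apply]
    conv_rhs => rw [ha]
    simp only [map_sum, LinearMap.sum_apply, map_smul, LinearMap.map_smulₛₗ, LinearMap.smul_apply,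
      smul_eq_mul, ← complexHess_eq hf]
    unfold sesq
    rw [Finset.sum_comm]
    refine Finset.sum_congr rfl fun j _ => ?_
    rw [Finset.mul_sum]
    refine Finset.sum_congr rfl fun k _ => ?_
    simp
    ring
  rw [h1, sesqExt_apply_self_re]
  rfl

theorem jHess_add {n : ℕ} {F : Type*} [NormedAddCommGroup F] [NormedSpace ℝ F]
    {f g : Cn n → F} {z : Cn n} (hf : ContDiffAt ℝ 2 f z) (hg : ContDiffAt ℝ 2 g z)
    (a b : Cn n) : jHess (fun x => f x + g x) z a b = jHess f z a b + jHess g z a b := by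
  simp only [jHess, fderiv_fderiv_add hf hg]
  abel

theorem jHess_clm_comp {n : ℕ} {F G : Type*} [NormedAddCommGroup F] [NormedSpace ℝ F]
    [NormedAddCommGroup G] [NormedSpace ℝ G] (B : F →L[ℝ] G)
    {f : Cn n → F} {z : Cn n} (hf : ContDiffAt ℝ 2 f z)
    (a b : Cn n) : jHess (fun x => B (f x)) z a b = B (jHess f z a b) := by
  simp only [jHess, fderiv_fderiv_clm_comp B hf, map_add]

theorem jHess_const_mul {n : ℕ} (c : ℝ) {f : Cn n → ℝ} {z : Cn n} (hf : ContDiffAt ℝ 2 f z)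
    (a b : Cn n) : jHess (fun x => c * f x) z a b = c * jHess f z a b := by
  have := jHess_clm_comp (c • ContinuousLinearMap.id ℝ ℝ) hf a b
  simpa using this

/-- Cutting off a function that vanishes to first order in the directions considered only
multiplies its Hessian by the cutoff function. -/
theorem jHess_mul_of_eq_zero {n : ℕ} {χ f : Cn n → ℝ} {z a : Cn n} (hχ : ContDiffAt ℝ 2 χ z)
    (hf : ContDiffAt ℝ 2 f z) (h0 : f z = 0) (h1 : fderiv ℝ f z a = 0)
    (h2 : fderiv ℝ f z (J n a) = 0) : jHess (fun x => χ x * f x) z a a = χ z * jHess f z a a := by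
  have := fun u v => fderiv_fderiv_of_bilinear (ContinuousLinearMap.mul ℝ ℝ) hχ hf u v
  simp only [ContinuousLinearMap.mul_apply'] at this
  simp only [jHess, this, h0, h1, h2]
  ring

theorem jHess_norm_sq {n : ℕ} {f : Cn n → Cn n} {z : Cn n} (a : Cn n)
    (hf : ContDiffAt ℝ 2 f z) (h0 : f z = 0) :
    jHess (fun x => ‖f x‖ ^ 2) z a a =
      2 * (‖fderiv ℝ f z a‖ ^ 2 + ‖fderiv ℝ f z (J n a)‖ ^ 2) := by
  have := fun u v => fderiv_fderiv_of_bilinear (innerSL ℝ (E := Cn n)) hf hf u v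
  have h1 : (fun x => ‖f x‖ ^ 2) = fun x => innerSL ℝ (f x) (f x) := by
    ext x
    exact (real_inner_self_eq_norm_sq (f x)).symm
  rw [h1]
  have h2 : ∀ v : Cn n, innerSL ℝ v v = ‖v‖ ^ 2 := real_inner_self_eq_norm_sq
  simp only [jHess, this, h0]
  simp only [h2, map_zero, zero_apply]
  ring

/-! ### Smoothing -/

section Mollification

open MeasureTheory

variable {E F : Type*} [NormedAddCommGroup E] [NormedSpace ℝ E] [FiniteDimensional ℝ E]
  [NormedAddCommGroup F] [NormedSpace ℝ F]

open scoped Convolution in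
theorem hasFDerivAt_mollify [MeasurableSpace E] [BorelSpace E] {μ : Measure E}
    [μ.IsAddHaarMeasure] (φ : ContDiffBump (0 : E))
    {f : E → F} (hf : ContDiff ℝ 1 f) (hc : HasCompactSupport f) (x : E) :
    HasFDerivAt (φ.normed μ ⋆[ContinuousLinearMap.lsmul ℝ ℝ, μ] f)
      ((φ.normed μ ⋆[ContinuousLinearMap.lsmul ℝ ℝ, μ] fderiv ℝ f) x) x := by
  have hφ : LocallyIntegrable (φ.normed μ) μ := φ.continuous_normed.locallyIntegrable
  have h := hc.hasFDerivAt_convolution_right (ContinuousLinearMap.lsmul ℝ ℝ) hφ hf x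
  exact h

open scoped Convolution in
/-- A compactly supported `C²` function with values in `[0, 1]` can be approximated by smooth
functions with values in `[0, 1]`, uniformly together with the second derivative. -/
theorem exists_contDiff_fderiv_fderiv_dist_le {f : E → ℝ} (hf : ContDiff ℝ 2 f)
    (hc : HasCompactSupport f) (h01 : ∀ x, 0 ≤ f x ∧ f x ≤ 1) {ε : ℝ} (hε : 0 < ε) :
    ∃ g : E → ℝ, ContDiff ℝ ∞ g ∧ (∀ x, 0 ≤ g x ∧ g x ≤ 1) ∧
      ∀ x, ‖fderiv ℝ (fderiv ℝ g) x - fderiv ℝ (fderiv ℝ f) x‖ ≤ ε := by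
  borelize E
  let μ : Measure E := Measure.addHaar
  have hf1 : ContDiff ℝ 1 (fderiv ℝ f) := hf.fderiv_right (by norm_num)
  have hf2 : Continuous (fderiv ℝ (fderiv ℝ f)) := hf1.continuous_fderiv (by simp)
  have hc1 : HasCompactSupport (fderiv ℝ f) := hc.fderiv ℝ
  have hc2 : HasCompactSupport (fderiv ℝ (fderiv ℝ f)) := hc1.fderiv ℝ
  obtain ⟨δ, hδ, hδ'⟩ := (Metric.uniformContinuous_iff (β := E →L[ℝ] E →L[ℝ] ℝ)).1
    (hf2.uniformContinuous_of_tendsto_cocompact hc2.is_zero_at_infty) ε hε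
  let φ : ContDiffBump (0 : E) := ⟨δ / 2, δ, half_pos hδ, half_lt_self hδ⟩
  have hd : fderiv ℝ (φ.normed μ ⋆[ContinuousLinearMap.lsmul ℝ ℝ, μ] f) =
      (φ.normed μ ⋆[ContinuousLinearMap.lsmul ℝ ℝ, μ] fderiv ℝ f) :=
    funext fun x => (hasFDerivAt_mollify φ (hf.of_le (by norm_num)) hc x).fderiv
  have hd2 := funext fun x => (hasFDerivAt_mollify (μ := μ) φ hf1 hc1 x).fderiv
  refine ⟨φ.normed μ ⋆[ContinuousLinearMap.lsmul ℝ ℝ, μ] f, ?_, fun x => ?_, fun x => ?_⟩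
  · exact φ.hasCompactSupport_normed.contDiff_convolution_left _ φ.contDiff_normed
      hf.continuous.locallyIntegrable
  · have h := dist_convolution_le (μ := μ) (f := φ.normed μ) (g := f) (x₀ := x) (R := δ)
      (ε := 1 / 2) (z₀ := (1 / 2 : ℝ)) (by norm_num) (by rw [φ.support_normed_eq])
      φ.nonneg_normed φ.integral_normed hf.continuous.aestronglyMeasurable
      (fun y _ => by
        rw [Real.dist_eq, abs_le]
        constructor <;> linarith [(h01 y).1, (h01 y).2])
    rw [Real.dist_eq, abs_le] at h
    constructor <;> linarith [h.1, h.2]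
  · rw [hd, hd2]
    refine (dist_eq_norm (E := E →L[ℝ] E →L[ℝ] ℝ) _ _).symm.trans_le ?_
    exact φ.dist_normed_convolution_le hf2.aestronglyMeasurable
      fun y hy => (hδ' (Metric.mem_ball.1 hy)).le

end Mollification

open Manifold in
/-- A smooth compactly supported cutoff function that is one near a compact set. -/
theorem exists_cutoff {n : ℕ} {M U : Set (Cn n)} (hM : IsCompact M) (hU : IsOpen U) (hMU : M ⊆ U) :
    ∃ χ : Cn n → ℝ, ContDiff ℝ ∞ χ ∧ HasCompactSupport χ ∧ tsupport χ ⊆ U ∧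
      (∀ x, 0 ≤ χ x ∧ χ x ≤ 1) ∧ ∀ z ∈ M, ∀ᶠ x in nhds z, χ x = 1 := by
  obtain ⟨K, hK, hMK, hKU⟩ := exists_compact_between hM hU hMU
  obtain ⟨K', hK', hKK', hK'U⟩ := exists_compact_between hK hU hKU
  obtain ⟨f, h1, h0, h01⟩ := exists_contMDiffMap_one_nhds_of_subset_interior
    (n := (⊤ : ℕ∞)) 𝓘(ℝ, Cn n) hM.isClosed hMK
  have hsupp : tsupport f ⊆ K := by
    refine closure_minimal (fun x hx => ?_) hK.isClosed
    by_contra hxK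
    exact hx (h0 x hxK)
  refine ⟨f, f.contMDiff.contDiff, HasCompactSupport.of_support_subset_isCompact hK
    (subset_tsupport _ |>.trans hsupp), hsupp.trans hKU, fun x => h01 x, fun z hz => ?_⟩
  exact h1.filter_mono (nhds_le_nhdsSet hz)

theorem contDiff_mul_of_tsupport_subset {n : ℕ} {r : ℕ∞} {χ f : Cn n → ℝ} {U : Set (Cn n)}
    (hU : IsOpen U) (hχ : ContDiff ℝ ∞ χ) (hχU : tsupport χ ⊆ U) (hf : ContDiffOn ℝ r f U) :
    ContDiff ℝ r (fun x => χ x * f x) := by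
  rw [contDiff_iff_contDiffAt]
  intro x
  by_cases hx : x ∈ U
  · exact (hχ.contDiffAt.of_le (by exact_mod_cast le_top)).mul (hf.contDiffAt (hU.mem_nhds hx))
  · have h0 : (fun x => χ x * f x) =ᶠ[nhds x] fun _ => 0 := by
      filter_upwards [(isClosed_tsupport χ).isOpen_compl.mem_nhds fun h => hx (hχU h)] with y hy
      rw [image_eq_zero_of_notMem_tsupport hy, zero_mul]
    exact contDiffAt_const.congr_of_eventuallyEq h0

theorem jHess_congr {n : ℕ} {F : Type*} [NormedAddCommGroup F] [NormedSpace ℝ F]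
    {f g : Cn n → F} {z : Cn n} (h : f =ᶠ[nhds z] g) (a b : Cn n) :
    jHess f z a b = jHess g z a b := by
  unfold jHess
  rw [(h.fderiv).fderiv_eq]

/-- `C²` functions with values in `[0, 1]` near a compact set can be smoothed with little change
of the complex Hessian on the compact set. -/
theorem exists_smooth_jHess_near {n : ℕ} {M U : Set (Cn n)} (hM : IsCompact M) (hU : IsOpen U)
    (hMU : M ⊆ U) {f : Cn n → ℝ} (hf : ContDiffOn ℝ 2 f U)
    (h01 : ∀ x ∈ U, 0 ≤ f x ∧ f x ≤ 1) {ε : ℝ} (hε : 0 < ε) :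
    ∃ g : Cn n → ℝ, ContDiff ℝ ∞ g ∧ (∀ x, 0 ≤ g x ∧ g x ≤ 1) ∧
      ∀ z ∈ M, ∀ a, jHess f z a a - ε * ‖a‖ ^ 2 ≤ jHess g z a a := by
  obtain ⟨χ, hχ, hχc, hχU, hχ01, hχ1⟩ := exists_cutoff hM hU hMU
  have hχf : ContDiff ℝ (2 : ℕ∞) (fun x => χ x * f x) :=
    contDiff_mul_of_tsupport_subset hU hχ hχU hf
  have hχf01 : ∀ x, 0 ≤ χ x * f x ∧ χ x * f x ≤ 1 := by
    intro x
    by_cases hx : x ∈ U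
    · exact ⟨mul_nonneg (hχ01 x).1 (h01 x hx).1,
        mul_le_one₀ (hχ01 x).2 (h01 x hx).1 (h01 x hx).2⟩
    · rw [image_eq_zero_of_notMem_tsupport fun h => hx (hχU h)]
      simp
  obtain ⟨g, hg, hg01, hgd⟩ := exists_contDiff_fderiv_fderiv_dist_le hχf hχc.mul_right hχf01
    (half_pos hε)
  refine ⟨g, hg, hg01, fun z hz a => ?_⟩
  have h1 : f =ᶠ[nhds z] fun x => χ x * f x := by
    filter_upwards [hχ1 z hz] with x hx
    rw [hx, one_mul]
  rw [jHess_congr h1]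
  set D := fderiv ℝ (fderiv ℝ fun x => χ x * f x) z
  set D' := fderiv ℝ (fderiv ℝ g) z
  have h2 : ∀ v : Cn n, D v v - D' v v ≤ ε / 2 * ‖v‖ ^ 2 := by
    intro v
    have h3 : ‖(D' - D) v v‖ ≤ ‖D' - D‖ * ‖v‖ * ‖v‖ := (D' - D).le_opNorm₂ v v
    have h4 : ‖D' - D‖ ≤ ε / 2 := hgd z
    have h5 : ‖D' - D‖ * ‖v‖ * ‖v‖ ≤ ε / 2 * ‖v‖ * ‖v‖ := by gcongr
    have h6 : (D' - D) v v = D' v v - D v v := by simp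
    rw [h6, Real.norm_eq_abs] at h3
    have := (abs_le.1 (h3.trans h5)).1
    linarith
  have h3 := h2 a
  have h4 := h2 (J n a)
  rw [norm_J] at h4
  change D a a + D (J n a) (J n a) - _ ≤ D' a a + D' (J n a) (J n a)
  linarith

/-! ### Local retractions onto a submanifold, and its tangent spaces -/

/-- `π` is a smooth retraction of the open set `W` onto a part of `M` that contains `M ∩ W`. -/
structure IsLocalRetraction {n : ℕ} (M W : Set (Cn n)) (π : Cn n → Cn n) : Prop where
  isOpen : IsOpen W
  contDiffOn : ContDiffOn ℝ ∞ π W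
  mapsTo : Set.MapsTo π W M
  eq_self : ∀ x ∈ M, x ∈ W → π x = x

theorem mem_tangentSpace_of_mapsTo {n : ℕ} {M W : Set (Cn n)} {π : Cn n → Cn n} {z : Cn n}
    (hW : W ∈ nhds z) (hπ : Set.MapsTo π W M) (hz : π z = z) (hd : DifferentiableAt ℝ π z)
    (v : Cn n) : fderiv ℝ π z v ∈ tangentSpace M z := by
  have h1 := hd.hasFDerivAt.hasFDerivWithinAt (s := W) |>.mapsTo_tangent_cone
  have h2 : v ∈ tangentConeAt ℝ W z := by
    rw [tangentConeAt_of_mem_nhds hW]; trivial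
  have h3 := h1 h2
  rw [hz] at h3
  exact Submodule.subset_span (tangentConeAt_mono hπ.image_subset h3)

/-- Two derivatives along `M` of the same function agree on the tangent space. -/
theorem eq_of_hasFDerivWithinAt {n : ℕ} {F : Type*} [NormedAddCommGroup F] [NormedSpace ℝ F]
    {M : Set (Cn n)} {z : Cn n} {f : Cn n → F} {f' f'' : Cn n →L[ℝ] F}
    (h' : HasFDerivWithinAt f f' M z) (h'' : HasFDerivWithinAt f f'' M z) {v : Cn n}
    (hv : v ∈ tangentSpace M z) : f' v = f'' v := by
  have h : Set.EqOn (f' : Cn n →ₗ[ℝ] F) f'' (tangentConeAt ℝ M z) := h'.unique_on h''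
  exact LinearMap.eqOn_span h hv

theorem fderiv_apply_eq_zero {n : ℕ} {F : Type*} [NormedAddCommGroup F] [NormedSpace ℝ F]
    {M : Set (Cn n)} {z : Cn n} {f : Cn n → F} (hz : z ∈ M) (hf : DifferentiableAt ℝ f z)
    (h0 : ∀ᶠ x in nhdsWithin z M, f x = 0) {v : Cn n} (hv : v ∈ tangentSpace M z) :
    fderiv ℝ f z v = 0 := by
  have h1 : HasFDerivWithinAt f (0 : Cn n →L[ℝ] F) M z :=
    (hasFDerivWithinAt_const (0 : F) z M).congr_of_eventuallyEq h0 (h0.self_of_nhdsWithin hz)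
  simpa using eq_of_hasFDerivWithinAt hf.hasFDerivAt.hasFDerivWithinAt h1 hv

/-- The implicit function theorem for a defining function `ρ` of `M`. -/
theorem exists_retraction_of_defining {n d : ℕ} {M U : Set (Cn n)}
    {ρ : Cn n → EuclideanSpace ℝ (Fin d)} (hU : IsOpen U) (hρ : ContDiffOn ℝ ∞ ρ U)
    (hsurj : ∀ x ∈ U, Function.Surjective (fderiv ℝ ρ x)) (hM : M ∩ U = {x ∈ U | ρ x = 0})
    {p : Cn n} (hp : p ∈ M) (hpU : p ∈ U) :
    (∃ W π, p ∈ W ∧ IsLocalRetraction M W π) ∧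
      tangentSpace M p = LinearMap.ker (fderiv ℝ ρ p : Cn n →ₗ[ℝ] EuclideanSpace ℝ (Fin d)) := by
  have hmem : ∀ x, x ∈ U → (x ∈ M ↔ ρ x = 0) := fun x hx => by
    have := Set.ext_iff.1 hM x
    simpa [hx] using this
  have hρp : ρ p = 0 := (hmem p hpU).1 hp
  set B : Cn n →L[ℝ] EuclideanSpace ℝ (Fin d) := fderiv ℝ ρ p
  set K : Submodule ℝ (Cn n) := LinearMap.ker (B : Cn n →ₗ[ℝ] EuclideanSpace ℝ (Fin d))
  let Q : Cn n →L[ℝ] K := K.orthogonalProjectionOnto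
  have hQ : ∀ v : K, Q v = v := fun v => K.orthogonalProjectionOnto_mem_subspace_eq_self v
  have hB : ∀ v : K, B v = 0 := fun v => v.2
  let Φ : Cn n → EuclideanSpace ℝ (Fin d) × K := fun x => (ρ x, Q x)
  have hΦ : ContDiffOn ℝ ∞ Φ U := hρ.prodMk Q.contDiff.contDiffOn
  have hΦd : ∀ x ∈ U, HasFDerivAt Φ ((fderiv ℝ ρ x).prod Q) x := fun x hx =>
    (((hρ.contDiffAt (hU.mem_nhds hx)).differentiableAt (by simp)).hasFDerivAt).prodMk
      Q.hasFDerivAt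
  have hbij : Function.Bijective (B.prod Q) := by
    constructor
    · rw [injective_iff_map_eq_zero]
      intro v hv
      simp only [ContinuousLinearMap.prod_apply, Prod.mk_eq_zero] at hv
      obtain ⟨hv1, hv2⟩ := hv
      have : Q v = ⟨v, hv1⟩ := hQ ⟨v, hv1⟩
      rw [hv2] at this
      exact (congrArg Subtype.val this).symm
    · rintro ⟨y, k⟩
      obtain ⟨v, hv⟩ := hsurj p hpU y
      refine ⟨v - Q v + k, ?_⟩
      ext1
      · change B (v - Q v + k) = y
        rw [map_add, map_sub, hB, hB, sub_zero, add_zero]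
        exact hv
      · change Q (v - Q v + k) = k
        rw [map_add, map_sub, hQ, hQ, sub_self, zero_add]
  let Φ' : Cn n ≃L[ℝ] EuclideanSpace ℝ (Fin d) × K :=
    ContinuousLinearEquiv.ofBijective (B.prod Q) (LinearMap.ker_eq_bot.2 hbij.1)
      (LinearMap.range_eq_top.2 hbij.2)
  have hΦ'd : HasFDerivAt Φ (Φ' : Cn n →L[ℝ] EuclideanSpace ℝ (Fin d) × K) p := hΦd p hpU
  have hΦp : ContDiffAt ℝ ∞ Φ p := hΦ.contDiffAt (hU.mem_nhds hpU)
  let e := hΦp.toOpenPartialHomeomorph Φ hΦ'd (by simp)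
  have he : ∀ x, e x = Φ x := fun x => rfl
  have hpe : p ∈ e.source := hΦp.mem_toOpenPartialHomeomorph_source hΦ'd (by simp)
  have hcont : ContinuousAt (fderiv ℝ Φ) p :=
    (hΦp.fderiv_right (m := 0) (by simp)).continuousAt
  have hinv : ∀ᶠ x in nhds p, fderiv ℝ Φ x ∈
      Set.range ((↑) : (Cn n ≃L[ℝ] EuclideanSpace ℝ (Fin d) × K) → _) := by
    refine hcont.tendsto.eventually ?_
    rw [hΦ'd.fderiv]
    exact Φ'.nhds
  obtain ⟨V, hV, hVo, hpV⟩ := eventually_nhds_iff.1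
    (hinv.and ((hU.eventually_mem hpU).and (e.open_source.eventually_mem hpe)))
  let ι : Cn n → EuclideanSpace ℝ (Fin d) × K := fun x => (0, Q x)
  have hι : ContDiff ℝ ∞ ι := contDiff_const.prodMk Q.contDiff
  have hιp : ι p = e p := by rw [he]; simp [ι, Φ, hρp]
  let W : Set (Cn n) := V ∩ ι ⁻¹' (e.target ∩ e.symm ⁻¹' V)
  let π : Cn n → Cn n := fun x => e.symm (ι x)
  have hWo : IsOpen W := hVo.inter ((e.isOpen_inter_preimage_symm hVo).preimage hι.continuous)
  have hpW : p ∈ W := by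
    refine ⟨hpV, ?_, ?_⟩
    · rw [hιp]; exact e.map_source hpe
    · change e.symm (ι p) ∈ V
      rw [hιp, e.left_inv hpe]; exact hpV
  have hret : IsLocalRetraction M W π := by
    refine ⟨hWo, fun x hx => ContDiffAt.contDiffWithinAt ?_, fun x hx => ?_, fun x hxM hx => ?_⟩
    · obtain ⟨⟨f', hf'⟩, hxU, -⟩ := hV _ hx.2.2
      have h1 : HasFDerivAt e (f' : Cn n →L[ℝ] EuclideanSpace ℝ (Fin d) × K) (e.symm (ι x)) := by
        rw [hf']
        exact (hΦd _ hxU).differentiableAt.hasFDerivAt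
      exact (e.contDiffAt_symm hx.2.1 h1 (hΦ.contDiffAt (hU.mem_nhds hxU))).comp x hι.contDiffAt
    · obtain ⟨-, hxU, -⟩ := hV _ hx.2.2
      refine (hmem _ hxU).2 ?_
      have := e.right_inv hx.2.1
      exact congrArg Prod.fst this
    · obtain ⟨-, hxU, hxe⟩ := hV _ hx.1
      have h1 : ι x = e x := by rw [he]; simp [ι, Φ, (hmem x hxU).1 hxM]
      change e.symm (ι x) = x
      rw [h1, e.left_inv hxe]
  refine ⟨⟨W, π, hpW, hret⟩, le_antisymm ?_ ?_⟩
  · intro v hv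
    have h0 : ∀ᶠ x in nhdsWithin p M, ρ x = 0 := by
      filter_upwards [self_mem_nhdsWithin, mem_nhdsWithin_of_mem_nhds (hU.mem_nhds hpU)]
        with x hx hxU
      exact (hmem x hxU).1 hx
    exact fderiv_apply_eq_zero hp ((hρ.contDiffAt (hU.mem_nhds hpU)).differentiableAt (by simp)) h0 hv
  · intro v hv
    have hπd : DifferentiableAt ℝ π p :=
      (hret.contDiffOn.contDiffAt (hWo.mem_nhds hpW)).differentiableAt (by simp)
    have h1 : Φ' (fderiv ℝ π p v) = Φ' v := by
      have h2 : Φ ∘ π =ᶠ[nhds p] ι := by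
        filter_upwards [hWo.mem_nhds hpW] with x hx
        exact e.right_inv hx.2.1
      have hπp : π p = p := hret.eq_self p hp hpW
      have h3 : HasFDerivAt (Φ ∘ π) ((Φ' : Cn n →L[ℝ] _).comp (fderiv ℝ π p)) p := by
        refine HasFDerivAt.comp p ?_ hπd.hasFDerivAt
        rw [hπp]; exact hΦ'd
      have h4 : HasFDerivAt ι ((0 : Cn n →L[ℝ] EuclideanSpace ℝ (Fin d)).prod Q) p :=
        (hasFDerivAt_const (0 : EuclideanSpace ℝ (Fin d)) p).prodMk Q.hasFDerivAt
      have h5 := congrArg (fun T => T v) (h3.unique (h4.congr_of_eventuallyEq h2))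
      have h6 : Φ' v = (B v, Q v) := rfl
      rw [h6, show B v = 0 from hv]
      exact h5
    rw [← Φ'.injective h1]
    exact mem_tangentSpace_of_mapsTo (hWo.mem_nhds hpW) hret.mapsTo (hret.eq_self p hp hpW) hπd v

theorem IsSmoothSubmanifold.exists_retraction {n k : ℕ} {M : Set (Cn n)}
    (hM : IsSmoothSubmanifold k M) {p : Cn n} (hp : p ∈ M) :
    ∃ W π, p ∈ W ∧ IsLocalRetraction M W π := by
  obtain ⟨d, -, h⟩ := hM
  obtain ⟨U, ρ, hU, hpU, hρ, hs, hMU⟩ := h p hp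
  exact (exists_retraction_of_defining hU hρ hs hMU hp hpU).1

theorem IsSmoothSubmanifold.finrank_tangentSpace {n k : ℕ} {M : Set (Cn n)}
    (hM : IsSmoothSubmanifold k M) {p : Cn n} (hp : p ∈ M) :
    Module.finrank ℝ (tangentSpace M p) = k := by
  obtain ⟨d, hd, h⟩ := hM
  obtain ⟨U, ρ, hU, hpU, hρ, hs, hMU⟩ := h p hp
  rw [(exists_retraction_of_defining hU hρ hs hMU hp hpU).2]
  have h1 := LinearMap.finrank_range_add_finrank_ker
    (fderiv ℝ ρ p : Cn n →ₗ[ℝ] EuclideanSpace ℝ (Fin d))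
  rw [LinearMap.range_eq_top.2 (hs p hpU), finrank_top, finrank_euclideanSpace,
    Fintype.card_fin] at h1
  have h2 : Module.finrank ℝ (Cn n) = 2 * n := by
    rw [← Module.finrank_mul_finrank ℝ ℂ (Cn n), Complex.finrank_real_complex]
    simp
  omega

namespace IsLocalRetraction

variable {n : ℕ} {M W : Set (Cn n)} {π : Cn n → Cn n} {z : Cn n}

theorem contDiffAt (h : IsLocalRetraction M W π) (hz : z ∈ W) : ContDiffAt ℝ ∞ π z :=
  h.contDiffOn.contDiffAt (h.isOpen.mem_nhds hz)

theorem differentiableAt (h : IsLocalRetraction M W π) (hz : z ∈ W) :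
    DifferentiableAt ℝ π z := (h.contDiffAt hz).differentiableAt (by simp)

/-- The displacement `x - π x` vanishes on `M`. -/
theorem eventually_sub_eq_zero (h : IsLocalRetraction M W π) (hz : z ∈ W) :
    ∀ᶠ x in nhdsWithin z M, x - π x = 0 := by
  filter_upwards [self_mem_nhdsWithin, mem_nhdsWithin_of_mem_nhds (h.isOpen.mem_nhds hz)]
    with x hx hxW
  rw [h.eq_self x hx hxW, sub_self]

theorem contDiffAt_sub (h : IsLocalRetraction M W π) (hz : z ∈ W) :
    ContDiffAt ℝ ∞ (fun x => x - π x) z := contDiffAt_id.sub (h.contDiffAt hz)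

theorem fderiv_sub (h : IsLocalRetraction M W π) (hz : z ∈ W) (v : Cn n) :
    fderiv ℝ (fun x => x - π x) z v = v - fderiv ℝ π z v := by
  have h1 := (hasFDerivAt_id (𝕜 := ℝ) z).sub (h.differentiableAt hz).hasFDerivAt
  have h2 : fderiv ℝ (fun x => x - π x) z = _ := h1.fderiv
  rw [h2]
  rfl

/-- The tangent space is the kernel of the differential of the displacement `x - π x`. -/
theorem mem_tangentSpace_iff (h : IsLocalRetraction M W π) (hz : z ∈ M) (hzW : z ∈ W)
    {v : Cn n} : v ∈ tangentSpace M z ↔ fderiv ℝ (fun x => x - π x) z v = 0 := by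
  constructor
  · exact fderiv_apply_eq_zero hz ((h.contDiffAt_sub hzW).differentiableAt (by simp))
      (h.eventually_sub_eq_zero hzW)
  · rw [h.fderiv_sub hzW, sub_eq_zero]
    intro hv
    rw [hv]
    exact mem_tangentSpace_of_mapsTo (h.isOpen.mem_nhds hzW) h.mapsTo (h.eq_self z hz hzW)
      (h.differentiableAt hzW) v

end IsLocalRetraction

/-! ### Smoothness of the orthogonal projections, and the form `η` -/

section KernelProjection

variable {E F : Type*} [NormedAddCommGroup E] [InnerProductSpace ℝ E] [FiniteDimensional ℝ E]
  [NormedAddCommGroup F] [InnerProductSpace ℝ F] [FiniteDimensional ℝ F]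

open ContinuousLinearMap in
theorem isUnit_comp_adjoint {B : E →L[ℝ] F} (hB : Function.Surjective B) :
    IsUnit (B.comp (adjoint B)) := by
  have hinj : Function.Injective (B.comp (adjoint B)) := by
    rw [injective_iff_map_eq_zero]
    intro y hy
    obtain ⟨x, rfl⟩ := hB y
    have h1 : adjoint B (B x) = 0 := by
      rw [← inner_self_eq_zero (𝕜 := ℝ), adjoint_inner_left]
      change inner ℝ (B x) ((B.comp (adjoint B)) (B x)) = 0
      rw [hy, inner_zero_right]
    rw [← inner_self_eq_zero (𝕜 := ℝ), ← adjoint_inner_left, h1, inner_zero_left]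
  rw [isUnit_iff_bijective]
  exact ⟨hinj, LinearMap.injective_iff_surjective
    (f := (B.comp (adjoint B) : F →ₗ[ℝ] F)) |>.1 hinj⟩

open ContinuousLinearMap in
/-- The orthogonal projection onto the kernel of a surjective map `B` is `1 - B† (B B†)⁻¹ B`. -/
theorem starProjection_ker {B : E →L[ℝ] F} (hB : Function.Surjective B) :
    (LinearMap.ker (B : E →ₗ[ℝ] F)).starProjection =
      ContinuousLinearMap.id ℝ E -
        (adjoint B).comp ((Ring.inverse (B.comp (adjoint B))).comp B) := by
  ext v
  refine Submodule.eq_starProjection_of_mem_of_inner_eq_zero ?_ fun w hw => ?_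
  · have h1 : (B.comp (adjoint B)) * Ring.inverse (B.comp (adjoint B)) = 1 :=
      Ring.mul_inverse_cancel _ (isUnit_comp_adjoint hB)
    have h2 := congrArg (fun T : F →L[ℝ] F => T (B v)) h1
    change B (v - adjoint B (Ring.inverse (B.comp (adjoint B)) (B v))) = 0
    rw [map_sub, sub_eq_zero]
    exact h2.symm
  · have hw' : B w = 0 := hw
    simp [adjoint_inner_left, hw']

open ContinuousLinearMap in
theorem contDiffOn_starProjection_ker {G : Type*} [NormedAddCommGroup G] [NormedSpace ℝ G]
    {B : G → E →L[ℝ] F} {U : Set G} (hB : ContDiffOn ℝ ∞ B U)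
    (hs : ∀ x ∈ U, Function.Surjective (B x)) :
    ContDiffOn ℝ ∞ (fun x => (LinearMap.ker (B x : E →ₗ[ℝ] F)).starProjection) U := by
  let adj : (E →L[ℝ] F) →L[ℝ] (F →L[ℝ] E) :=
    { toFun := fun T => adjoint T
      map_add' := fun S T => map_add _ S T
      map_smul' := fun c T => by simp
      cont := (adjoint (𝕜 := ℝ) (E := E) (F := F)).continuous }
  have hadj : ContDiffOn ℝ ∞ (fun x => adjoint (B x)) U := adj.contDiff.comp_contDiffOn hB
  have hinv : ContDiffOn ℝ ∞ (fun x => Ring.inverse ((B x).comp (adjoint (B x)))) U := by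
    intro x hx
    obtain ⟨u, hu⟩ := isUnit_comp_adjoint (hs x hx)
    have h1 : ContDiffAt ℝ ∞ Ring.inverse ((B x).comp (adjoint (B x))) := by
      rw [← hu]; exact contDiffAt_ringInverse ℝ u
    exact h1.comp_contDiffWithinAt (f := fun x => (B x).comp (adjoint (B x))) x
      ((hB.clm_comp hadj) x hx)
  exact (contDiffOn_const.sub (hadj.clm_comp (hinv.clm_comp hB))).congr
    fun x hx => starProjection_ker (hs x hx)

end KernelProjection

theorem IsSmoothSubmanifold.contDiffOn_starProjection {n k : ℕ} {M : Set (Cn n)}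
    (hM : IsSmoothSubmanifold k M) :
    ContDiffOn ℝ ∞ (fun x => (tangentSpace M x).starProjection) M := by
  obtain ⟨d, -, h⟩ := hM
  intro p hp
  obtain ⟨U, ρ, hU, hpU, hρ, hs, hMU⟩ := h p hp
  have h1 := contDiffOn_starProjection_ker (hρ.fderiv_of_isOpen hU (m := ∞) (by simp)) hs
  have h2 := (h1.contDiffAt (hU.mem_nhds hpU)).contDiffWithinAt (s := M)
  have h3 : ∀ x ∈ M, x ∈ U → (tangentSpace M x).starProjection =
      (LinearMap.ker (fderiv ℝ ρ x : Cn n →ₗ[ℝ] EuclideanSpace ℝ (Fin d))).starProjection := by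
    intro x hx hxU
    have := (exists_retraction_of_defining hU hρ hs hMU hx hxU).2
    congr 1
  refine h2.congr_of_eventuallyEq ?_ (h3 p hp hpU)
  filter_upwards [self_mem_nhdsWithin, mem_nhdsWithin_of_mem_nhds (hU.mem_nhds hpU)] with x hx hxU
  exact h3 x hx hxU

theorem real_inner_eq_re {n : ℕ} (x y : Cn n) : inner ℝ x y = (inner ℂ x y).re := by
  simp [PiLp.inner_apply]

theorem inner_J_J {n : ℕ} (x y : Cn n) : inner ℝ (J n x) (J n y) = inner ℝ x y := by
  simp only [real_inner_eq_re, J_apply, inner_smul_left, inner_smul_right]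
  rw [← mul_assoc]
  simp

theorem inner_J_left {n : ℕ} (x y : Cn n) : inner ℝ (J n x) y = -inner ℝ x (J n y) := by
  have := inner_J_J x (-(J n y))
  rw [map_neg, J_J, neg_neg, inner_neg_right] at this
  exact this

theorem inner_J_self {n : ℕ} (x : Cn n) : inner ℝ (J n x) x = 0 := by
  have := inner_J_left x x
  rw [← real_inner_comm] at this
  rw [← real_inner_comm]
  linarith

theorem complex_inner_eq_zero_iff {n : ℕ} (x y : Cn n) :
    inner ℂ x y = 0 ↔ inner ℝ x y = 0 ∧ inner ℝ x (J n y) = 0 := by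
  rw [Complex.ext_iff]
  simp [real_inner_eq_re, J_apply]

theorem J_mem_complexTangent {n : ℕ} {M : Set (Cn n)} {z a : Cn n}
    (h : a ∈ complexTangent M z) : J n a ∈ complexTangent M z :=
  (complexTangent M z).smul_mem Complex.I h

theorem real_smul_mem_complexTangent {n : ℕ} {M : Set (Cn n)} {z a : Cn n} (t : ℝ)
    (h : a ∈ complexTangent M z) : t • a ∈ complexTangent M z := by
  rw [← Complex.coe_smul]
  exact (complexTangent M z).smul_mem _ h

theorem proj_mem {n : ℕ} (M : Set (Cn n)) (z v : Cn n) : proj M z v ∈ complexTangent M z :=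
  Submodule.starProjection_apply_mem _ _

theorem proj_eq_self {n : ℕ} {M : Set (Cn n)} {z a : Cn n} (h : a ∈ complexTangent M z) :
    proj M z a = a := Submodule.starProjection_eq_self_iff.2 h

theorem inner_sub_proj {n : ℕ} (M : Set (Cn n)) (z v : Cn n) {a : Cn n}
    (ha : a ∈ complexTangent M z) : inner ℝ (v - proj M z v) a = 0 := by
  rw [real_inner_eq_re, proj, Submodule.starProjection_inner_eq_zero v a ha, Complex.zero_re]

section Hypersurface

variable {n m : ℕ} {M : Set (Cn n)} {z : Cn n}

/-- The complex tangent space has real codimension one in the tangent space. -/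
theorem IsCRHypersurfaceType.exists_sub_smul_mem (hCR : IsCRHypersurfaceType m M) (hz : z ∈ M)
    {t v : Cn n} (ht : t ∈ tangentSpace M z) (ht' : t ∉ complexTangent M z)
    (hv : v ∈ tangentSpace M z) : ∃ c : ℝ, v - c • t ∈ complexTangent M z := by
  let C : Submodule ℝ (Cn n) := (complexTangent M z).restrictScalars ℝ
  have hC : Module.finrank ℝ C = 2 * Module.finrank ℂ (complexTangent M z) := by
    rw [← Complex.finrank_real_complex, Module.finrank_mul_finrank ℝ ℂ (complexTangent M z)]
    rfl
  have hCT : C ≤ tangentSpace M z := fun a ha => ha.1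
  have hT := hCR.1.finrank_tangentSpace hz
  have hm := hCR.2 z hz
  have hle : C ⊔ Submodule.span ℝ {t} ≤ tangentSpace M z :=
    sup_le hCT (by rwa [Submodule.span_singleton_le_iff_mem])
  have hlt : C < C ⊔ Submodule.span ℝ {t} := by
    refine lt_of_le_of_ne le_sup_left fun h => ht' ?_
    have : t ∈ C := by
      rw [h]; exact Submodule.mem_sup_right (Submodule.mem_span_singleton_self t)
    exact this
  have h1 := Submodule.finrank_lt_finrank_of_lt hlt
  have h2 := Submodule.finrank_mono hle
  have h3 : C ⊔ Submodule.span ℝ {t} = tangentSpace M z :=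
    Submodule.eq_of_le_of_finrank_eq hle (by omega)
  rw [← h3] at hv
  obtain ⟨a, ha, b, hb, rfl⟩ := Submodule.mem_sup.1 hv
  obtain ⟨c, rfl⟩ := Submodule.mem_span_singleton.1 hb
  refine ⟨c, ?_⟩
  rw [add_sub_cancel_right]
  exact ha

/-- `J` maps the part of a tangent vector that is orthogonal to the complex tangent space into the
normal space of `M`. -/
theorem IsCRHypersurfaceType.inner_J_sub_proj (hCR : IsCRHypersurfaceType m M) (hz : z ∈ M)
    {t v : Cn n} (ht : t ∈ tangentSpace M z) (hv : v ∈ tangentSpace M z) :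
    inner ℝ (J n (t - proj M z t)) v = 0 := by
  by_cases htC : t ∈ complexTangent M z
  · rw [proj_eq_self htC]; simp
  obtain ⟨c, hc⟩ := hCR.exists_sub_smul_mem hz ht htC hv
  have h1 : v = c • (t - proj M z t) + ((v - c • t) + c • proj M z t) := by module
  have h2 : (v - c • t) + c • proj M z t ∈ complexTangent M z :=
    add_mem hc (real_smul_mem_complexTangent c (proj_mem M z t))
  rw [h1, inner_add_right, inner_smul_right, inner_J_self, inner_J_left,
    inner_sub_proj M z t (J_mem_complexTangent h2)]
  simp

/-- As `T_z(M) = T^ℂ_z(M) ⊕ ℝN` with `JN` normal to `M`, the orthogonal projections onto `T_z(M)`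
and onto `J T_z(M)` commute, and their product projects onto the complex tangent space. -/
theorem IsCRHypersurfaceType.proj_eq (hCR : IsCRHypersurfaceType m M) (hz : z ∈ M) :
    (proj M z).restrictScalars ℝ = -((tangentSpace M z).starProjection.comp
      ((J n).comp ((tangentSpace M z).starProjection.comp (J n)))) := by
  set D := (tangentSpace M z).starProjection
  have hD : ∀ v, D v ∈ tangentSpace M z := fun v => Submodule.starProjection_apply_mem _ _
  have hDself : ∀ v ∈ tangentSpace M z, D v = v := fun v hv =>
    Submodule.starProjection_eq_self_iff.2 hv
  have hDsymm : ∀ v w, inner ℝ (D v) w = inner ℝ v (D w) := fun v w =>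
    Submodule.inner_starProjection_left_eq_right _ v w
  have hD0 : ∀ v, (∀ w ∈ tangentSpace M z, inner ℝ v w = 0) → D v = 0 := fun v hv =>
    Submodule.eq_starProjection_of_mem_of_inner_eq_zero (zero_mem _) (by simpa using hv)
  ext1 v
  change proj M z v = -D (J n (D (J n v)))
  refine Submodule.eq_starProjection_of_mem_of_inner_eq_zero ?_ fun w hw => ?_
  · set w := D (J n v)
    have h1 : w = (w - proj M z w) + proj M z w := by abel
    have h2 : D (J n (w - proj M z w)) = 0 :=
      hD0 _ fun u hu => hCR.inner_J_sub_proj hz (hD _) hu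
    rw [h1, map_add, map_add, h2, zero_add, hDself _ (J_mem_complexTangent (proj_mem M z w)).1]
    exact neg_mem (J_mem_complexTangent (proj_mem M z w))
  · have h1 : ∀ w ∈ complexTangent M z, inner ℝ (v - -D (J n (D (J n v)))) w = 0 := by
      intro w hw
      rw [sub_neg_eq_add, inner_add_left, hDsymm, hDself w hw.1, inner_J_left, hDsymm,
        hDself _ (J_mem_complexTangent hw).1, inner_J_J]
      ring
    exact (complex_inner_eq_zero_iff _ _).2 ⟨h1 w hw, h1 _ (J_mem_complexTangent hw)⟩

theorem IsCRHypersurfaceType.contDiffOn_proj (hCR : IsCRHypersurfaceType m M) :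
    ContDiffOn ℝ ∞ (fun x => (proj M x).restrictScalars ℝ) M := by
  have hD := hCR.1.contDiffOn_starProjection
  exact ((hD.clm_comp (contDiffOn_const.clm_comp (hD.clm_comp contDiffOn_const))).neg).congr
    fun x hx => hCR.proj_eq hx

theorem IsSection.J {X : Cn n → Cn n} (hX : IsSection M X) : IsSection M fun x => J n (X x) :=
  ⟨(CRSub.J n).contDiff.comp_contDiffOn hX.1, fun x hx => J_mem_complexTangent (hX.2 x hx)⟩

theorem IsCRHypersurfaceType.isSection_proj (hCR : IsCRHypersurfaceType m M) (a : Cn n) :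
    IsSection M fun x => proj M x a :=
  ⟨hCR.contDiffOn_proj.clm_apply contDiffOn_const, fun x _ => proj_mem M x a⟩

theorem eta_apply (M : Set (Cn n)) (T : Cn n → Cn n) (z v : Cn n) :
    eta M T z v = (‖normalPart M T z‖ ^ 2)⁻¹ * inner ℝ (normalPart M T z) v := by
  rw [real_inner_eq_re]
  rfl

theorem eta_eq_zero {T : Cn n → Cn n} {a : Cn n} (ha : a ∈ complexTangent M z) :
    eta M T z a = 0 := by
  rw [eta_apply, normalPart, inner_sub_proj M z _ ha, mul_zero]

theorem normalPart_ne_zero {T : Cn n → Cn n} (h : T z ∉ complexTangent M z) :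
    normalPart M T z ≠ 0 := fun h0 => h <| by
  rw [normalPart, sub_eq_zero] at h0
  rw [h0]
  exact proj_mem M z _

theorem eta_self {T : Cn n → Cn n} (h : T z ∉ complexTangent M z) : eta M T z (T z) = 1 := by
  have h1 : T z = normalPart M T z + proj M z (T z) := by simp [normalPart]
  have h2 : eta M T z (T z) = eta M T z (normalPart M T z) := by
    conv_lhs => rw [h1]
    rw [map_add, eta_eq_zero (proj_mem M z _), add_zero]
  rw [h2, eta_apply, real_inner_self_eq_norm_sq]
  have : ‖normalPart M T z‖ ≠ 0 := norm_ne_zero_iff.2 (normalPart_ne_zero h)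
  field_simp

theorem IsCRHypersurfaceType.sub_eta_smul_mem (hCR : IsCRHypersurfaceType m M) (hz : z ∈ M)
    {T : Cn n → Cn n} {v : Cn n} (hT : T z ∈ tangentSpace M z) (hT' : T z ∉ complexTangent M z)
    (hv : v ∈ tangentSpace M z) : v - eta M T z v • T z ∈ complexTangent M z := by
  obtain ⟨c, hc⟩ := hCR.exists_sub_smul_mem hz hT hT' hv
  have h1 := eta_eq_zero (T := T) hc
  rw [map_sub, map_smul, eta_self hT', smul_eq_mul, mul_one, sub_eq_zero] at h1
  rwa [h1]

theorem IsCRHypersurfaceType.sub_proj_eq (hCR : IsCRHypersurfaceType m M) (hz : z ∈ M)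
    {T : Cn n → Cn n} {v : Cn n} (hT : T z ∈ tangentSpace M z) (hT' : T z ∉ complexTangent M z)
    (hv : v ∈ tangentSpace M z) : v - proj M z v = eta M T z v • normalPart M T z := by
  have h1 := proj_eq_self (hCR.sub_eta_smul_mem hz hT hT' hv)
  rw [map_sub, show proj M z (eta M T z v • T z) = eta M T z v • proj M z (T z) from
    ((proj M z).restrictScalars ℝ).map_smul _ _] at h1
  rw [normalPart, smul_sub]
  have h2 := congrArg (fun w => v - w - eta M T z v • proj M z (T z)) h1
  rw [show v - proj M z v = v - (proj M z v - eta M T z v • proj M z (T z)) -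
    eta M T z v • proj M z (T z) by abel, h2]
  abel

/-- The forms `η` of two transversal fields are multiples of each other on `T_z(M)`. -/
theorem IsCRHypersurfaceType.eta_eq_mul (hCR : IsCRHypersurfaceType m M) (hz : z ∈ M)
    {T T' : Cn n → Cn n} {v : Cn n} (hT' : T' z ∈ tangentSpace M z)
    (hT'' : T' z ∉ complexTangent M z) (hv : v ∈ tangentSpace M z) :
    eta M T z v = eta M T z (T' z) * eta M T' z v := by
  have h1 := eta_eq_zero (T := T) (hCR.sub_eta_smul_mem hz hT' hT'' hv)
  rw [map_sub, map_smul, smul_eq_mul, sub_eq_zero] at h1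
  rw [h1, mul_comm]

theorem IsCRHypersurfaceType.contDiffOn_normalPart (hCR : IsCRHypersurfaceType m M)
    {V : Set (Cn n)} {T : Cn n → Cn n} (hT : IsTransversal M V T) :
    ContDiffOn ℝ ∞ (normalPart M T) (M ∩ V) :=
  hT.1.sub ((hCR.contDiffOn_proj.mono Set.inter_subset_left).clm_apply hT.1)

theorem IsCRHypersurfaceType.contDiffOn_eta (hCR : IsCRHypersurfaceType m M)
    {V : Set (Cn n)} {T : Cn n → Cn n} (hT : IsTransversal M V T) :
    ContDiffOn ℝ ∞ (eta M T) (M ∩ V) := by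
  have hN := hCR.contDiffOn_normalPart hT
  have h1 : ContDiffOn ℝ ∞ (fun x => (‖normalPart M T x‖ ^ 2)⁻¹ • innerSL ℝ (normalPart M T x))
      (M ∩ V) := by
    refine ((hN.norm_sq ℝ).inv fun x hx => ?_).smul ((innerSL ℝ).contDiff.comp_contDiffOn hN)
    exact pow_ne_zero 2 (norm_ne_zero_iff.2 (normalPart_ne_zero (hT.2 x hx).2))
  refine h1.congr fun x _ => ?_
  ext v
  rw [eta_apply]
  rfl

end Hypersurface

/-! ### The Levi form as a complex Hessian -/

section LeviForm

variable {n m : ℕ} {M : Set (Cn n)} {z : Cn n}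

/-- If `f` vanishes on `M` and `X` is tangential, then `X f = 0` on `M`; this is the derivative of
that identity. -/
theorem fderiv_fderiv_add_eq_zero {F : Type*} [NormedAddCommGroup F] [NormedSpace ℝ F]
    {f : Cn n → F} {X : Cn n → Cn n} {X' : Cn n →L[ℝ] Cn n} (hz : z ∈ M)
    (hf : ContDiffAt ℝ 2 f z) (h0 : ∀ᶠ x in nhdsWithin z M, f x = 0)
    (hX : HasFDerivWithinAt X X' M z) (hXM : ∀ x ∈ M, X x ∈ tangentSpace M x)
    {u : Cn n} (hu : u ∈ tangentSpace M z) :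
    fderiv ℝ (fderiv ℝ f) z u (X z) + fderiv ℝ f z (X' u) = 0 := by
  have h1 : HasFDerivWithinAt (fun x => fderiv ℝ f x (X x)) _ M z :=
    (ContDiffAt.differentiableAt_fderiv hf).hasFDerivAt.hasFDerivWithinAt.clm_apply hX
  have h2 : ∀ᶠ x in nhdsWithin z M, fderiv ℝ f x (X x) = 0 := by
    filter_upwards [self_mem_nhdsWithin, eventually_eventually_nhdsWithin.2 h0,
      mem_nhdsWithin_of_mem_nhds (ContDiffAt.eventually_differentiableAt hf)] with x hx hx0 hxd
    exact fderiv_apply_eq_zero hx hxd hx0 (hXM x hx)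
  have h3 : HasFDerivWithinAt (fun x => fderiv ℝ f x (X x)) (0 : Cn n →L[ℝ] F) M z :=
    (hasFDerivWithinAt_const (0 : F) z M).congr_of_eventuallyEq h2 (h2.self_of_nhdsWithin hz)
  have h4 := eq_of_hasFDerivWithinAt h1 h3 hu
  refine Eq.trans ?_ h4
  simp [add_comm]

theorem IsSection.hasFDerivWithinAt {X : Cn n → Cn n} (hX : IsSection M X) (hz : z ∈ M) :
    HasFDerivWithinAt X (fderivWithin ℝ X M z) M z :=
  ((hX.1 z hz).differentiableWithinAt (by simp)).hasFDerivWithinAt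

theorem IsSection.mem_tangentSpace {X : Cn n → Cn n} (hX : IsSection M X) {x : Cn n}
    (hx : x ∈ M) : X x ∈ tangentSpace M x := (hX.2 x hx).1

theorem IsSection.J_mem_tangentSpace {X : Cn n → Cn n} (hX : IsSection M X) {x : Cn n}
    (hx : x ∈ M) : CRSub.J n (X x) ∈ tangentSpace M x := (hX.2 x hx).2

theorem hasFDerivWithinAt_clm_comp {X : Cn n → Cn n} {X' : Cn n →L[ℝ] Cn n}
    (L : Cn n →L[ℝ] Cn n) (hX : HasFDerivWithinAt X X' M z) :
    HasFDerivWithinAt (fun x => L (X x)) (L.comp X') M z :=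
  L.hasFDerivAt.comp_hasFDerivWithinAt z hX

/-- On tangent vectors, `fderivWithin` along `M` is computed by any derivative along `M`. -/
theorem fderivWithin_apply_eq {F : Type*} [NormedAddCommGroup F] [NormedSpace ℝ F]
    {f : Cn n → F} {f' : Cn n →L[ℝ] F} (h : HasFDerivWithinAt f f' M z) {u : Cn n}
    (hu : u ∈ tangentSpace M z) : fderivWithin ℝ f M z u = f' u :=
  eq_of_hasFDerivWithinAt h.differentiableWithinAt.hasFDerivWithinAt h hu

theorem lieBracketWithin_clm {X Y : Cn n → Cn n} (hX : IsSection M X) (hY : IsSection M Y)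
    (hz : z ∈ M) (K L : Cn n →L[ℝ] Cn n) (hK : K (X z) ∈ tangentSpace M z)
    (hL : L (Y z) ∈ tangentSpace M z) :
    VectorField.lieBracketWithin ℝ (fun x => K (X x)) (fun x => L (Y x)) M z =
      L (fderivWithin ℝ Y M z (K (X z))) - K (fderivWithin ℝ X M z (L (Y z))) := by
  simp only [VectorField.lieBracketWithin_eq]
  rw [fderivWithin_apply_eq (hasFDerivWithinAt_clm_comp L (hY.hasFDerivWithinAt hz)) hK,
    fderivWithin_apply_eq (hasFDerivWithinAt_clm_comp K (hX.hasFDerivWithinAt hz)) hL]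
  rfl

/-- The value at `z` of `[X, JY] - [JX, Y]`, eight times whose `η`-component is the real part of
the Levi form. -/
noncomputable def leviVec (M : Set (Cn n)) (X Y : Cn n → Cn n) (z : Cn n) : Cn n :=
  J n (fderivWithin ℝ Y M z (X z)) - fderivWithin ℝ X M z (J n (Y z)) -
    fderivWithin ℝ Y M z (J n (X z)) + J n (fderivWithin ℝ X M z (Y z))

theorem cBracket_snd {X Y : Cn n → Cn n} (hX : IsSection M X) (hY : IsSection M Y)
    (hz : z ∈ M) :
    (cBracket M (fun x => vec10 (X x)) (fun x => vec01 (Y x)) z).2 =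
      (1 / 4 : ℝ) • leviVec M X Y z := by
  let I₂ : Cn n →L[ℝ] Cn n := (1 / 2 : ℝ) • ContinuousLinearMap.id ℝ (Cn n)
  let J₂ : Cn n →L[ℝ] Cn n := (1 / 2 : ℝ) • J n
  have hX1 := hX.mem_tangentSpace hz
  have hX2 := hX.J_mem_tangentSpace hz
  have hY1 := hY.mem_tangentSpace hz
  have hY2 := hY.J_mem_tangentSpace hz
  have h1 := lieBracketWithin_clm hX hY hz I₂ J₂ (Submodule.smul_mem _ _ hX1)
    (Submodule.smul_mem _ _ hY2)
  have h2 := lieBracketWithin_clm hX hY hz (-J₂) I₂ (neg_mem (Submodule.smul_mem _ _ hX2))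
    (Submodule.smul_mem _ _ hY1)
  refine (congrArg₂ (· + ·) h1 h2).trans ?_
  simp only [I₂, J₂, leviVec, smul_apply, ContinuousLinearMap.id_apply, neg_apply, map_smul,
    map_neg]
  module

theorem leviVec_J_right {X Y : Cn n → Cn n} (hX : IsSection M X) (hY : IsSection M Y)
    (hz : z ∈ M) : leviVec M X (fun x => J n (Y x)) z =
      -fderivWithin ℝ Y M z (X z) + fderivWithin ℝ X M z (Y z) -
        J n (fderivWithin ℝ Y M z (J n (X z))) + J n (fderivWithin ℝ X M z (J n (Y z))) := by
  have h := hasFDerivWithinAt_clm_comp (J n) (hY.hasFDerivWithinAt hz)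
  rw [leviVec, fderivWithin_apply_eq h (hX.mem_tangentSpace hz),
    fderivWithin_apply_eq h (hX.J_mem_tangentSpace hz)]
  simp [J_J]

theorem cBracket_fst {X Y : Cn n → Cn n} (hX : IsSection M X) (hY : IsSection M Y)
    (hz : z ∈ M) :
    (cBracket M (fun x => vec10 (X x)) (fun x => vec01 (Y x)) z).1 =
      -((1 / 4 : ℝ) • leviVec M X (fun x => J n (Y x)) z) := by
  let I₂ : Cn n →L[ℝ] Cn n := (1 / 2 : ℝ) • ContinuousLinearMap.id ℝ (Cn n)
  let J₂ : Cn n →L[ℝ] Cn n := (1 / 2 : ℝ) • J n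
  have hX1 := hX.mem_tangentSpace hz
  have hX2 := hX.J_mem_tangentSpace hz
  have hY1 := hY.mem_tangentSpace hz
  have hY2 := hY.J_mem_tangentSpace hz
  have h1 := lieBracketWithin_clm hX hY hz I₂ I₂ (Submodule.smul_mem _ _ hX1)
    (Submodule.smul_mem _ _ hY1)
  have h2 := lieBracketWithin_clm hX hY hz (-J₂) J₂ (neg_mem (Submodule.smul_mem _ _ hX2))
    (Submodule.smul_mem _ _ hY2)
  refine (congrArg₂ (· - ·) h1 h2).trans ?_
  rw [leviVec_J_right hX hY hz]
  simp only [I₂, J₂, smul_apply, ContinuousLinearMap.id_apply, neg_apply, map_smul, map_neg]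
  module

theorem leviForm_re {X Y : Cn n → Cn n} (hX : IsSection M X) (hY : IsSection M Y)
    (hz : z ∈ M) (T : Cn n → Cn n) :
    (leviForm M T X Y z).re = (1 / 8) * eta M T z (leviVec M X Y z) := by
  rw [leviForm, cBracket_snd hX hY hz, cBracket_fst hX hY hz]
  simp only [map_neg, map_smul, smul_eq_mul]
  have : (1 / (2 * Complex.I)) = -(1 / 2 : ℝ) * Complex.I := by
    field_simp
    simp
  rw [this]
  simp
  ring

theorem leviForm_im {X Y : Cn n → Cn n} (hX : IsSection M X) (hY : IsSection M Y)
    (hz : z ∈ M) (T : Cn n → Cn n) :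
    (leviForm M T X Y z).im = (leviForm M T X (fun x => J n (Y x)) z).re := by
  rw [leviForm_re hX hY.J hz, leviForm, cBracket_snd hX hY hz, cBracket_fst hX hY hz]
  simp only [map_neg, map_smul, smul_eq_mul]
  have : (1 / (2 * Complex.I)) = -(1 / 2 : ℝ) * Complex.I := by
    field_simp
    simp
  rw [this]
  simp
  ring

theorem IsSmoothSubmanifold.leviVec_mem {k : ℕ} (hM : IsSmoothSubmanifold k M)
    {X Y : Cn n → Cn n} (hX : IsSection M X) (hY : IsSection M Y) (hz : z ∈ M) :
    leviVec M X Y z ∈ tangentSpace M z := by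
  obtain ⟨W, π, hzW, hπ⟩ := hM.exists_retraction hz
  have hf : ContDiffAt ℝ 2 (fun x => x - π x) z := (hπ.contDiffAt_sub hzW).of_le (WithTop.coe_le_coe.2 le_top)
  have h0 := hπ.eventually_sub_eq_zero hzW
  rw [hπ.mem_tangentSpace_iff hz hzW]
  have hX' := hX.hasFDerivWithinAt hz
  have hY' := hY.hasFDerivWithinAt hz
  have e1 := fderiv_fderiv_add_eq_zero hz hf h0 (hasFDerivWithinAt_clm_comp (J n) hY')
    (fun x hx => hY.J_mem_tangentSpace hx) (hX.mem_tangentSpace hz)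
  have e2 := fderiv_fderiv_add_eq_zero hz hf h0 hX'
    (fun x hx => hX.mem_tangentSpace hx) (hY.J_mem_tangentSpace hz)
  have e3 := fderiv_fderiv_add_eq_zero hz hf h0 hY'
    (fun x hx => hY.mem_tangentSpace hx) (hX.J_mem_tangentSpace hz)
  have e4 := fderiv_fderiv_add_eq_zero hz hf h0 (hasFDerivWithinAt_clm_comp (J n) hX')
    (fun x hx => hX.J_mem_tangentSpace hx) (hY.mem_tangentSpace hz)
  rw [ContDiffAt.fderiv_fderiv_comm hf] at e2 e4
  simp only [ContinuousLinearMap.comp_apply] at e1 e4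
  rw [leviVec, map_add, map_sub, map_sub, eq_neg_of_add_eq_zero_right e1,
    eq_neg_of_add_eq_zero_right e2, eq_neg_of_add_eq_zero_right e3,
    eq_neg_of_add_eq_zero_right e4]
  abel

/-- For a function `f` vanishing on `M`, the complex Hessian on the complex tangent space is the
Levi form times the derivative of `f` in the direction `JT` (the factor `4` comes from `jHess`). -/
theorem IsCRHypersurfaceType.jHess_eq_leviForm (hCR : IsCRHypersurfaceType m M)
    {F : Type*} [NormedAddCommGroup F] [NormedSpace ℝ F] {f : Cn n → F} (hz : z ∈ M)
    (hf : ContDiffAt ℝ 2 f z) (h0 : ∀ᶠ x in nhdsWithin z M, f x = 0) {T X Y : Cn n → Cn n}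
    (hT : T z ∈ tangentSpace M z) (hT' : T z ∉ complexTangent M z)
    (hX : IsSection M X) (hY : IsSection M Y) :
    jHess f z (X z) (Y z) = (4 * (leviForm M T X Y z).re) • fderiv ℝ f z (J n (T z)) := by
  have hX' := hX.hasFDerivWithinAt hz
  have hY' := hY.hasFDerivWithinAt hz
  have e1 := fderiv_fderiv_add_eq_zero hz hf h0 hY'
    (fun x hx => hY.mem_tangentSpace hx) (hX.mem_tangentSpace hz)
  have e2 := fderiv_fderiv_add_eq_zero hz hf h0 (hasFDerivWithinAt_clm_comp (J n) hX')
    (fun x hx => hX.J_mem_tangentSpace hx) (hY.J_mem_tangentSpace hz)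
  have e3 := fderiv_fderiv_add_eq_zero hz hf h0 (hasFDerivWithinAt_clm_comp (J n) hY')
    (fun x hx => hY.J_mem_tangentSpace hx) (hX.J_mem_tangentSpace hz)
  have e4 := fderiv_fderiv_add_eq_zero hz hf h0 hX'
    (fun x hx => hX.mem_tangentSpace hx) (hY.mem_tangentSpace hz)
  rw [ContDiffAt.fderiv_fderiv_comm hf] at e2 e4
  simp only [ContinuousLinearMap.comp_apply] at e2 e3
  have hw := hCR.1.leviVec_mem hX hY hz
  set w := leviVec M X Y z with hwdef
  have h1 : fderiv ℝ f z (J n w) = (2 : ℝ) • jHess f z (X z) (Y z) := by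
    rw [hwdef, leviVec]
    simp only [map_add, map_sub, J_J, map_neg]
    rw [eq_neg_of_add_eq_zero_right e1, eq_neg_of_add_eq_zero_right e2,
      eq_neg_of_add_eq_zero_right e3, eq_neg_of_add_eq_zero_right e4, jHess]
    module
  have h2 : fderiv ℝ f z (J n w) = eta M T z w • fderiv ℝ f z (J n (T z)) := by
    have h3 := J_mem_complexTangent (hCR.sub_eta_smul_mem hz hT hT' hw)
    have h4 := fderiv_apply_eq_zero hz (hf.differentiableAt (by simp)) h0 h3.1
    rw [map_sub, map_sub, map_smul, map_smul, sub_eq_zero] at h4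
    exact h4
  have h5 : jHess f z (X z) (Y z) = (1 / 2 : ℝ) • fderiv ℝ f z (J n w) := by
    rw [h1]; module
  rw [h5, h2, leviForm_re hX hY hz]
  module

/-- Levi forms relative to different transversal fields are multiples of each other. -/
theorem IsCRHypersurfaceType.leviForm_eq_mul (hCR : IsCRHypersurfaceType m M) (hz : z ∈ M)
    {T T' X Y : Cn n → Cn n} (hT : T' z ∈ tangentSpace M z)
    (hT' : T' z ∉ complexTangent M z) (hX : IsSection M X) (hY : IsSection M Y) :
    leviForm M T X Y z = (eta M T z (T' z) : ℂ) * leviForm M T' X Y z := by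
  have h : ∀ Y, IsSection M Y →
      (leviForm M T X Y z).re = eta M T z (T' z) * (leviForm M T' X Y z).re := by
    intro Y hY
    rw [leviForm_re hX hY hz, leviForm_re hX hY hz,
      hCR.eta_eq_mul (T := T) hz hT hT' (hCR.1.leviVec_mem hX hY hz)]
    ring
  apply Complex.ext
  · rw [Complex.re_ofReal_mul, h Y hY]
  · rw [Complex.im_ofReal_mul, leviForm_im hX hY hz, leviForm_im hX hY hz, h _ hY.J]

theorem eta_neg (M : Set (Cn n)) (T : Cn n → Cn n) (z v : Cn n) :
    eta M (fun x => -T x) z v = -eta M T z v := by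
  have h1 : normalPart M (fun x => -T x) z = -normalPart M T z := by
    simp only [normalPart, map_neg]; abel
  rw [eta_apply, eta_apply, h1, norm_neg, inner_neg_left, mul_neg]

/-- After a change of sign of `T`, pseudoconvexity makes the Levi form locally nonnegative. -/
theorem IsPseudoconvex.exists_leviNonneg (h : IsPseudoconvex M) {p : Cn n} (hp : p ∈ M) :
    ∃ (V : Set (Cn n)) (T : Cn n → Cn n), IsOpen V ∧ p ∈ V ∧ IsTransversal M V T ∧
      LeviNonneg M V T := by
  obtain ⟨V, T, hV, hpV, hT, h1 | h1⟩ := h p hp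
  · exact ⟨V, T, hV, hpV, hT, h1⟩
  · refine ⟨V, fun x => -T x, hV, hpV, ⟨hT.1.neg, fun x hx => ?_⟩, fun z hz X hX => ?_⟩
    · exact ⟨neg_mem (hT.2 x hx).1, fun h => (hT.2 x hx).2 (by simpa using neg_mem h)⟩
    · have h2 := h1 z hz X hX
      rw [leviForm_re hX hX hz.1] at h2 ⊢
      rw [eta_neg]
      linarith

end LeviForm

/-! ### Functions that vanish on `M` and control the Levi form and the normal directions -/

section ControlFunctions

variable {n m : ℕ} {M : Set (Cn n)} {z : Cn n}

theorem jHess_comm {f : Cn n → ℝ} (hf : ContDiffAt ℝ 2 f z) (a b : Cn n) :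
    jHess f z a b = jHess f z b a := by
  simp only [jHess, ContDiffAt.fderiv_fderiv_comm hf a, ContDiffAt.fderiv_fderiv_comm hf (J n a)]

/-- A positive semidefinite form vanishes on the vectors where its quadratic form does. -/
theorem jHess_eq_zero_of_self {f : Cn n → ℝ} (hf : ContDiffAt ℝ 2 f z)
    (hpos : ∀ a ∈ complexTangent M z, 0 ≤ jHess f z a a) {a b : Cn n}
    (ha : a ∈ complexTangent M z) (hb : b ∈ complexTangent M z) (h0 : jHess f z a a = 0) :
    jHess f z a b = 0 := by
  by_contra hne
  have h1 : ∀ t : ℝ, 0 ≤ jHess f z b b + 2 * t * jHess f z a b := by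
    intro t
    have h2 := hpos (b + t • a) (add_mem hb (real_smul_mem_complexTangent t ha))
    have h3 : jHess f z (b + t • a) (b + t • a) =
        jHess f z b b + t * jHess f z b a + t * jHess f z a b + t ^ 2 * jHess f z a a := by
      simp only [jHess, map_add, map_smul, add_apply, smul_apply, smul_eq_mul]
      ring
    rw [h3, h0, jHess_comm hf b a] at h2
    linarith
  have h2 := h1 (-(jHess f z b b + 1) / (2 * jHess f z a b))
  have h3 : 2 * (-(jHess f z b b + 1) / (2 * jHess f z a b)) * jHess f z a b =
      -(jHess f z b b + 1) := by
    field_simp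
  rw [h3] at h2
  linarith

theorem IsCRHypersurfaceType.jHess_nonneg_of_leviNonneg (hCR : IsCRHypersurfaceType m M)
    {V : Set (Cn n)} {T : Cn n → Cn n} (hT : IsTransversal M V T) (hL : LeviNonneg M V T)
    (hz : z ∈ M) (hzV : z ∈ V) {f : Cn n → ℝ} (hf : ContDiffAt ℝ 2 f z)
    (h0 : ∀ᶠ x in nhdsWithin z M, f x = 0) (hJT : 0 ≤ fderiv ℝ f z (J n (T z))) {a : Cn n}
    (ha : a ∈ complexTangent M z) : 0 ≤ jHess f z a a := by
  have hX := hCR.isSection_proj a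
  have h1 := hCR.jHess_eq_leviForm hz hf h0 (hT.2 z ⟨hz, hzV⟩).1 (hT.2 z ⟨hz, hzV⟩).2 hX hX
  simp only [proj_eq_self ha] at h1
  rw [h1, smul_eq_mul]
  exact mul_nonneg (mul_nonneg (by norm_num) (hL z ⟨hz, hzV⟩ _ hX)) hJT

theorem IsCRHypersurfaceType.mem_leviNull_of_jHess_eq_zero (hCR : IsCRHypersurfaceType m M)
    {V : Set (Cn n)} {T : Cn n → Cn n} (hT : IsTransversal M V T) (hL : LeviNonneg M V T)
    (hz : z ∈ M) (hzV : z ∈ V) {f : Cn n → ℝ} (hf : ContDiffAt ℝ 2 f z)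
    (h0 : ∀ᶠ x in nhdsWithin z M, f x = 0) (hJT : 0 < fderiv ℝ f z (J n (T z))) {a : Cn n}
    (ha : a ∈ complexTangent M z) (h : jHess f z a a = 0) : a ∈ leviNull M z := by
  refine ⟨ha, fun V' T' hV' hzV' hT' X Y hX hY hXa => ?_⟩
  obtain ⟨hT1, hT2⟩ := hT.2 z ⟨hz, hzV⟩
  have h1 : ∀ Y, IsSection M Y → (leviForm M T X Y z).re = 0 := by
    intro Y hY
    have h2 := hCR.jHess_eq_leviForm hz hf h0 hT1 hT2 hX hY
    rw [hXa, jHess_eq_zero_of_self hf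
      (fun b hb => hCR.jHess_nonneg_of_leviNonneg hT hL hz hzV hf h0 hJT.le hb) ha (hY.2 z hz) h,
      smul_eq_mul] at h2
    rcases mul_eq_zero.1 h2.symm with h3 | h3
    · linarith
    · exact absurd h3 hJT.ne'
  have h2 : leviForm M T X Y z = 0 := by
    apply Complex.ext
    · exact h1 Y hY
    · rw [leviForm_im hX hY hz]
      exact h1 _ hY.J
  rw [hCR.leviForm_eq_mul (T := T') hz hT1 hT2 hX hY, h2, mul_zero]

/-- `h` and `r` are smooth functions that vanish on `M`. On `M`, the complex Hessian of `h` is a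
nonnegative multiple of the semidefinite Levi form, that of `r` is positive semidefinite, and over
`S` the kernels of these two forms are as small as they can be. -/
structure IsControlPair (M S : Set (Cn n)) (h r : Cn n → ℝ) : Prop where
  contDiff_h : ContDiff ℝ ∞ h
  contDiff_r : ContDiff ℝ ∞ r
  h_eq_zero : ∀ z ∈ M, h z = 0
  r_eq_zero : ∀ z ∈ M, r z = 0
  jHess_h : ∀ z ∈ M, ∀ a ∈ complexTangent M z, 0 ≤ jHess h z a a
  jHess_r : ∀ z ∈ M, ∀ a, 0 ≤ jHess r z a a
  mem_complexTangent : ∀ z ∈ M, z ∈ S → ∀ a, jHess r z a a = 0 → a ∈ complexTangent M z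
  mem_leviNull : ∀ z ∈ M, z ∈ S → ∀ a ∈ complexTangent M z, jHess h z a a = 0 → a ∈ leviNull M z

theorem jHess_zero (z a b : Cn n) : jHess (fun _ : Cn n => (0 : ℝ)) z a b = 0 := by
  have h1 : fderiv ℝ (fun _ : Cn n => (0 : ℝ)) = fun _ => 0 := by
    ext1 x; simp
  simp [jHess, h1]

theorem two_le_infty : (2 : WithTop ℕ∞) ≤ ∞ := WithTop.coe_le_coe.2 le_top

theorem IsControlPair.add {S S' : Set (Cn n)} {h r h' r' : Cn n → ℝ}
    (hc : IsControlPair M S h r) (hc' : IsControlPair M S' h' r') :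
    IsControlPair M (S ∪ S') (fun x => h x + h' x) (fun x => r x + r' x) := by
  have e1 : ∀ z a, jHess (fun x => h x + h' x) z a a = jHess h z a a + jHess h' z a a :=
    fun z a => jHess_add (hc.contDiff_h.contDiffAt.of_le two_le_infty)
      (hc'.contDiff_h.contDiffAt.of_le two_le_infty) a a
  have e2 : ∀ z a, jHess (fun x => r x + r' x) z a a = jHess r z a a + jHess r' z a a :=
    fun z a => jHess_add (hc.contDiff_r.contDiffAt.of_le two_le_infty)
      (hc'.contDiff_r.contDiffAt.of_le two_le_infty) a a
  refine ⟨hc.contDiff_h.add hc'.contDiff_h, hc.contDiff_r.add hc'.contDiff_r, fun z hz => ?_,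
    fun z hz => ?_, fun z hz a ha => ?_, fun z hz a => ?_, fun z hz hS a h0 => ?_,
    fun z hz hS a ha h0 => ?_⟩
  · rw [hc.h_eq_zero z hz, hc'.h_eq_zero z hz, add_zero]
  · rw [hc.r_eq_zero z hz, hc'.r_eq_zero z hz, add_zero]
  · rw [e1]; exact add_nonneg (hc.jHess_h z hz a ha) (hc'.jHess_h z hz a ha)
  · rw [e2]; exact add_nonneg (hc.jHess_r z hz a) (hc'.jHess_r z hz a)
  · rw [e2] at h0
    have h1 := hc.jHess_r z hz a
    have h2 := hc'.jHess_r z hz a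
    rcases hS with hS | hS
    · exact hc.mem_complexTangent z hz hS a (by linarith)
    · exact hc'.mem_complexTangent z hz hS a (by linarith)
  · rw [e1] at h0
    have h1 := hc.jHess_h z hz a ha
    have h2 := hc'.jHess_h z hz a ha
    rcases hS with hS | hS
    · exact hc.mem_leviNull z hz hS a ha (by linarith)
    · exact hc'.mem_leviNull z hz hS a ha (by linarith)

/-- With a local retraction `π` and `f x = x - π x`, the functions are `⟨c, f⟩` and `|f|²`, multiplied
by a cutoff function; the vector `c` is chosen so that `⟨c, f⟩` increases along `JT`. -/
theorem IsCRHypersurfaceType.exists_controlPair_nhds (hCR : IsCRHypersurfaceType m M)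
    (hpsc : IsPseudoconvex M) {p : Cn n} (hp : p ∈ M) :
    ∃ V h r, IsOpen V ∧ p ∈ V ∧ IsControlPair M V h r := by
  obtain ⟨V₀, T, hV₀, hpV₀, hT, hL⟩ := hpsc.exists_leviNonneg hp
  obtain ⟨W, π, hpW, hπ⟩ := hCR.1.exists_retraction hp
  let f : Cn n → Cn n := fun x => x - π x
  have hfsm : ContDiffOn ℝ ∞ f W := contDiffOn_id.sub hπ.contDiffOn
  have hf : ∀ z ∈ W, ContDiffAt ℝ 2 f z := fun z hz => (hπ.contDiffAt_sub hz).of_le two_le_infty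
  -- `c ≠ 0`, since `JT` is not tangential
  let c : Cn n := fderiv ℝ f p (J n (T p))
  have hc : c ≠ 0 := by
    intro hc
    have h1 := (hT.2 p ⟨hp, hpV₀⟩)
    exact h1.2 ⟨h1.1, (hπ.mem_tangentSpace_iff hp hpW).2 hc⟩
  let h₀ : Cn n → ℝ := fun x => innerSL ℝ c (f x)
  have hh₀sm : ContDiffOn ℝ ∞ h₀ W := (innerSL ℝ c).contDiff.comp_contDiffOn hfsm
  have hh₀ : ∀ z ∈ W, ContDiffAt ℝ 2 h₀ z := fun z hz =>
    (hh₀sm.contDiffAt (hπ.isOpen.mem_nhds hz)).of_le two_le_infty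
  let s : Cn n → ℝ := fun z => fderiv ℝ h₀ z (J n (T z))
  have hsp : 0 < s p := by
    have h1 : fderiv ℝ h₀ p = (innerSL ℝ c).comp (fderiv ℝ f p) :=
      ((innerSL ℝ c).hasFDerivAt.comp p
        ((hf p hpW).differentiableAt (by simp)).hasFDerivAt).fderiv
    have h2 : s p = inner ℝ c c := by
      change fderiv ℝ h₀ p (J n (T p)) = _
      rw [h1]; rfl
    rw [h2]
    exact real_inner_self_pos.2 hc
  have hscont : ContinuousWithinAt s M p := by
    have h1 : ContinuousAt (fderiv ℝ h₀) p :=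
      (((hh₀ p hpW).fderiv_right (m := 1) (by norm_num)).continuousAt)
    have h2 : ContinuousWithinAt T M p := by
      refine (hT.1.continuousOn p ⟨hp, hpV₀⟩).mono_of_mem_nhdsWithin ?_
      exact Filter.inter_mem self_mem_nhdsWithin (mem_nhdsWithin_of_mem_nhds (hV₀.mem_nhds hpV₀))
    exact h1.continuousWithinAt.clm_apply ((J n).continuous.continuousAt.comp_continuousWithinAt h2)
  obtain ⟨V₁, hV₁, hpV₁, hV₁s⟩ := mem_nhdsWithin.1 (hscont.eventually (lt_mem_nhds hsp))
  obtain ⟨χ, hχ, -, hχV, hχ01, hχ1⟩ := exists_cutoff (isCompact_singleton (x := p))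
    ((hV₁.inter hV₀).inter hπ.isOpen) (by
      rintro _ rfl; exact ⟨⟨hpV₁, hpV₀⟩, hpW⟩)
  have hχat : ∀ z, ContDiffAt ℝ 2 χ z := fun z => hχ.contDiffAt.of_le two_le_infty
  let r₀ : Cn n → ℝ := fun x => ‖f x‖ ^ 2
  have hr₀sm : ContDiffOn ℝ ∞ r₀ W := hfsm.norm_sq ℝ
  have hr₀ : ∀ z ∈ W, ContDiffAt ℝ 2 r₀ z := fun z hz =>
    (hr₀sm.contDiffAt (hπ.isOpen.mem_nhds hz)).of_le two_le_infty
  have hf0 : ∀ z ∈ M, z ∈ W → f z = 0 := fun z hz hzW => sub_eq_zero.2 (hπ.eq_self z hz hzW).symm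
  have hχW : tsupport χ ⊆ W := fun x hx => (hχV hx).2
  have hh : ContDiff ℝ ∞ (fun x => χ x * h₀ x) :=
    contDiff_mul_of_tsupport_subset (r := ⊤) hπ.isOpen hχ hχW hh₀sm
  have hr : ContDiff ℝ ∞ (fun x => χ x * r₀ x) :=
    contDiff_mul_of_tsupport_subset (r := ⊤) hπ.isOpen hχ hχW hr₀sm
  have hh0 : ∀ z ∈ M, χ z * h₀ z = 0 := by
    intro z hz
    by_cases hzχ : z ∈ tsupport χ
    · simp only [h₀, hf0 z hz (hχW hzχ), map_zero, mul_zero]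
    · rw [image_eq_zero_of_notMem_tsupport hzχ, zero_mul]
  have hr0 : ∀ z ∈ M, χ z * r₀ z = 0 := by
    intro z hz
    by_cases hzχ : z ∈ tsupport χ
    · simp [r₀, hf0 z hz (hχW hzχ)]
    · rw [image_eq_zero_of_notMem_tsupport hzχ, zero_mul]
  have houtside : ∀ z, z ∉ tsupport χ → ∀ (g : Cn n → ℝ) (a : Cn n),
      jHess (fun x => χ x * g x) z a a = 0 := by
    intro z hz g a
    have h1 : (fun x => χ x * g x) =ᶠ[nhds z] fun _ => 0 := by
      filter_upwards [(isClosed_tsupport χ).isOpen_compl.mem_nhds hz] with y hy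
      rw [image_eq_zero_of_notMem_tsupport hy, zero_mul]
    rw [jHess_congr h1, jHess_zero]
  have hev : ∀ z, ∀ᶠ x in nhdsWithin z M, χ x * h₀ x = 0 := fun z => by
    filter_upwards [self_mem_nhdsWithin] with x hx using hh0 x hx
  have hJT : ∀ z ∈ M, z ∈ tsupport χ →
      fderiv ℝ (fun x => χ x * h₀ x) z (J n (T z)) = χ z * s z := by
    intro z hz hzχ
    have h1 : h₀ z = 0 := by simp only [h₀, hf0 z hz (hχW hzχ), map_zero]
    have h2 := fderiv_fun_mul ((hχat z).differentiableAt (by simp))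
      ((hh₀ z (hχW hzχ)).differentiableAt (by simp))
    rw [h2, h1]
    simp [s]
  have hs : ∀ z ∈ M, z ∈ tsupport χ → 0 < s z := fun z hz hzχ => hV₁s ⟨(hχV hzχ).1.1, hz⟩
  have hrHess : ∀ z ∈ M, z ∈ tsupport χ → ∀ a, jHess (fun x => χ x * r₀ x) z a a =
      χ z * (2 * (‖fderiv ℝ f z a‖ ^ 2 + ‖fderiv ℝ f z (J n a)‖ ^ 2)) := by
    intro z hz hzχ a
    have hzW := hχW hzχ
    have h1 : fderiv ℝ r₀ z = 0 := by
      have h2 : HasFDerivAt r₀ _ z :=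
        ((hf z hzW).differentiableAt (by simp)).hasFDerivAt.norm_sq
      rw [h2.fderiv, hf0 z hz hzW]
      ext v
      simp
    rw [jHess_mul_of_eq_zero (hχat z) (hr₀ z hzW) (by simp [r₀, hf0 z hz hzW]) (by simp [h1])
      (by simp [h1]), jHess_norm_sq a (hf z hzW) (hf0 z hz hzW)]
  have hpos : ∀ z, 0 < χ z → z ∈ tsupport χ := fun z hz => subset_tsupport _ hz.ne'
  refine ⟨{x | 0 < χ x}, fun x => χ x * h₀ x, fun x => χ x * r₀ x,
    isOpen_lt continuous_const hχ.continuous, ?_, hh, hr, hh0, hr0, fun z hz a ha => ?_,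
    fun z hz a => ?_, fun z hz hzS a h => ?_, fun z hz hzS a ha h => ?_⟩
  · have := (hχ1 p rfl).self_of_nhds
    change 0 < χ p
    rw [this]; exact one_pos
  · by_cases hzχ : z ∈ tsupport χ
    · refine hCR.jHess_nonneg_of_leviNonneg hT hL hz (hχV hzχ).1.2
        (hh.contDiffAt.of_le two_le_infty) (hev z) ?_ ha
      rw [hJT z hz hzχ]
      exact mul_nonneg (hχ01 z).1 (hs z hz hzχ).le
    · rw [houtside z hzχ]
  · by_cases hzχ : z ∈ tsupport χ
    · rw [hrHess z hz hzχ]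
      exact mul_nonneg (hχ01 z).1 (by positivity)
    · rw [houtside z hzχ]
  · have hzχ := hpos z hzS
    rw [hrHess z hz hzχ] at h
    have h1 : ‖fderiv ℝ f z a‖ ^ 2 + ‖fderiv ℝ f z (J n a)‖ ^ 2 = 0 := by
      rcases mul_eq_zero.1 h with h | h
      · exact absurd h (ne_of_gt hzS)
      · linarith
    have h2 : ‖fderiv ℝ f z a‖ = 0 := by
      have := sq_nonneg ‖fderiv ℝ f z (J n a)‖
      exact pow_eq_zero_iff two_ne_zero |>.1 (le_antisymm (by linarith) (sq_nonneg _))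
    have h3 : ‖fderiv ℝ f z (J n a)‖ = 0 := by
      rw [h2] at h1
      exact pow_eq_zero_iff two_ne_zero |>.1 (by linarith)
    exact ⟨(hπ.mem_tangentSpace_iff hz (hχW hzχ)).2 (norm_eq_zero.1 h2),
      (hπ.mem_tangentSpace_iff hz (hχW hzχ)).2 (norm_eq_zero.1 h3)⟩
  · have hzχ := hpos z hzS
    refine hCR.mem_leviNull_of_jHess_eq_zero hT hL hz (hχV hzχ).1.2
      (hh.contDiffAt.of_le two_le_infty) (hev z) ?_ ha h
    rw [hJT z hz hzχ]
    exact mul_pos hzS (hs z hz hzχ)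

theorem IsCRHypersurfaceType.exists_controlPair (hCR : IsCRHypersurfaceType m M)
    (hcompact : IsCompact M) (hpsc : IsPseudoconvex M) : ∃ h r, IsControlPair M M h r := by
  refine hcompact.induction_on (p := fun S => ∃ h r, IsControlPair M S h r) ?_ ?_ ?_ ?_
  · refine ⟨fun _ => 0, fun _ => 0, contDiff_const, contDiff_const, fun _ _ => rfl,
      fun _ _ => rfl, fun z _ a _ => (jHess_zero z a a).ge, fun z _ a => (jHess_zero z a a).ge,
      fun _ _ h => h.elim, fun _ _ h => h.elim⟩
  · rintro S S' hSS' ⟨h, r, hc⟩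
    exact ⟨h, r, { hc with
      mem_complexTangent := fun z hz hS => hc.mem_complexTangent z hz (hSS' hS)
      mem_leviNull := fun z hz hS => hc.mem_leviNull z hz (hSS' hS) }⟩
  · rintro S S' ⟨h, r, hc⟩ ⟨h', r', hc'⟩
    exact ⟨_, _, hc.add hc'⟩
  · intro p hp
    obtain ⟨V, h, r, hV, hpV, hc⟩ := hCR.exists_controlPair_nhds hpsc hp
    exact ⟨V, mem_nhdsWithin_of_mem_nhds (hV.mem_nhds hpV), h, r, hc⟩

end ControlFunctions

/-! ### Smooth functions with large complex Hessian on `M` -/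

section SmoothPropertyP

variable {n m q : ℕ} {M : Set (Cn n)}

/-- Property `(P_q)` with smooth functions, in terms of orthonormal tuples at the points of `M`. -/
def SmoothPropertyP (q : ℕ) (M : Set (Cn n)) : Prop :=
  ∀ A : ℝ, 0 < A → ∃ (U : Set (Cn n)) (g : Cn n → ℝ), IsOpen U ∧ M ⊆ U ∧
    ContDiffOn ℝ ∞ g U ∧ (∀ z ∈ U, 0 ≤ g z ∧ g z ≤ 1) ∧
    ∀ z ∈ M, ∀ L : Fin q → Cn n, Orthonormal ℂ L → A < ∑ s, jHess g z (L s) (L s)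

theorem re_sum_complexHess {f : Cn n → ℝ} {z : Cn n} (hf : ContDiffAt ℝ 2 f z)
    (L : Fin q → Cn n) :
    (∑ s, ∑ j, ∑ k, complexHess f z j k * L s j * star (L s k)).re =
      (1 / 4) * ∑ s, jHess f z (L s) (L s) := by
  rw [Complex.re_sum, Finset.mul_sum]
  exact Finset.sum_congr rfl fun s _ => sesq_complexHess hf (L s)

/-- A bound on `f` over the zero set of `g ≥ 0` extends to all of `K` when a large multiple of `g` is
added. -/
theorem le_add_mul_of_isCompact {X : Type*} [TopologicalSpace X] {K : Set X} (hK : IsCompact K)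
    {f g : X → ℝ} (hf : ContinuousOn f K) (hg : ContinuousOn g K) {b : ℝ}
    (hg0 : ∀ x ∈ K, 0 ≤ g x) (hfg : ∀ x ∈ K, g x = 0 → b < f x) :
    ∃ C : ℝ, ∀ x ∈ K, b < f x + C * g x := by
  obtain ⟨C, hC⟩ : ∃ C : ℝ, ∀ C' ≥ C, ∀ x ∈ K, x ∈ K → b < f x + C' * g x := by
    refine hK.induction_on (p := fun S => ∃ C : ℝ, ∀ C' ≥ C, ∀ x ∈ S, x ∈ K → b < f x + C' * g x)
      ⟨0, fun _ _ _ h => h.elim⟩ ?_ ?_ ?_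
    · rintro S S' hSS' ⟨C, hC⟩
      exact ⟨C, fun C' h x hx => hC C' h x (hSS' hx)⟩
    · rintro S S' ⟨C, hC⟩ ⟨D, hD⟩
      refine ⟨max C D, fun C' h x hx => ?_⟩
      rcases hx with hx | hx
      · exact hC C' ((le_max_left _ _).trans h) x hx
      · exact hD C' ((le_max_right _ _).trans h) x hx
    · intro x hx
      obtain ⟨C, hC⟩ : ∃ C : ℝ, b < f x + C * g x := by
        by_cases h0 : g x = 0
        · exact ⟨0, by simpa using hfg x hx h0⟩
        · refine ⟨(b + 1 - f x) / g x, ?_⟩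
          rw [div_mul_cancel₀ _ h0]
          linarith
      have h1 : ContinuousWithinAt (fun y => f y + C * g y) K x :=
        (hf x hx).add ((hg x hx).const_mul C)
      refine ⟨_, Filter.inter_mem (h1.eventually (lt_mem_nhds hC)) self_mem_nhdsWithin, C,
        fun C' hC' y hy hyK => ?_⟩
      have h2 : b < f y + C * g y := hy.1
      have h3 := mul_le_mul_of_nonneg_right hC' (hg0 y hyK)
      linarith
  exact ⟨C, fun x hx => hC C le_rfl x hx hx⟩

theorem isCompact_orthonormal (n q : ℕ) : IsCompact {L : Fin q → Cn n | Orthonormal ℂ L} := by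
  refine Metric.isCompact_of_isClosed_isBounded ?_ ?_
  · simp only [orthonormal_iff_ite, Set.ofPred_forall]
    refine isClosed_iInter fun i => isClosed_iInter fun j => isClosed_eq ?_ continuous_const
    exact (continuous_apply i).inner (continuous_apply j)
  · refine (Metric.isBounded_closedBall (x := (0 : Fin q → Cn n)) (r := 1)).subset fun L hL => ?_
    rw [mem_closedBall_zero_iff, pi_norm_le_iff_of_nonneg zero_le_one]
    exact fun i => (hL.1 i).le

theorem continuousOn_sum_jHess {U : Set (Cn n)} (hU : IsOpen U) {g : Cn n → ℝ}
    (hg : ContDiffOn ℝ 2 g U) :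
    ContinuousOn (fun x : Cn n × (Fin q → Cn n) => ∑ s, jHess g x.1 (x.2 s) (x.2 s))
      (U ×ˢ Set.univ) := by
  have h1 : ContDiffOn ℝ 1 (fderiv ℝ g) U := hg.fderiv_of_isOpen hU (by norm_num)
  have h2 : ContinuousOn (fderiv ℝ (fderiv ℝ g)) U :=
    h1.continuousOn_fderiv_of_isOpen hU (by simp)
  have h3 : ContinuousOn (fun x : Cn n × (Fin q → Cn n) => fderiv ℝ (fderiv ℝ g) x.1)
      (U ×ˢ Set.univ) := h2.comp continuousOn_fst fun x hx => hx.1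
  refine continuousOn_finsetSum _ fun s _ => ?_
  have h4 : Continuous fun x : Cn n × (Fin q → Cn n) => x.2 s :=
    (continuous_apply s).comp continuous_snd
  have h5 : Continuous fun x : Cn n × (Fin q → Cn n) => J n (x.2 s) := (J n).continuous.comp h4
  exact ((h3.clm_apply h4.continuousOn).clm_apply h4.continuousOn).add
    ((h3.clm_apply h5.continuousOn).clm_apply h5.continuousOn)

/-- An affine change of a function with values in `(-1, 2)` on `M` has values in `[0, 1]` near
`M`. -/
theorem exists_affine_unit_interval {U : Set (Cn n)} (hU : IsOpen U) (hMU : M ⊆ U) {g : Cn n → ℝ}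
    (hg : ContDiffOn ℝ ∞ g U) (h01 : ∀ z ∈ M, 0 ≤ g z ∧ g z ≤ 1) :
    ∃ U', IsOpen U' ∧ M ⊆ U' ∧ U' ⊆ U ∧ ContDiffOn ℝ ∞ (fun x => (1 / 3) * g x + 1 / 3) U' ∧
      (∀ z ∈ U', 0 ≤ (1 / 3) * g z + 1 / 3 ∧ (1 / 3) * g z + 1 / 3 ≤ 1) ∧
      ∀ z ∈ U', ∀ a, jHess (fun x => (1 / 3) * g x + 1 / 3) z a a = (1 / 3) * jHess g z a a := by
  refine ⟨U ∩ g ⁻¹' Set.Ioo (-1) 2, hg.continuousOn.isOpen_inter_preimage hU isOpen_Ioo,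
    fun z hz => ⟨hMU hz, ?_⟩, Set.inter_subset_left, ?_, fun z hz => ?_, fun z hz a => ?_⟩
  · have := h01 z hz
    exact ⟨by linarith, by linarith⟩
  · exact ((contDiffOn_const.mul hg).add contDiffOn_const).mono Set.inter_subset_left
  · have h1 := hz.2.1
    have h2 := hz.2.2
    constructor <;> linarith
  · have h1 : ContDiffAt ℝ 2 g z := (hg.contDiffAt (hU.mem_nhds hz.1)).of_le two_le_infty
    have h2 : jHess (fun _ : Cn n => (1 / 3 : ℝ)) z a a = 0 := by
      have h3 : fderiv ℝ (fun _ : Cn n => (1 / 3 : ℝ)) = fun _ => 0 := by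
        ext1 x; simp
      simp only [jHess, h3]
      simp
    rw [jHess_add (contDiffAt_const.mul h1) contDiffAt_const, jHess_const_mul _ h1, h2, add_zero]

/-- Adding large multiples of the two functions of a control pair turns a lower bound on the
nullspace of the Levi form into one on all of `ℂⁿ`. -/
theorem PropertyPNull.smoothPropertyP (hCR : IsCRHypersurfaceType m M) (hcompact : IsCompact M)
    (hpsc : IsPseudoconvex M) (h : PropertyPNull q M) : SmoothPropertyP q M := by
  intro A hA
  obtain ⟨U, lam, hU, hMU, hlam, h01, hlb⟩ := h A hA
  obtain ⟨h, r, hc⟩ := hCR.exists_controlPair hcompact hpsc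
  let K : Set (Cn n × (Fin q → Cn n)) := M ×ˢ {L | Orthonormal ℂ L}
  have hK : IsCompact K := hcompact.prod (isCompact_orthonormal n q)
  have hKU : K ⊆ U ×ˢ Set.univ := fun x hx => ⟨hMU hx.1, trivial⟩
  have hlam2 : ∀ z ∈ M, ContDiffAt ℝ 2 lam z := fun z hz =>
    (hlam.contDiffAt (hU.mem_nhds (hMU hz))).of_le two_le_infty
  let F : (Cn n → ℝ) → Cn n × (Fin q → Cn n) → ℝ := fun g x => ∑ s, jHess g x.1 (x.2 s) (x.2 s)
  have hF0 : ContinuousOn (F lam) K :=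
    (continuousOn_sum_jHess hU (hlam.of_le two_le_infty)).mono hKU
  have hF : ∀ g, ContDiff ℝ ∞ g → ContinuousOn (F g) K := fun g hg =>
    (continuousOn_sum_jHess isOpen_univ (hg.contDiffOn.of_le two_le_infty)).mono
      fun x _ => ⟨trivial, trivial⟩
  have hFr := hF r hc.contDiff_r
  have hFh := hF h hc.contDiff_h
  have hFr0 : ∀ x ∈ K, F r x = 0 → ∀ s, x.2 s ∈ complexTangent M x.1 := by
    intro x hx h0 s
    refine hc.mem_complexTangent x.1 hx.1 hx.1 _ ?_
    exact (Finset.sum_eq_zero_iff_of_nonneg fun s _ => hc.jHess_r x.1 hx.1 _).1 h0 s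
      (Finset.mem_univ s)
  -- the tuples of complex tangent vectors are those with `F r = 0`
  let K' : Set (Cn n × (Fin q → Cn n)) := K ∩ F r ⁻¹' {0}
  have hK' : IsCompact K' :=
    hK.of_isClosed_subset (hFr.preimage_isClosed_of_isClosed hK.isClosed isClosed_singleton)
      Set.inter_subset_left
  obtain ⟨C₁, hC₁⟩ := le_add_mul_of_isCompact (b := 3 * A) hK' (hF0.mono Set.inter_subset_left)
    (hFh.mono Set.inter_subset_left)
    (fun x hx => Finset.sum_nonneg fun s _ => hc.jHess_h x.1 hx.1.1 _ (hFr0 x hx.1 hx.2 s))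
    (fun x hx h0 => by
      have h1 : ∀ s, x.2 s ∈ leviNull M x.1 := by
        intro s
        refine hc.mem_leviNull x.1 hx.1.1 hx.1.1 _ (hFr0 x hx.1 hx.2 s) ?_
        exact (Finset.sum_eq_zero_iff_of_nonneg fun s _ =>
          hc.jHess_h x.1 hx.1.1 _ (hFr0 x hx.1 hx.2 s)).1 h0 s (Finset.mem_univ s)
      have h2 := hlb x.1 hx.1.1 x.2 hx.1.2 h1
      rw [re_sum_complexHess (hlam2 x.1 hx.1.1)] at h2
      change 3 * A < ∑ s, jHess lam x.1 (x.2 s) (x.2 s)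
      linarith)
  obtain ⟨C₂, hC₂⟩ := le_add_mul_of_isCompact (b := 3 * A) hK (hF0.add (hFh.const_mul C₁)) hFr
    (fun x hx => Finset.sum_nonneg fun s _ => hc.jHess_r x.1 hx.1 _)
    (fun x hx h0 => hC₁ x ⟨hx, h0⟩)
  let g : Cn n → ℝ := fun x => lam x + C₁ * h x + C₂ * r x
  have hg : ContDiffOn ℝ ∞ g U :=
    (hlam.add (contDiff_const.mul hc.contDiff_h).contDiffOn).add
      (contDiff_const.mul hc.contDiff_r).contDiffOn
  obtain ⟨U', hU', hMU', -, hg', hg01, hgHess⟩ := exists_affine_unit_interval hU hMU hg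
    (fun z hz => by
      simp only [g, hc.h_eq_zero z hz, hc.r_eq_zero z hz, mul_zero, add_zero]
      exact h01 z (hMU hz))
  refine ⟨U', _, hU', hMU', hg', hg01, fun z hz L hL => ?_⟩
  simp only [hgHess z (hMU' hz)]
  have h1 : ∀ a, jHess g z a a = jHess lam z a a + C₁ * jHess h z a a + C₂ * jHess r z a a := by
    intro a
    have hh := hc.contDiff_h.contDiffAt.of_le (x := z) two_le_infty
    have hr := hc.contDiff_r.contDiffAt.of_le (x := z) two_le_infty
    rw [jHess_add ((hlam2 z hz).add (contDiffAt_const.mul hh)) (contDiffAt_const.mul hr),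
      jHess_add (hlam2 z hz) (contDiffAt_const.mul hh), jHess_const_mul _ hh, jHess_const_mul _ hr]
  have h2 := hC₂ (z, L) ⟨hz, hL⟩
  simp only [F, Pi.add_apply] at h2
  simp only [h1]
  rw [← Finset.mul_sum, Finset.sum_add_distrib, Finset.sum_add_distrib, ← Finset.mul_sum,
    ← Finset.mul_sum]
  linarith

theorem SmoothPropertyP.propertyPNull (h : SmoothPropertyP q M) : PropertyPNull q M := by
  intro A hA
  obtain ⟨U, g, hU, hMU, hg, h01, hlb⟩ := h (4 * A) (by linarith)
  refine ⟨U, g, hU, hMU, hg, h01, fun z hz L hL _ => ?_⟩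
  rw [re_sum_complexHess ((hg.contDiffAt (hU.mem_nhds (hMU hz))).of_le two_le_infty)]
  have := hlb z hz L hL
  linarith

/-- The bounds at the points of `M` persist, by compactness, on a neighborhood of `M`. -/
theorem SmoothPropertyP.propertyP (hq : 1 ≤ q) (h : SmoothPropertyP q M) : PropertyP q M := by
  intro A hA
  obtain ⟨U, g, hU, hMU, hg, h01, hlb⟩ := h (4 * A) (by linarith)
  have hcont := continuousOn_sum_jHess (q := q) hU (hg.of_le two_le_infty)
  have hev : ∀ z ∈ M, ∀ᶠ x in nhds z, ∀ L ∈ {L : Fin q → Cn n | Orthonormal ℂ L},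
      4 * A < ∑ s, jHess g x (L s) (L s) := by
    intro z hz
    refine (isCompact_orthonormal n q).eventually_forall_of_forall_eventually fun L hL => ?_
    have h1 := hcont.continuousAt (x := (z, L))
      ((hU.prod isOpen_univ).mem_nhds ⟨hMU hz, trivial⟩)
    have h2 := h1.eventually (lt_mem_nhds (hlb z hz L hL))
    exact h2
  let U' : Set (Cn n) := U ∩ interior {x | ∀ L ∈ {L : Fin q → Cn n | Orthonormal ℂ L},
    4 * A < ∑ s, jHess g x (L s) (L s)}
  refine ⟨U', g, hU.inter isOpen_interior, fun z hz => ⟨hMU hz, mem_interior_iff_mem_nhds.2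
    (hev z hz)⟩, (hg.of_le two_le_infty).mono Set.inter_subset_left, fun z hz => h01 z hz.1,
    fun z hz => (form_ineq_iff hq (complexHess g z) A).2 fun L hL => ?_⟩
  have h1 := re_sum_complexHess ((hg.contDiffAt (hU.mem_nhds hz.1)).of_le two_le_infty) L
  have h2 := interior_subset hz.2 L hL
  have h3 : (∑ s, sesq (complexHess g z) (L s) (L s)).re = _ := h1
  rw [h3]
  linarith

/-- Mollification costs at most `1` in each term `jHess g z (L s) (L s)`, hence the bound
`A + q + 1` required of the given function. -/
theorem PropertyP.smoothPropertyP (hq : 1 ≤ q) (hcompact : IsCompact M) (h : PropertyP q M) :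
    SmoothPropertyP q M := by
  intro A hA
  obtain ⟨U, lam, hU, hMU, hlam, h01, hlb⟩ := h (A + q + 1) (by positivity)
  obtain ⟨g, hg, hg01, hgHess⟩ := exists_smooth_jHess_near hcompact hU hMU hlam h01 one_pos
  refine ⟨Set.univ, g, isOpen_univ, fun _ _ => trivial, hg.contDiffOn, fun z _ => hg01 z,
    fun z hz L hL => ?_⟩
  have h1 := (form_ineq_iff hq (complexHess lam z) _).1 (hlb z (hMU hz)) L hL
  have h2 : (∑ s, sesq (complexHess lam z) (L s) (L s)).re = _ :=
    re_sum_complexHess (hlam.contDiffAt (hU.mem_nhds (hMU hz))) L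
  rw [h2] at h1
  have h3 : ∑ s, (jHess lam z (L s) (L s) - 1) ≤ ∑ s, jHess g z (L s) (L s) := by
    refine Finset.sum_le_sum fun s _ => ?_
    have := hgHess z hz (L s)
    rw [hL.1 s] at this
    linarith
  rw [Finset.sum_sub_distrib] at h3
  simp at h3
  have hq0 : (0 : ℝ) ≤ q := by positivity
  linarith

end SmoothPropertyP

/-! ### The Levi form does not vanish on open sets, and the global transversal field -/

section GlobalTransversal

variable {n m q : ℕ} {M : Set (Cn n)}

theorem jHess_norm_sub_sq (z₀ z a : Cn n) :
    jHess (fun x => ‖x - z₀‖ ^ 2) z a a = 4 * ‖a‖ ^ 2 := by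
  have h1 : (fun x => ‖x - z₀‖ ^ 2) = fun x : Cn n => innerSL ℝ (x - z₀) (x - z₀) := by
    ext x
    exact (real_inner_self_eq_norm_sq (x - z₀)).symm
  have h2 : ContDiffAt ℝ 2 (fun x : Cn n => x - z₀) z := contDiffAt_id.sub contDiffAt_const
  have h3 : fderiv ℝ (fun x : Cn n => x - z₀) = fun _ => ContinuousLinearMap.id ℝ (Cn n) := by
    ext1 x
    exact ((hasFDerivAt_id x).sub_const z₀).fderiv
  have h4 : ∀ v : Cn n, innerSL ℝ v v = ‖v‖ ^ 2 := real_inner_self_eq_norm_sq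
  rw [h1]
  simp only [jHess, fderiv_fderiv_of_bilinear _ h2 h2, h3]
  simp only [fderiv_fun_const, Pi.zero_apply, zero_apply, map_zero, ContinuousLinearMap.id_apply,
    h4, norm_J]
  ring

/-- The maximum principle: where the Levi form vanishes, the complex Hessian of a function whose
restriction to `M` has a local maximum is nonpositive on the complex tangent space. -/
theorem IsCRHypersurfaceType.jHess_nonpos_of_isLocalMaxOn (hCR : IsCRHypersurfaceType m M)
    {z : Cn n} (hz : z ∈ M) {T : Cn n → Cn n} (hT : T z ∈ tangentSpace M z)
    (hT' : T z ∉ complexTangent M z)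
    (hL : ∀ X, IsSection M X → (leviForm M T X X z).re = 0) {v : Cn n → ℝ}
    (hv : ContDiffAt ℝ 2 v z) (hmax : IsLocalMaxOn v M z) {a : Cn n}
    (ha : a ∈ complexTangent M z) : jHess v z a a ≤ 0 := by
  obtain ⟨W, π, hzW, hπ⟩ := hCR.1.exists_retraction hz
  have hπz : π z = z := hπ.eq_self z hz hzW
  have hπ2 : ContDiffAt ℝ 2 π z := (hπ.contDiffAt hzW).of_le two_le_infty
  have hw : ContDiffAt ℝ 2 (fun x => v (π x)) z := by
    refine ContDiffAt.comp z ?_ hπ2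
    rw [hπz]; exact hv
  have hwmax : IsLocalMax (fun x => v (π x)) z := by
    have h1 : Filter.Tendsto π (nhds z) (nhdsWithin z M) := by
      refine tendsto_nhdsWithin_iff.2 ⟨?_, ?_⟩
      · have := hπ2.continuousAt.tendsto
        rwa [hπz] at this
      · filter_upwards [hπ.isOpen.mem_nhds hzW] with x hx using hπ.mapsTo hx
    filter_upwards [h1.eventually hmax] with x hx
    rw [hπz]; exact hx
  -- `v - v ∘ π` vanishes on `M`, so its Hessian is a multiple of the Levi form
  have hφ : ContDiffAt ℝ 2 (fun x => v x - v (π x)) z := hv.sub hw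
  have hφ0 : ∀ᶠ x in nhdsWithin z M, v x - v (π x) = 0 := by
    filter_upwards [self_mem_nhdsWithin, mem_nhdsWithin_of_mem_nhds (hπ.isOpen.mem_nhds hzW)]
      with x hx hxW
    rw [hπ.eq_self x hx hxW, sub_self]
  have hX := hCR.isSection_proj a
  have h2 := hCR.jHess_eq_leviForm hz hφ hφ0 hT hT' hX hX
  rw [hL _ hX] at h2
  simp only [proj_eq_self ha, mul_zero, zero_smul] at h2
  have h3 := jHess_add hφ hw a a
  simp only [sub_add_cancel] at h3
  rw [h3, h2, zero_add]
  exact add_nonpos (fderiv_fderiv_nonpos_of_isLocalMax hw hwmax a)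
    (fderiv_fderiv_nonpos_of_isLocalMax hw hwmax _)

theorem IsCRHypersurfaceType.exists_orthonormal (hCR : IsCRHypersurfaceType m M)
    (hqm : q + 1 ≤ m) {z : Cn n} (hz : z ∈ M) :
    ∃ L : Fin q → Cn n, Orthonormal ℂ L ∧ ∀ s, L s ∈ complexTangent M z := by
  have hq : q ≤ Module.finrank ℂ (complexTangent M z) := by
    have := hCR.2 z hz
    omega
  let b := stdOrthonormalBasis ℂ (complexTangent M z)
  refine ⟨fun s => b (Fin.castLE hq s), ?_, fun s => (b (Fin.castLE hq s)).2⟩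
  exact (b.orthonormal.comp_linearIsometry (complexTangent M z).subtypeₗᵢ).comp _
    (Fin.castLE_injective hq)

/-- Property `(P_q)` excludes Levi flat pieces of `M`: there, `g - R|x - z₀|²` would have an
interior maximum, for a function `g` with large Hessian. -/
theorem SmoothPropertyP.exists_leviForm_ne_zero (h : SmoothPropertyP q M)
    (hCR : IsCRHypersurfaceType m M) (hcompact : IsCompact M) (hqm : q + 1 ≤ m) {z₀ : Cn n}
    (hz₀ : z₀ ∈ M) {V : Set (Cn n)} (hV : IsOpen V) (hz₀V : z₀ ∈ V) {T : Cn n → Cn n}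
    (hT : IsTransversal M V T) :
    ∃ z ∈ M ∩ V, ∃ X, IsSection M X ∧ (leviForm M T X X z).re ≠ 0 := by
  by_contra! hflat
  obtain ⟨ε, hε, hεV⟩ := Metric.nhds_basis_closedBall.mem_iff.1 (hV.mem_nhds hz₀V)
  obtain ⟨U, g, hU, hMU, hg, h01, hlb⟩ := h (4 * (2 / ε ^ 2) * q + 1) (by positivity)
  let v : Cn n → ℝ := fun x => g x + -(2 / ε ^ 2) * ‖x - z₀‖ ^ 2
  have hsq : ContDiff ℝ ∞ fun x : Cn n => ‖x - z₀‖ ^ 2 := (contDiff_id.sub contDiff_const).norm_sq ℝ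
  have hv : ∀ z ∈ M, ContDiffAt ℝ 2 v z := fun z hz =>
    ((hg.contDiffAt (hU.mem_nhds (hMU hz))).of_le two_le_infty).add
      (contDiffAt_const.mul (hsq.contDiffAt.of_le two_le_infty))
  obtain ⟨z, ⟨hzM, hzB⟩, hzmax⟩ := (hcompact.inter_right
    (Metric.isClosed_closedBall (x := z₀) (ε := ε))).exists_isMaxOn
    ⟨z₀, hz₀, Metric.mem_closedBall_self hε.le⟩
    (fun x hx => (hv x hx.1).continuousAt.continuousWithinAt)
  have hzball : z ∈ Metric.ball z₀ ε := by
    by_contra hzb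
    have h1 : ‖z - z₀‖ = ε := by
      rw [← dist_eq_norm]
      exact le_antisymm hzB (not_lt.1 hzb)
    have h2 : v z₀ ≤ v z := hzmax ⟨hz₀, Metric.mem_closedBall_self hε.le⟩
    have h3 : (2 / ε ^ 2) * ε ^ 2 = 2 := by field_simp
    simp only [v, h1, sub_self, norm_zero] at h2
    have h4 := (h01 z₀ (hMU hz₀)).1
    have h5 := (h01 z (hMU hzM)).2
    have h6 : -(2 / ε ^ 2) * ε ^ 2 = -2 := by rw [neg_mul, h3]
    rw [h6] at h2
    norm_num at h2
    linarith
  have hloc : IsLocalMaxOn v M z := by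
    filter_upwards [self_mem_nhdsWithin,
      mem_nhdsWithin_of_mem_nhds (Metric.isOpen_ball.mem_nhds hzball)] with x hx hxb
    exact hzmax ⟨hx, Metric.ball_subset_closedBall hxb⟩
  have hzV : z ∈ M ∩ V := ⟨hzM, hεV hzB⟩
  obtain ⟨L, hL, hLz⟩ := hCR.exists_orthonormal hqm hzM
  have h1 := hlb z hzM L hL
  have h2 : ∑ s, jHess g z (L s) (L s) ≤ ∑ _s : Fin q, 4 * (2 / ε ^ 2) := by
    refine Finset.sum_le_sum fun s _ => ?_
    have h3 := hCR.jHess_nonpos_of_isLocalMaxOn hzM (hT.2 z hzV).1 (hT.2 z hzV).2 (hflat z hzV)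
      (hv z hzM) hloc (hLz s)
    have hsq2 := hsq.contDiffAt.of_le (x := z) two_le_infty
    rw [jHess_add ((hg.contDiffAt (hU.mem_nhds (hMU hzM))).of_le two_le_infty)
      (contDiffAt_const.mul hsq2), jHess_const_mul _ hsq2, jHess_norm_sub_sq, hL.1 s] at h3
    linarith
  rw [Finset.sum_const, Finset.card_univ, Fintype.card_fin, nsmul_eq_mul] at h2
  linarith

/-- Two local transversal fields with nonnegative Levi forms point to the same side: otherwise the
Levi form would vanish near `z`. -/
theorem SmoothPropertyP.eta_pos (h : SmoothPropertyP q M) (hCR : IsCRHypersurfaceType m M)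
    (hcompact : IsCompact M) (hqm : q + 1 ≤ m) {V V' : Set (Cn n)} {T T' : Cn n → Cn n}
    (hV : IsOpen V) (hV' : IsOpen V') (hT : IsTransversal M V T) (hT' : IsTransversal M V' T')
    (hL : LeviNonneg M V T) (hL' : LeviNonneg M V' T') {z : Cn n} (hz : z ∈ M) (hzV : z ∈ V)
    (hzV' : z ∈ V') : 0 < eta M T z (T' z) := by
  by_contra! hle
  have hne : eta M T z (T' z) ≠ 0 := by
    intro h0
    have h1 := hCR.sub_eta_smul_mem hz (hT.2 z ⟨hz, hzV⟩).1 (hT.2 z ⟨hz, hzV⟩).2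
      (hT'.2 z ⟨hz, hzV'⟩).1
    rw [h0, zero_smul, sub_zero] at h1
    exact (hT'.2 z ⟨hz, hzV'⟩).2 h1
  have hlt : eta M T z (T' z) < 0 := lt_of_le_of_ne hle hne
  have hcont : ContinuousWithinAt (fun x => eta M T x (T' x)) M z := by
    have h1 : ContinuousWithinAt (eta M T) M z :=
      ((hCR.contDiffOn_eta hT).continuousOn z ⟨hz, hzV⟩).mono_of_mem_nhdsWithin
        (Filter.inter_mem self_mem_nhdsWithin (mem_nhdsWithin_of_mem_nhds (hV.mem_nhds hzV)))
    have h2 : ContinuousWithinAt T' M z :=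
      (hT'.1.continuousOn z ⟨hz, hzV'⟩).mono_of_mem_nhdsWithin
        (Filter.inter_mem self_mem_nhdsWithin (mem_nhdsWithin_of_mem_nhds (hV'.mem_nhds hzV')))
    exact h1.clm_apply h2
  obtain ⟨O, hO, hzO, hOneg⟩ := mem_nhdsWithin.1 (hcont.eventually (gt_mem_nhds hlt))
  obtain ⟨x, ⟨hx, hxO⟩, X, hX, hne⟩ := h.exists_leviForm_ne_zero hCR hcompact hqm hz
    ((hO.inter hV).inter hV') ⟨⟨hzO, hzV⟩, hzV'⟩ (T := T)
    ⟨hT.1.mono fun y hy => ⟨hy.1, hy.2.1.2⟩, fun y hy => hT.2 y ⟨hy.1, hy.2.1.2⟩⟩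
  have h1 := hCR.leviForm_eq_mul (T := T) hx (hT'.2 x ⟨hx, hxO.2⟩).1 (hT'.2 x ⟨hx, hxO.2⟩).2 hX hX
  have h2 := hL x ⟨hx, hxO.1.2⟩ X hX
  have h3 := hL' x ⟨hx, hxO.2⟩ X hX
  have h4 : eta M T x (T' x) < 0 := hOneg ⟨hxO.1.1, hx⟩
  refine hne (le_antisymm ?_ h2)
  rw [h1, Complex.re_ofReal_mul]
  exact mul_nonpos_of_nonpos_of_nonneg h4.le h3

/-- A tangential field on `M` that points nowhere to the negative side, and to the positive side
over `S`; the sides are those given by the local fields with nonnegative Levi form. -/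
structure IsPositiveField (M S : Set (Cn n)) (T : Cn n → Cn n) : Prop where
  contDiffOn : ContDiffOn ℝ ∞ T M
  mem_tangentSpace : ∀ z ∈ M, T z ∈ tangentSpace M z
  nonneg : ∀ z ∈ M, ∀ V T₀, IsOpen V → z ∈ V → IsTransversal M V T₀ → LeviNonneg M V T₀ →
    0 ≤ eta M T₀ z (T z)
  pos : ∀ z ∈ M, z ∈ S → ∀ V T₀, IsOpen V → z ∈ V → IsTransversal M V T₀ → LeviNonneg M V T₀ →
    0 < eta M T₀ z (T z)

/-- Local fields multiplied by cutoff functions are added up; by `eta_pos` they do not cancel. -/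
theorem SmoothPropertyP.exists_positiveField (h : SmoothPropertyP q M)
    (hCR : IsCRHypersurfaceType m M) (hcompact : IsCompact M) (hpsc : IsPseudoconvex M)
    (hqm : q + 1 ≤ m) : ∃ T, IsPositiveField M M T := by
  refine hcompact.induction_on (p := fun S => ∃ T, IsPositiveField M S T) ?_ ?_ ?_ ?_
  · exact ⟨fun _ => 0, contDiffOn_const, fun _ _ => zero_mem _, fun _ _ _ _ _ _ _ _ => by simp,
      fun _ _ h => h.elim⟩
  · rintro S S' hSS' ⟨T, hT⟩
    exact ⟨T, { hT with pos := fun z hz hS => hT.pos z hz (hSS' hS) }⟩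
  · rintro S S' ⟨T, hT⟩ ⟨T', hT'⟩
    refine ⟨fun x => T x + T' x, hT.contDiffOn.add hT'.contDiffOn,
      fun z hz => add_mem (hT.mem_tangentSpace z hz) (hT'.mem_tangentSpace z hz),
      fun z hz V T₀ hV hzV h1 h2 => ?_, fun z hz hS V T₀ hV hzV h1 h2 => ?_⟩
    · rw [map_add]
      exact add_nonneg (hT.nonneg z hz V T₀ hV hzV h1 h2) (hT'.nonneg z hz V T₀ hV hzV h1 h2)
    · rw [map_add]
      rcases hS with hS | hS
      · exact add_pos_of_pos_of_nonneg (hT.pos z hz hS V T₀ hV hzV h1 h2)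
          (hT'.nonneg z hz V T₀ hV hzV h1 h2)
      · exact add_pos_of_nonneg_of_pos (hT.nonneg z hz V T₀ hV hzV h1 h2)
          (hT'.pos z hz hS V T₀ hV hzV h1 h2)
  · intro p hp
    obtain ⟨V, T, hV, hpV, hT, hL⟩ := hpsc.exists_leviNonneg hp
    obtain ⟨χ, hχ, -, hχV, hχ01, hχ1⟩ := exists_cutoff (isCompact_singleton (x := p)) hV
      (by rintro _ rfl; exact hpV)
    have hpos : ∀ z, χ z ≠ 0 → z ∈ V := fun z hz => hχV (subset_tsupport _ hz)
    refine ⟨{x | 0 < χ x}, mem_nhdsWithin_of_mem_nhds ((isOpen_lt continuous_const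
      hχ.continuous).mem_nhds ?_), fun x => χ x • T x, fun z hz => ?_, fun z hz => ?_,
      fun z hz V₀ T₀ hV₀ hzV₀ h1 h2 => ?_, fun z hz hS V₀ T₀ hV₀ hzV₀ h1 h2 => ?_⟩
    · have := (hχ1 p rfl).self_of_nhds
      change 0 < χ p
      rw [this]; exact one_pos
    · by_cases hzχ : z ∈ tsupport χ
      · have h1 : ContDiffWithinAt ℝ ∞ T M z :=
          (hT.1 z ⟨hz, hχV hzχ⟩).mono_of_mem_nhdsWithin (Filter.inter_mem self_mem_nhdsWithin
            (mem_nhdsWithin_of_mem_nhds (hV.mem_nhds (hχV hzχ))))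
        exact hχ.contDiffAt.contDiffWithinAt.smul h1
      · have h1 : (fun x => χ x • T x) =ᶠ[nhds z] fun _ => 0 := by
          filter_upwards [(isClosed_tsupport χ).isOpen_compl.mem_nhds hzχ] with y hy
          rw [image_eq_zero_of_notMem_tsupport hy, zero_smul]
        exact (contDiffAt_const.congr_of_eventuallyEq h1).contDiffWithinAt
    · by_cases hz0 : χ z = 0
      · simp only [hz0, zero_smul]
        exact zero_mem _
      · exact Submodule.smul_mem _ _ (hT.2 z ⟨hz, hpos z hz0⟩).1
    · rw [map_smul, smul_eq_mul]
      by_cases hz0 : χ z = 0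
      · simp [hz0]
      · exact mul_nonneg (hχ01 z).1 (h.eta_pos hCR hcompact hqm hV₀ hV h1 hT h2 hL hz hzV₀
          (hpos z hz0)).le
    · rw [map_smul, smul_eq_mul]
      exact mul_pos hS (h.eta_pos hCR hcompact hqm hV₀ hV h1 hT h2 hL hz hzV₀ (hpos z hS.ne'))

theorem SmoothPropertyP.exists_global_transversal (h : SmoothPropertyP q M)
    (hCR : IsCRHypersurfaceType m M) (hcompact : IsCompact M) (hpsc : IsPseudoconvex M)
    (hqm : q + 1 ≤ m) :
    ∃ T, IsTransversal M Set.univ T ∧ LeviNonneg M Set.univ T := by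
  obtain ⟨T, hT⟩ := h.exists_positiveField hCR hcompact hpsc hqm
  have hnot : ∀ z ∈ M, T z ∉ complexTangent M z := by
    intro z hz hC
    obtain ⟨V, T₀, hV, hzV, hT₀, hL₀⟩ := hpsc.exists_leviNonneg hz
    have h1 := hT.pos z hz hz V T₀ hV hzV hT₀ hL₀
    rw [eta_eq_zero hC] at h1
    exact lt_irrefl _ h1
  refine ⟨T, ⟨hT.contDiffOn.mono Set.inter_subset_left, fun z hz =>
    ⟨hT.mem_tangentSpace z hz.1, hnot z hz.1⟩⟩, fun z hz X hX => ?_⟩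
  obtain ⟨V, T₀, hV, hzV, hT₀, hL₀⟩ := hpsc.exists_leviNonneg hz.1
  have h1 := hT.pos z hz.1 hz.1 V T₀ hV hzV hT₀ hL₀
  have h2 := hL₀ z ⟨hz.1, hzV⟩ X hX
  rw [hCR.leviForm_eq_mul (T := T₀) hz.1 (hT.mem_tangentSpace z hz.1) (hnot z hz.1) hX hX,
    Complex.re_ofReal_mul] at h2
  exact nonneg_of_mul_nonneg_right h2 h1

end GlobalTransversal

/-! ### The form of property `(CR-P_q)` -/

section CRForm

variable {n m q : ℕ} {M : Set (Cn n)} {z : Cn n}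

theorem form_smul_smul (θ : (Cn n) [⋀^Fin 2]→L[ℝ] ℂ) (c d : ℝ) (u v : Cn n) :
    θ ![c • u, d • v] = (c * d) • θ ![u, v] := by
  have h1 : ![c • u, d • v] = fun i => (![c, d] : Fin 2 → ℝ) i • (![u, v] : Fin 2 → Cn n) i := by
    ext1 i
    fin_cases i <;> rfl
  rw [h1, θ.map_smul_univ]
  simp

theorem form_swap (θ : (Cn n) [⋀^Fin 2]→L[ℝ] ℂ) (u v : Cn n) : θ ![v, u] = -θ ![u, v] := by
  have h1 : (![v, u] : Fin 2 → Cn n) = ![u, v] ∘ Equiv.swap 0 1 := by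
    ext1 i
    fin_cases i <;> simp
  rw [h1]
  exact θ.toAlternatingMap.map_swap _ (by simp)

theorem form_self (θ : (Cn n) [⋀^Fin 2]→L[ℝ] ℂ) (u : Cn n) : θ ![u, u] = 0 :=
  θ.map_eq_zero_of_eq _ (i := 0) (j := 1) rfl (by simp)

theorem pairing_vec (θ : (Cn n) [⋀^Fin 2]→L[ℝ] ℂ) (a : Cn n) :
    pairing θ (vec10 a) (vec01 a) = (Complex.I / 2) * θ ![a, J n a] := by
  have h1 : -((1 / 2 : ℝ) • J n a) = (-(1 / 2) : ℝ) • J n a := by rw [neg_smul]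
  simp only [pairing, vec10, vec01, h1, form_smul_smul, form_self, form_swap θ a (J n a)]
  simp
  ring

theorem part11_apply (θ : (Cn n) [⋀^Fin 2]→L[ℝ] ℂ) (a : Cn n) :
    part11 θ ![a, J n a] = θ ![a, J n a] := by
  have h1 : θ.compContinuousLinearMap (J n) ![a, J n a] = θ ![a, J n a] := by
    have h2 : (J n) ∘ ![a, J n a] = ![(1 : ℝ) • J n a, (-1 : ℝ) • a] := by
      ext1 i
      fin_cases i <;> simp [J_J]
    change θ ((J n) ∘ ![a, J n a]) = _
    rw [h2, form_smul_smul, form_swap]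
    simp
  change (1 / 2 : ℝ) • (θ ![a, J n a] + θ.compContinuousLinearMap (J n) ![a, J n a]) = _
  rw [h1]
  module

theorem extDerivWithin_oneForm {β : Cn n → (Cn n →L[ℝ] ℂ)} {β' : Cn n →L[ℝ] Cn n →L[ℝ] ℂ}
    (h : HasFDerivWithinAt β β' M z) {u v : Cn n} (hu : u ∈ tangentSpace M z)
    (hv : v ∈ tangentSpace M z) :
    extDerivWithin (fun x => oneForm (β x)) M z ![u, v] = β' u v - β' v u := by
  let Λ : (Cn n →L[ℝ] ℂ) →L[ℝ] (Cn n) [⋀^Fin 1]→L[ℝ] ℂ :=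
    (ContinuousAlternatingMap.ofSubsingletonLIE (𝕜 := ℝ) (E := Cn n) (F := ℂ)
      (0 : Fin 1)).toContinuousLinearEquiv
  have h1 : HasFDerivWithinAt (fun x => oneForm (β x)) (Λ.comp β') M z :=
    Λ.hasFDerivAt.comp_hasFDerivWithinAt z h
  have h2 : ∀ (f : Cn n →L[ℝ] ℂ) (w : Fin 1 → Cn n), Λ f w = f (w 0) := fun f w => rfl
  rw [extDerivWithin, ContinuousAlternatingMap.alternatizeUncurryFin_apply, Fin.sum_univ_two]
  simp only [Matrix.cons_val_zero, Matrix.cons_val_one]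
  rw [fderivWithin_apply_eq h1 hu, fderivWithin_apply_eq h1 hv]
  simp only [ContinuousLinearMap.comp_apply, h2]
  simp [Fin.removeNth, sub_eq_add_neg]

theorem dTan11_pairing {α : Cn n → (Cn n) [⋀^Fin 1]→L[ℝ] ℂ} {a : Cn n}
    (ha : a ∈ complexTangent M z) :
    pairing (dTan11 M α z) (vec10 a) (vec01 a) =
      (Complex.I / 2) * extDerivWithin α M z ![a, J n a] := by
  rw [pairing_vec, dTan11, part11_apply]
  have h1 : ((proj M z).restrictScalars ℝ) ∘ ![a, J n a] = ![a, J n a] := by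
    ext1 i
    fin_cases i
    · exact proj_eq_self ha
    · exact proj_eq_self (J_mem_complexTangent ha)
  change _ * extDerivWithin α M z (((proj M z).restrictScalars ℝ) ∘ ![a, J n a]) = _
  rw [h1]

theorem leviVec_self {X : Cn n → Cn n} : leviVec M X X z =
    (2 : ℝ) • (J n (fderivWithin ℝ X M z (X z)) - fderivWithin ℝ X M z (J n (X z))) := by
  rw [leviVec]; module

/-- The exterior derivative along `M` of the tangential part `μ ∘ P` of a `1`-form `μ`. Its
difference from `dμ` comes from the component of `[X, JX]` normal to the complex tangent space. -/
theorem IsCRHypersurfaceType.extDerivWithin_comp_proj (hCR : IsCRHypersurfaceType m M)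
    (hz : z ∈ M) {T : Cn n → Cn n} (hT : T z ∈ tangentSpace M z) (hT' : T z ∉ complexTangent M z)
    {μ : Cn n → (Cn n →L[ℝ] ℂ)} {μ' : Cn n →L[ℝ] Cn n →L[ℝ] ℂ} (hμ : HasFDerivAt μ μ' z)
    {X : Cn n → Cn n} (hX : IsSection M X) :
    extDerivWithin (fun x => oneForm ((μ x).comp ((proj M x).restrictScalars ℝ))) M z
        ![X z, J n (X z)] =
      μ' (X z) (J n (X z)) - μ' (J n (X z)) (X z) +
        ((4 * (leviForm M T X X z).re : ℝ) : ℂ) * μ z (normalPart M T z) := by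
  have hP := ((hCR.contDiffOn_proj z hz).differentiableWithinAt (by simp)).hasFDerivWithinAt
  obtain ⟨β', hβ⟩ : ∃ β' : Cn n →L[ℝ] Cn n →L[ℝ] ℂ, HasFDerivWithinAt
      (fun x => (μ x).comp ((proj M x).restrictScalars ℝ)) β' M z :=
    ⟨_, (hμ.hasFDerivWithinAt (s := M)).clm_comp hP⟩
  -- `(μ ∘ P)(Y) = μ(Y)` on `M` for sections `Y`; differentiate
  have key : ∀ (Y : Cn n → Cn n) (Y' : Cn n →L[ℝ] Cn n), IsSection M Y →
      HasFDerivWithinAt Y Y' M z → ∀ u ∈ tangentSpace M z,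
      β' u (Y z) = μ' u (Y z) + μ z (Y' u - proj M z (Y' u)) := by
    intro Y Y' hY hY' u hu
    have h1 := hβ.clm_apply hY'
    have h2 := (hμ.hasFDerivWithinAt (s := M)).clm_apply hY'
    have h3 : ∀ x ∈ M, ((μ x).comp ((proj M x).restrictScalars ℝ)) (Y x) = μ x (Y x) := by
      intro x hx
      exact congrArg (μ x) (proj_eq_self (hY.2 x hx))
    have h4 := eq_of_hasFDerivWithinAt h1 (h2.congr h3 (h3 z hz)) hu
    have h5 : μ z (proj M z (Y' u)) + β' u (Y z) = μ z (Y' u) + μ' u (Y z) := h4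
    rw [map_sub, add_comm (μ' u (Y z)), sub_add_eq_add_sub, ← h5]
    ring
  rw [extDerivWithin_oneForm hβ (hX.mem_tangentSpace hz) (hX.J_mem_tangentSpace hz)]
  have hX' := hX.hasFDerivWithinAt hz
  have e1 := key _ _ hX.J (hasFDerivWithinAt_clm_comp (J n) hX') _ (hX.mem_tangentSpace hz)
  have e2 := key _ _ hX hX' _ (hX.J_mem_tangentSpace hz)
  rw [e1, e2]
  have hw := hCR.1.leviVec_mem hX hX hz
  have h1 := hCR.sub_proj_eq hz hT hT' hw
  have h2 : eta M T z (leviVec M X X z) = 8 * (leviForm M T X X z).re := by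
    rw [leviForm_re hX hX hz]; ring
  rw [h2, leviVec_self] at h1
  set b := fderivWithin ℝ X M z (X z)
  set c := fderivWithin ℝ X M z (J n (X z))
  have hPs : ∀ (t : ℝ) v, proj M z (t • v) = t • proj M z v := fun t v =>
    ((proj M z).restrictScalars ℝ).map_smul t v
  rw [hPs, ← smul_sub, map_sub] at h1
  have h3 : μ z (J n b - proj M z (J n b)) - μ z (c - proj M z c) =
      ((4 * (leviForm M T X X z).re : ℝ) : ℂ) * μ z (normalPart M T z) := by
    rw [← map_sub, show J n b - proj M z (J n b) - (c - proj M z c) =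
      (1 / 2 : ℝ) • ((2 : ℝ) • (J n b - c - (proj M z (J n b) - proj M z c))) by module, h1,
      map_smul, map_smul, smul_smul, Complex.real_smul]
    congr 2
    ring
  rw [← h3]
  simp only [ContinuousLinearMap.comp_apply]
  ring

theorem IsCRHypersurfaceType.extDerivWithin_gammaForm (hCR : IsCRHypersurfaceType m M)
    (hz : z ∈ M) {T : Cn n → Cn n} (hT : IsTransversal M Set.univ T)
    {X : Cn n → Cn n} (hX : IsSection M X) :
    extDerivWithin (gammaForm M T) M z ![X z, J n (X z)] =
      -2 * Complex.I * (leviForm M T X X z).re := by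
  have hη : HasFDerivWithinAt (eta M T) (fderivWithin ℝ (eta M T) M z) M z := by
    have := hCR.contDiffOn_eta hT
    rw [Set.inter_univ] at this
    exact ((this z hz).differentiableWithinAt (by simp)).hasFDerivWithinAt
  set η' := fderivWithin ℝ (eta M T) M z
  let Λ : (Cn n →L[ℝ] ℝ) →L[ℝ] (Cn n →L[ℝ] ℂ) :=
    (Complex.I / 2) • (ContinuousLinearMap.compL ℝ (Cn n) ℝ ℂ Complex.ofRealCLM)
  have h1 : HasFDerivWithinAt (fun x => (Complex.I / 2) • Complex.ofRealCLM.comp (eta M T x))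
      (Λ.comp η') M z := Λ.hasFDerivAt.comp_hasFDerivWithinAt z hη
  have key : ∀ (Y : Cn n → Cn n) (Y' : Cn n →L[ℝ] Cn n), IsSection M Y →
      HasFDerivWithinAt Y Y' M z → ∀ u ∈ tangentSpace M z,
      η' u (Y z) = -eta M T z (Y' u) := by
    intro Y Y' hY hY' u hu
    have h2 := hη.clm_apply hY'
    have h3 : ∀ x ∈ M, eta M T x (Y x) = 0 := fun x hx => eta_eq_zero (hY.2 x hx)
    have h4 := eq_of_hasFDerivWithinAt h2
      ((hasFDerivWithinAt_const (0 : ℝ) z M).congr h3 (h3 z hz)) hu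
    have h5 : eta M T z (Y' u) + η' u (Y z) = 0 := h4
    linarith
  have hX' := hX.hasFDerivWithinAt hz
  have e1 := key _ _ hX.J (hasFDerivWithinAt_clm_comp (J n) hX') _ (hX.mem_tangentSpace hz)
  have e2 := key _ _ hX hX' _ (hX.J_mem_tangentSpace hz)
  refine (extDerivWithin_oneForm h1 (hX.mem_tangentSpace hz) (hX.J_mem_tangentSpace hz)).trans ?_
  have h2 : ∀ u v, (Λ.comp η') u v = (Complex.I / 2) * (η' u v : ℂ) := fun u v => rfl
  rw [h2, h2, e1, e2, leviForm_re hX hX hz, leviVec_self, map_smul, map_sub]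
  simp only [ContinuousLinearMap.comp_apply, smul_eq_mul]
  push_cast
  ring

theorem pairing_add (θ θ' : (Cn n) [⋀^Fin 2]→L[ℝ] ℂ) (Z W : Cn n × Cn n) :
    pairing (θ + θ') Z W = pairing θ Z W + pairing θ' Z W := by
  simp only [pairing, ContinuousAlternatingMap.add_apply]
  ring

theorem pairing_smul (c : ℝ) (θ : (Cn n) [⋀^Fin 2]→L[ℝ] ℂ) (Z W : Cn n × Cn n) :
    pairing (c • θ) Z W = c * pairing θ Z W := by
  simp only [pairing, ContinuousAlternatingMap.smul_apply, Complex.real_smul]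
  ring

theorem pairing_sub (θ θ' : (Cn n) [⋀^Fin 2]→L[ℝ] ℂ) (Z W : Cn n × Cn n) :
    pairing (θ - θ') Z W = pairing θ Z W - pairing θ' Z W := by
  simp only [pairing, ContinuousAlternatingMap.sub_apply]
  ring

/-- The value of the form of property `(CR-P_q)` is the complex Hessian of `λ`, up to a multiple of
the Levi form that involves the derivative of `λ` in the direction `JN` normal to `M`. -/
theorem IsCRHypersurfaceType.pairing_crForm (hCR : IsCRHypersurfaceType m M)
    (hz : z ∈ M) {T : Cn n → Cn n} (hT : IsTransversal M Set.univ T) {lam : Cn n → ℝ}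
    (hlam : ContDiffAt ℝ 2 lam z) (A₀ : ℝ) {X : Cn n → Cn n} (hX : IsSection M X) :
    (pairing (crForm M T lam A₀ z) (vec10 (X z)) (vec01 (X z))).re =
      (1 / 4) * jHess lam z (X z) (X z) +
        (A₀ - fderiv ℝ lam z (J n (normalPart M T z))) * (leviForm M T X X z).re := by
  have hTz := hT.2 z ⟨hz, trivial⟩
  let D := fderiv ℝ (fderiv ℝ lam) z
  have hD : HasFDerivAt (fderiv ℝ lam) D z := (ContDiffAt.differentiableAt_fderiv hlam).hasFDerivAt
  let ι : (Cn n →L[ℝ] ℝ) →L[ℝ] (Cn n →L[ℝ] ℂ) :=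
    ContinuousLinearMap.compL ℝ (Cn n) ℝ ℂ Complex.ofRealCLM
  let κ : (Cn n →L[ℝ] ℂ) →L[ℝ] (Cn n →L[ℝ] ℂ) :=
    (ContinuousLinearMap.compL ℝ (Cn n) (Cn n) ℂ).flip (J n)
  have hd : ∀ x, DifferentiableAt ℝ lam x →
      fderiv ℝ (fun y => (lam y : ℂ)) x = ι (fderiv ℝ lam x) := fun x hx =>
    (Complex.ofRealCLM.hasFDerivAt.comp x hx.hasFDerivAt).fderiv
  let Λ₁ : (Cn n →L[ℝ] ℝ) →L[ℝ] (Cn n →L[ℝ] ℂ) := (1 / 2 : ℂ) • (ι + Complex.I • κ.comp ι)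
  let Λ₂ : (Cn n →L[ℝ] ℝ) →L[ℝ] (Cn n →L[ℝ] ℂ) := (1 / 2 : ℂ) • (ι - Complex.I • κ.comp ι)
  have hΛ₁ : ∀ f v, Λ₁ f v = (1 / 2 : ℂ) * ((f v : ℂ) + Complex.I * (f (J n v) : ℂ)) :=
    fun f v => rfl
  have hΛ₂ : ∀ f v, Λ₂ f v = (1 / 2 : ℂ) * ((f v : ℂ) - Complex.I * (f (J n v) : ℂ)) :=
    fun f v => rfl
  have hb : delbar (fun y => (lam y : ℂ)) =ᶠ[nhds z] fun x => Λ₁ (fderiv ℝ lam x) := by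
    filter_upwards [ContDiffAt.eventually_differentiableAt hlam] with x hx
    rw [delbar, hd x hx]
    rfl
  have hdl : del (fun y => (lam y : ℂ)) =ᶠ[nhds z] fun x => Λ₂ (fderiv ℝ lam x) := by
    filter_upwards [ContDiffAt.eventually_differentiableAt hlam] with x hx
    rw [del, hd x hx]
    rfl
  have h1 : HasFDerivAt (delbar (fun y => (lam y : ℂ))) (Λ₁.comp D) z :=
    (Λ₁.hasFDerivAt.comp z hD).congr_of_eventuallyEq hb
  have h2 : HasFDerivAt (del (fun y => (lam y : ℂ))) (Λ₂.comp D) z :=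
    (Λ₂.hasFDerivAt.comp z hD).congr_of_eventuallyEq hdl
  have ha := hX.2 z hz
  have e1 := hCR.extDerivWithin_comp_proj hz hTz.1 hTz.2 h1 hX
  have e2 := hCR.extDerivWithin_comp_proj hz hTz.1 hTz.2 h2 hX
  rw [hb.self_of_nhds] at e1
  rw [hdl.self_of_nhds] at e2
  have e3 := hCR.extDerivWithin_gammaForm hz hT hX
  rw [crForm, pairing_add, pairing_smul, pairing_smul, pairing_sub, dTan11_pairing ha,
    dTan11_pairing ha, pairing_vec, e3]
  unfold delbarb delb
  rw [e1, e2]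
  simp only [ContinuousLinearMap.comp_apply, hΛ₁, hΛ₂, J_J, map_neg, jHess]
  set l := (leviForm M T X X z).re
  change _ = (1 / 4) * (D (X z) (X z) + D (J n (X z)) (J n (X z))) + _
  simp
  ring

/-- On the nullspace the Levi term of `pairing_crForm` vanishes. -/
theorem PropertyCRP.propertyPNull (hCR : IsCRHypersurfaceType m M) (h : PropertyCRP q M) :
    PropertyPNull q M := by
  obtain ⟨T, hT, -, hA⟩ := h
  intro A hApos
  obtain ⟨U, lam, A₀, hU, hMU, hlam, h01, hlb⟩ := hA A hApos
  refine ⟨U, lam, hU, hMU, hlam, h01, fun z hz L hL hLnull => ?_⟩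
  have hlam2 : ContDiffAt ℝ 2 lam z :=
    (hlam.contDiffAt (hU.mem_nhds (hMU hz))).of_le two_le_infty
  have h1 := hlb z hz L hL fun j => (hLnull j).1
  rw [re_sum_complexHess hlam2]
  rw [Complex.re_sum] at h1
  have h2 : ∀ j, (pairing (crForm M T lam A₀ z) (vec10 (L j)) (vec01 (L j))).re =
      (1 / 4) * jHess lam z (L j) (L j) := by
    intro j
    have hX := hCR.isSection_proj (L j)
    have hXz : proj M z (L j) = L j := proj_eq_self (hLnull j).1
    have h3 := hCR.pairing_crForm hz hT hlam2 A₀ hX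
    have h4 := (hLnull j).2 Set.univ T isOpen_univ trivial hT _ _ hX hX hXz
    rw [h4] at h3
    simpa only [hXz, Complex.zero_re, mul_zero, add_zero] using h3
  rwa [Finset.sum_congr rfl fun j _ => h2 j, ← Finset.mul_sum] at h1

/-- Once `A₀` exceeds the derivative of `λ` along `JN` on `M`, the Levi term of `pairing_crForm` is
nonnegative. -/
theorem SmoothPropertyP.propertyCRP (hCR : IsCRHypersurfaceType m M) (hcompact : IsCompact M)
    (hpsc : IsPseudoconvex M) (hqm : q + 1 ≤ m) (h : SmoothPropertyP q M) : PropertyCRP q M := by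
  obtain ⟨T, hT, hL⟩ := h.exists_global_transversal hCR hcompact hpsc hqm
  refine ⟨T, hT, hL, fun A hA => ?_⟩
  obtain ⟨U, g, hU, hMU, hg, h01, hlb⟩ := h (4 * A) (by linarith)
  have hN : ContinuousOn (normalPart M T) M := by
    have := (hCR.contDiffOn_normalPart hT).continuousOn
    rwa [Set.inter_univ] at this
  have hcont : ContinuousOn (fun z => fderiv ℝ g z (J n (normalPart M T z))) M :=
    ((hg.continuousOn_fderiv_of_isOpen hU (by simp)).mono hMU).clm_apply
      ((J n).continuous.comp_continuousOn hN)
  obtain ⟨A₀, hA₀⟩ := (hcompact.image_of_continuousOn hcont).bddAbove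
  refine ⟨U, g, A₀, hU, hMU, hg, h01, fun z hz L hLo hLz => ?_⟩
  have hg2 : ContDiffAt ℝ 2 g z := (hg.contDiffAt (hU.mem_nhds (hMU hz))).of_le two_le_infty
  have h1 : ∀ j, (1 / 4) * jHess g z (L j) (L j) ≤
      (pairing (crForm M T g A₀ z) (vec10 (L j)) (vec01 (L j))).re := by
    intro j
    have hX := hCR.isSection_proj (L j)
    have h3 := hCR.pairing_crForm hz hT hg2 A₀ hX
    simp only [proj_eq_self (hLz j)] at h3
    rw [h3]
    have h4 := hA₀ (Set.mem_image_of_mem _ hz)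
    have h5 := mul_nonneg (sub_nonneg.2 h4) (hL z ⟨hz, trivial⟩ _ hX)
    linarith
  have h2 := hlb z hz L hLo
  rw [Complex.re_sum]
  refine le_trans ?_ (Finset.sum_le_sum fun j _ => h1 j)
  rw [← Finset.mul_sum]
  linarith

end CRForm

end CRSub

theorem proposition2 {n m q : ℕ} (M : Set (CRSub.Cn n)) (hcompact : IsCompact M)
    (hCR : CRSub.IsCRHypersurfaceType m M) (hpsc : CRSub.IsPseudoconvex M)
    (hq : 1 ≤ q) (hqm : q + 1 ≤ m) :
    (CRSub.PropertyPNull q M ↔ CRSub.PropertyP q M) ∧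
      (CRSub.IsOrientable (2 * m - 1) M →
        [CRSub.PropertyPNull q M, CRSub.PropertyP q M, CRSub.PropertyCRP q M].TFAE) := by
  have h12 : CRSub.PropertyPNull q M ↔ CRSub.PropertyP q M :=
    ⟨fun h => (h.smoothPropertyP hCR hcompact hpsc).propertyP hq,
      fun h => (h.smoothPropertyP hq hcompact).propertyPNull⟩
  refine ⟨h12, fun _ => ?_⟩
  tfae_have 1 ↔ 2 := h12
  tfae_have 1 → 3 := fun h => (h.smoothPropertyP hCR hcompact hpsc).propertyCRP hCR hcompact hpsc hqm
  tfae_have 3 → 1 := fun h => h.propertyPNull hCR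
  tfae_finish
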